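/- Let $L>0$, $n_0>0$, and consider a linear destination $[0,L]$. All fields are scalar, complex-valued, jointly (circularly symmetric, zero-mean) Gaussian random fields, $\log$ is the natural logarithm, and the mutual information $I(X;Y)$ is the Kullback–Leibler divergence of the joint law of $(X,Y)$ from the product of the laws of $X$ and $Y$. The noise $N$ is circularly symmetric complex white Gaussian noise of level $n_0/2$ on $[0,L]$, i.e. $\mathbb E[N(r)N(r')^*]=\frac{n_0}{2}\delta(r-r')$; as a generalized random field it is a circularly symmetric Gaussian family $(N(f))_{f\in L^2([0,L];\mathbb C)}$ with $\mathbb E[N(f)N(h)^*]=\frac{n_0}{2}\int_0^L f(r)h(r)^*\,dr$. For a random field $E$ on $[0,L]$, with $R_E(r,r')=\mathbb E[E(r)E(r')^*]$, the received field is $Y=E+N$, that is, $Y(f)=\int_0^L f(r)E(r)\,dr+N(f)$ for $f\in L^2([0,L];\mathbb C)$. A Mercer expansion of $R_E$ consists of real numbers $\lambda_k$ and functions $\phi_k\in L^2([0,L];\mathbb C)$, $k=1,2,\dots$, with $$\int_0^L\phi_j(r)\phi_k(r)^*\,dr=\delta_{jk},\qquad \int_0^L R_E(r',r)\phi_k(r)\,dr=\lambda_k\phi_k(r'),\qquad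 R_E(r,r')=\sum_{k=1}^{\infty}\lambda_k\phi_k(r)\phi_k(r')^*$$ for all $r,r'\in[0,L]$. (a) Let $E$ be a jointly measurable, circularly symmetric complex Gaussian random field on $[0,L]$ with continuous $R_E$, independent of $N$. Then $R_E$ has a Mercer expansion, and for every Mercer expansion of $R_E$ the mutual information $I(E;Y)$ is finite and $$I(E;Y)=\sum_{k=1}^{\infty}\log\Bigl(1+\frac{\lambda_k}{n_0/2}\Bigr).$$ (b) Let the source occupy a measurable part $S\subseteq\mathbb R$ of a line parallel to the destination at distance $d>0$ (for instance $S=[0,L]$ or $S=\mathbb R$), and let its current density $J$ be a jointly measurable, circularly symmetric complex Gaussian random field on $S$, independent of $N$, with $\int_S \frac{\mathbb E|J(s)|^2}{1+s^2}\,ds<\infty$ (which holds if $S$ is bounded and $J$ has finite power $\int_S\mathbb E|J(s)|^2ds$, and if $J$ is stationary). Let $E(r)=\int_S g(r-s)J(s)\,ds$, where, for wavelength $\lambda>0$, $Z_0\in\mathbb R$ and $\rho=\sqrt{x^2+d^2}$, $$g(x)=\frac{-\mathrm j Z_0e^{\mathrm j2\pi\rho/\lambda}}{2\lambda\rho}\left[\frac{d^2}{\rho^2}+\frac{\mathrm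 j}{2\pi\rho/\lambda}\,\frac{d^2-2x^2}{\rho^2}-\frac{1}{(2\pi/\lambda)^2\rho^2}\,\frac{d^2-2x^2}{\rho^2}\right].$$ Then $R_E$ has a Mercer expansion, and for every Mercer expansion of $R_E$ the mutual information $I(J;Y)$ between source and destination is finite and $$I(J;Y)=\sum_{k=1}^{\infty}\log\Bigl(1+\frac{\lambda_k}{n_0/2}\Bigr).$$ -/

import Mathlib

open MeasureTheory ProbabilityTheory
open scoped ENNReal ComplexConjugate

-- Subsets of the line carry Lebesgue measure.
attribute [local instance] Measure.Subtype.measureSpace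

namespace EMCapacity

/-- The linear destination of length `L`, the segment `[0, L]` with Lebesgue measure. -/
abbrev Destination (L : ℝ) : Type := Set.Icc (0 : ℝ) L

/-- Square-integrable complex test functions on the destination. -/
abbrev TestFun (L : ℝ) : Type := Lp ℂ 2 (volume : Measure (Destination L))

section Probability

variable {Ω : Type*} [MeasurableSpace Ω]

/-- Mutual information, in nats, of two random elements: the Kullback-Leibler divergence of their
joint law from the product of their laws. -/
noncomputable def mutualInfo {α β : Type*} [MeasurableSpace α] [MeasurableSpace β]
    (X : Ω → α) (Y : Ω → β) (P : Measure Ω) : ℝ≥0∞ :=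
  InformationTheory.klDiv (P.map (fun ω => (X ω, Y ω))) ((P.map X).prod (P.map Y))

/-- A zero-mean circularly symmetric complex Gaussian random field: jointly Gaussian, centred, and
with vanishing pseudo-covariance. -/
structure IsCircularGaussian {T : Type*} (X : T → Ω → ℂ) (P : Measure Ω) : Prop where
  gaussian : IsGaussianProcess X P
  mean_zero : ∀ t, ∫ ω, X t ω ∂P = 0
  pseudoCov_zero : ∀ s t, ∫ ω, X s ω * X t ω ∂P = 0

/-- The autocorrelation function `R_X(s, t) = E[X(s) X(t)*]`. -/
noncomputable def autocorr {T : Type*} (X : T → Ω → ℂ) (P : Measure Ω) (s t : T) : ℂ :=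
  ∫ ω, X s ω * conj (X t ω) ∂P

/-- White circularly symmetric complex Gaussian noise of level `σ2` on the destination, as a
generalized random field: `W f` stands for `∫ f(r) N(r) dr`, where `N` has autocorrelation
`E[N(r) N(r')*] = σ2 δ(r - r')`, so that `E[W(f) W(h)*] = σ2 ∫ f(r) h(r)* dr`. -/
structure IsWhiteNoise (L σ2 : ℝ) (W : TestFun L → Ω → ℂ) (P : Measure Ω) : Prop where
  measurable : ∀ f, Measurable (W f)
  circularGaussian : IsCircularGaussian W P
  autocorr_eq : ∀ f h : TestFun L, autocorr W P f h = (σ2 : ℂ) * ∫ r, f r * conj (h r)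

/-- The received field `Y = E + N`, observed through all test functions:
`Y(f) = ∫ f(r) E(r) dr + ∫ f(r) N(r) dr`. -/
noncomputable def received {L : ℝ} (E : Destination L → Ω → ℂ) (W : TestFun L → Ω → ℂ)
    (ω : Ω) (f : TestFun L) : ℂ :=
  (∫ r, f r * E r ω) + W f ω

end Probability

/-- `(lam k, φ k)` is a Mercer expansion of the kernel `R` on `[0, L]`: the `φ k` are orthonormal in
`L²([0, L])`, they are eigenfunctions of the integral operator with kernel `R` for the eigenvalues
`lam k`, and `R(r, r') = ∑ lam k * φ k (r) * φ k (r')*` at all points. -/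
structure IsMercerExpansion {L : ℝ} (R : Destination L → Destination L → ℂ)
    (lam : ℕ → ℝ) (φ : ℕ → Destination L → ℂ) : Prop where
  memLp : ∀ k, MemLp (φ k) 2 volume
  orthonormal : ∀ j k, ∫ r, φ j r * conj (φ k r) = if j = k then 1 else 0
  eigen : ∀ k r', ∫ r, R r' r * φ k r = (lam k : ℂ) * φ k r'
  expansion : ∀ r r', HasSum (fun k => (lam k : ℂ) * φ k r * conj (φ k r')) (R r r')

/-- The scalar Green function between parallel lines at distance `d`, for wavelength `wl` and
free-space impedance `Z₀`, as a function of the displacement `x = r - s` along the lines. -/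
noncomputable def green (Z₀ wl d x : ℝ) : ℂ :=
  let ρ : ℝ := Real.sqrt (x ^ 2 + d ^ 2);
  let κ₀ : ℝ := 2 * Real.pi / wl;
  (-Complex.I * Z₀ * Complex.exp (Complex.I * κ₀ * ρ)) / (2 * wl * ρ) *
    ((d ^ 2 / ρ ^ 2 : ℝ)
      + Complex.I / (κ₀ * ρ : ℝ) * ((d ^ 2 - 2 * x ^ 2) / ρ ^ 2 : ℝ)
      - (1 / (κ₀ ^ 2 * ρ ^ 2) * ((d ^ 2 - 2 * x ^ 2) / ρ ^ 2) : ℝ))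

/-- The electric field `E(r) = ∫_S g(r - s) J(s) ds` on the destination that is induced by a current
density `J` on the part `S` of the source line. -/
noncomputable def inducedField {Ω : Type*} (L Z₀ wl d : ℝ) {S : Set ℝ} (J : S → Ω → ℂ)
    (r : Destination L) (ω : Ω) : ℂ :=
  ∫ s : S, green Z₀ wl d ((r : ℝ) - (s : ℝ)) * J s ω

end EMCapacity

/-! Let `A f = ∫ f(r) E(r) dr` be the signal operator from test functions to `L²(P)`, and let `σ2 =
n₀/2`. The operator `A* A` has kernel `R_E(r', r)`, so the conjugates of the Mercer eigenfunctions
are eigenvectors of it. They make the signal covariance `⟨A f, A g⟩` and the noise covariance `σ2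
⟨f, g⟩` diagonal at once. The channel thereby splits into independent scalar Gaussian channels with
signal variance `λ_k` and noise variance `σ2`, each carrying `log (1 + λ_k / σ2)` nats. The
eigenfunctions need not be complete: on their orthogonal complement `A` vanishes
(`IsMercerExpansion.op_eq_zero`), and the output there is noise independent of the source.

With infinitely many scalar channels, the density of the joint law with respect to the product law
is an infinite product of Gaussian density ratios. Under the product law the factors are
independent, with mean `1` and second moment `1 + l_k / v`. Since the eigenvalues are summable
(`IsMercerExpansion.summable`), the partial products converge in `L²`. The divergence of the limit
is the sum of the scalar ones: Fatou gives one inequality, the tangent bound for the entropy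
function the other (`exists_density_of_iIndepFun`). Characteristic functions identify the limit with
the density of the joint law (`tendsto_integral_prod_gaussRatio`, `klDiv_ne_top_and_hasSum`).

This is done over the reals and applied to real parts: each complex direction `ψ` yields the two
real directions `ψ` and `i ψ`, with all variances halved, hence twice half of the logarithm.

Existence of a Mercer expansion comes from the spectral theorem for the compact operator `A* A` and
mean-square continuity (`exists_isMercerExpansion`). Both halves of the theorem are instances of
`IsFieldChannel`, with source `E` or `J`; the source enters only as the carrier of the signal. For
the current, the decay of the Green function makes the induced field mean-square continuous. -/

namespace EMCapacity

/-! ### The scalar Gaussian channel. -/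

section GaussianRatio

open scoped NNReal

/-- The density of `N(a, v)` with respect to `N(0, l + v)`. -/
noncomputable def gaussRatio (l v : ℝ≥0) (a y : ℝ) : ℝ :=
  gaussianPDFReal a v y / gaussianPDFReal 0 (l + v) y

lemma gaussRatio_pos {l v : ℝ≥0} (hv : v ≠ 0) (a y : ℝ) : 0 < gaussRatio l v a y :=
  div_pos (gaussianPDFReal_pos _ _ _ hv) (gaussianPDFReal_pos _ _ _ (by positivity))

lemma measurable_gaussRatio (l v : ℝ≥0) : Measurable (Function.uncurry (gaussRatio l v)) := by
  unfold gaussRatio gaussianPDFReal Function.uncurry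
  fun_prop

lemma integral_gaussRatio_smul {E : Type*} [NormedAddCommGroup E] [NormedSpace ℝ E]
    {l v : ℝ≥0} (hv : v ≠ 0) (a : ℝ) (f : ℝ → E) :
    ∫ y, gaussRatio l v a y • f y ∂(gaussianReal 0 (l + v)) = ∫ y, f y ∂(gaussianReal a v) := by
  rw [integral_gaussianReal_eq_integral_smul (by positivity),
    integral_gaussianReal_eq_integral_smul hv]
  congr with y
  have := (gaussianPDFReal_pos 0 (l + v) y (by positivity)).ne'
  rw [smul_smul, gaussRatio, mul_div_cancel₀ _ this]

lemma log_gaussRatio {l v : ℝ≥0} (hv : v ≠ 0) (a y : ℝ) :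
    Real.log (gaussRatio l v a y)
      = Real.log (1 + l / v) / 2 - (y - a) ^ 2 / (2 * v) + y ^ 2 / (2 * (l + v)) := by
  have hv' : (0 : ℝ) < v := by positivity
  have hl : (0 : ℝ) ≤ l := l.2
  have hlv : (0 : ℝ) < l + v := by positivity
  have e : (1 + l / v : ℝ) = (l + v) / v := by field_simp; ring
  simp only [gaussRatio, gaussianPDFReal]
  rw [Real.log_div (by positivity) (by push_cast; positivity),
    Real.log_mul (by positivity) (by positivity),
    Real.log_mul (by push_cast; positivity) (by positivity), Real.log_inv, Real.log_inv,
    Real.log_sqrt (by positivity), Real.log_sqrt (by positivity), Real.log_exp, Real.log_exp, e,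
    Real.log_div (by positivity) (by positivity)]
  push_cast
  rw [Real.log_mul (x := 2 * Real.pi) (y := v) (by positivity) (by positivity),
    Real.log_mul (x := 2 * Real.pi) (y := l + v) (by positivity) (by positivity)]
  ring

/-- Completing the square in `a`: the total precision `1 / l + 2 / v` gives the variance `l v / (2 l
+ v)` and the centre `2 l y / (2 l + v)`. Both densities on the right integrate to one, which leaves
`1 + l / v` as the second moment of the ratio. -/
lemma gaussianPDFReal_mul_gaussRatio_sq {l v : ℝ≥0} (hl : l ≠ 0) (hv : v ≠ 0) (a y : ℝ) :
    gaussianPDFReal 0 l a * (gaussianPDFReal 0 (l + v) y * gaussRatio l v a y ^ 2)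
      = (1 + l / v) * (gaussianPDFReal 0 ((2 * l + v) * (l + v) / v) y *
        gaussianPDFReal (2 * l / (2 * l + v) * y) (l * v / (2 * l + v)) a) := by
  have hv' : (0 : ℝ) < v := by positivity
  have hl' : (0 : ℝ) < l := by positivity
  have hpi := Real.pi_pos
  simp only [gaussRatio, gaussianPDFReal]
  push_cast
  have key : ∀ A B C D F x y z w u : ℝ, B ≠ 0 → A * Real.exp x * (B * Real.exp y *
      (C * Real.exp z / (B * Real.exp y)) ^ 2) =
      A * C ^ 2 / B * Real.exp (x + 2 * z - y) := by
    intro A B C D F x y z w u hB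
    rw [Real.exp_sub, Real.exp_add, two_mul z, Real.exp_add]
    field_simp
  rw [key _ _ _ 0 0 _ _ _ 0 0 (by positivity)]
  have key2 : ∀ A B C x y : ℝ, C * (A * Real.exp x * (B * Real.exp y))
      = C * A * B * Real.exp (x + y) := by
    intro A B C x y; rw [Real.exp_add]; ring
  rw [key2]
  congr 1
  · rw [← Real.sqrt_inv, ← Real.sqrt_inv, ← Real.sqrt_inv, ← Real.sqrt_inv, ← Real.sqrt_inv,
      Real.sq_sqrt (by positivity), div_eq_iff (by positivity)]
    have : ((2 * Real.pi * (l : ℝ))⁻¹) = ((2 * Real.pi * ((2 * l + v) * (l + v) / v))⁻¹) *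
      ((2 * Real.pi * (l * v / (2 * l + v)))⁻¹) * ((2 * Real.pi * (l + v))⁻¹) *
      (2 * Real.pi * (l + v)) ^ 2 := by field_simp
    rw [this, Real.sqrt_mul (by positivity), Real.sqrt_mul (by positivity),
      Real.sqrt_mul (by positivity), Real.sqrt_sq (by positivity)]
    field_simp
    ring
  · congr 1
    field_simp
    ring

variable (l v : ℝ≥0)

lemma lintegral_gaussRatio_sq (hv : v ≠ 0) :
    ∫⁻ z, ENNReal.ofReal (gaussRatio l v z.1 z.2 ^ 2)
      ∂((gaussianReal 0 l).prod (gaussianReal 0 (l + v))) = ENNReal.ofReal (1 + l / v) := by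
  have hm : Measurable fun z : ℝ × ℝ => ENNReal.ofReal (gaussRatio l v z.1 z.2 ^ 2) :=
    ((measurable_gaussRatio l v).pow_const 2).ennreal_ofReal
  -- For `l = 0` the first factor is a Dirac mass without a Lebesgue density; there the ratio at `a
  -- = 0` is `1`.
  rcases eq_or_ne l 0 with rfl | hl
  · rw [lintegral_prod _ hm.aemeasurable, gaussianReal_zero_var,
      lintegral_dirac' _ hm.lintegral_prod_right']
    have h (y : ℝ) : gaussRatio 0 v 0 y = 1 := by
      rw [gaussRatio, zero_add, div_self (gaussianPDFReal_pos _ _ _ hv).ne']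
    simp [h]
  · have hlv : l + v ≠ 0 := by positivity
    have hs : l * v / (2 * l + v) ≠ 0 := by positivity
    have ht : (2 * l + v) * (l + v) / v ≠ 0 := by positivity
    rw [gaussianReal_of_var_ne_zero _ hl, gaussianReal_of_var_ne_zero _ hlv,
      prod_withDensity (measurable_gaussianPDF _ _) (measurable_gaussianPDF _ _),
      lintegral_withDensity_eq_lintegral_mul _ (by fun_prop) hm]
    have e (z : ℝ × ℝ) : ((fun z : ℝ × ℝ => gaussianPDF 0 l z.1 * gaussianPDF 0 (l + v) z.2) *
        fun z : ℝ × ℝ => ENNReal.ofReal (gaussRatio l v z.1 z.2 ^ 2)) z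
        = ENNReal.ofReal (1 + l / v) * (gaussianPDF 0 ((2 * l + v) * (l + v) / v) z.2 *
          gaussianPDF (2 * l / (2 * l + v) * z.2) (l * v / (2 * l + v)) z.1) := by
      simp only [Pi.mul_apply, gaussianPDF]
      rw [mul_assoc, ← ENNReal.ofReal_mul (gaussianPDFReal_nonneg _ _ _),
        ← ENNReal.ofReal_mul (gaussianPDFReal_nonneg _ _ _),
        gaussianPDFReal_mul_gaussRatio_sq hl hv, ENNReal.ofReal_mul (by positivity),
        ENNReal.ofReal_mul (gaussianPDFReal_nonneg _ _ _)]
    simp_rw [e]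
    have hm' : Measurable fun z : ℝ × ℝ => gaussianPDF 0 ((2 * l + v) * (l + v) / v) z.2 *
          gaussianPDF (2 * l / (2 * l + v) * z.2) (l * v / (2 * l + v)) z.1 := by
      unfold gaussianPDF gaussianPDFReal
      fun_prop
    rw [lintegral_const_mul _ hm', lintegral_prod_symm _ hm'.aemeasurable]
    have e2 (y : ℝ) : ∫⁻ x, gaussianPDF 0 ((2 * l + v) * (l + v) / v) y *
          gaussianPDF (2 * l / (2 * l + v) * y) (l * v / (2 * l + v)) x
          = gaussianPDF 0 ((2 * l + v) * (l + v) / v) y := by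
      rw [lintegral_const_mul _ (measurable_gaussianPDF _ _), lintegral_gaussianPDF_eq_one _ hs,
        mul_one]
    simp only [e2]
    rw [lintegral_gaussianPDF_eq_one _ ht, mul_one]

lemma memLp_gaussRatio (hv : v ≠ 0) :
    MemLp (fun z : ℝ × ℝ => gaussRatio l v z.1 z.2) 2
      ((gaussianReal 0 l).prod (gaussianReal 0 (l + v))) := by
  rw [← integrable_norm_rpow_iff
    (by exact (measurable_gaussRatio l v).aestronglyMeasurable) two_ne_zero
    ENNReal.ofNat_ne_top]
  refine ⟨((measurable_gaussRatio l v).norm.pow_const _).aestronglyMeasurable, ?_⟩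
  rw [hasFiniteIntegral_iff_ofReal (by filter_upwards with z using by positivity)]
  have := lintegral_gaussRatio_sq l v hv
  simp only [ENNReal.toReal_ofNat, Real.norm_eq_abs, Real.rpow_two, sq_abs]
  rw [this]
  exact ENNReal.ofReal_lt_top

lemma integral_gaussRatio_sq (hv : v ≠ 0) :
    ∫ z, gaussRatio l v z.1 z.2 ^ 2 ∂((gaussianReal 0 l).prod (gaussianReal 0 (l + v)))
      = 1 + l / v := by
  rw [integral_eq_lintegral_of_nonneg_ae (by filter_upwards with z using by positivity)
    (by exact ((measurable_gaussRatio l v).pow_const 2).aestronglyMeasurable),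
    lintegral_gaussRatio_sq l v hv,
    ENNReal.toReal_ofReal (by positivity)]

lemma integral_gaussRatio (hv : v ≠ 0) :
    ∫ z, gaussRatio l v z.1 z.2 ∂((gaussianReal 0 l).prod (gaussianReal 0 (l + v))) = 1 := by
  rw [integral_prod (fun z : ℝ × ℝ => gaussRatio l v z.1 z.2)
    ((memLp_gaussRatio l v hv).integrable one_le_two)]
  have (a : ℝ) := integral_gaussRatio_smul (l := l) hv a (fun _ => (1 : ℝ))
  simp only [smul_eq_mul, mul_one, integral_const, probReal_univ] at this
  simp [this]

/-- The logarithm is a quadratic polynomial, so fourth moments of Gaussians suffice. -/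
lemma memLp_log_gaussRatio (hv : v ≠ 0) :
    MemLp (fun z : ℝ × ℝ => Real.log (gaussRatio l v z.1 z.2)) 2
      ((gaussianReal 0 l).prod (gaussianReal 0 (l + v))) := by
  simp_rw [log_gaussRatio hv]
  have h1 : MemLp (fun z : ℝ × ℝ => z.1) 4 ((gaussianReal 0 l).prod (gaussianReal 0 (l + v))) :=
    (memLp_id_gaussianReal' 4 (by simp)).comp_measurePreserving measurePreserving_fst
  have h2 : MemLp (fun z : ℝ × ℝ => z.2) 4 ((gaussianReal 0 l).prod (gaussianReal 0 (l + v))) :=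
    (memLp_id_gaussianReal' 4 (by simp)).comp_measurePreserving measurePreserving_snd
  have hsq {f : ℝ × ℝ → ℝ} (hf : MemLp f 4 ((gaussianReal 0 l).prod (gaussianReal 0 (l + v)))) :
      MemLp (fun z => f z ^ 2) 2 ((gaussianReal 0 l).prod (gaussianReal 0 (l + v))) := by
    have : ENNReal.HolderTriple 4 4 2 := ⟨by
      rw [← two_mul, show (4 : ℝ≥0∞) = 2 * 2 by norm_num,
        ENNReal.mul_inv (by simp) (by simp), ← mul_assoc,
        ENNReal.mul_inv_cancel (by simp) (by simp), one_mul]⟩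
    simp_rw [pow_two]
    exact hf.mul hf
  have h3 := (hsq (h2.sub h1)).mul_const (2 * (v : ℝ))⁻¹
  have h4 := (hsq h2).mul_const (2 * ((l : ℝ) + v))⁻¹
  have h5 : MemLp (fun _ : ℝ × ℝ => Real.log (1 + l / v) / 2) 2
    ((gaussianReal 0 l).prod (gaussianReal 0 (l + v))) := memLp_const _
  exact (h5.sub h3).add h4

lemma integral_sq_gaussianReal (a : ℝ) : ∫ y, y ^ 2 ∂(gaussianReal a v) = v + a ^ 2 := by
  have h := variance_eq_sub (memLp_id_gaussianReal' (μ := a) (v := v) 2 (by simp))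
  simp only [variance_id_gaussianReal, id, integral_id_gaussianReal] at h
  simp only [Pi.pow_apply, id] at h
  linarith

lemma integral_gaussRatio_mul_log (hv : v ≠ 0) :
    ∫ z, gaussRatio l v z.1 z.2 * Real.log (gaussRatio l v z.1 z.2)
      ∂((gaussianReal 0 l).prod (gaussianReal 0 (l + v))) = Real.log (1 + l / v) / 2 := by
  have hv' : (0 : ℝ) < v := by positivity
  have hl : (0 : ℝ) ≤ l := l.2
  have hsq (a : ℝ) (s : ℝ≥0) : Integrable (fun y : ℝ => y ^ 2) (gaussianReal a s) :=
    (memLp_id_gaussianReal' 2 (by simp)).integrable_sq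
  rw [integral_prod (fun z : ℝ × ℝ => gaussRatio l v z.1 z.2 * Real.log (gaussRatio l v z.1 z.2))
    ((memLp_gaussRatio l v hv).integrable_mul (memLp_log_gaussRatio l v hv))]
  -- For fixed `a` this is the divergence of `N(a, v)` from `N(0, l + v)`. Averaging over `a` turns
  -- the last term into `1 / 2`, which cancels the `- 1 / 2`.
  have h1 (a : ℝ) : ∫ y, gaussRatio l v a y * Real.log (gaussRatio l v a y)
      ∂(gaussianReal 0 (l + v))
        = Real.log (1 + l / v) / 2 - 1 / 2 + (v + a ^ 2) / (2 * (l + v)) := by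
    have := integral_gaussRatio_smul (l := l) hv a (fun y => Real.log (gaussRatio l v a y))
    simp only [smul_eq_mul] at this
    rw [this]
    simp_rw [log_gaussRatio hv]
    have h3 : ∫ y, (y - a) ^ 2 ∂(gaussianReal a v) = v := by
      have h := variance_eq_integral (X := id) (μ := gaussianReal a v) aemeasurable_id
      simpa only [variance_id_gaussianReal, id, integral_id_gaussianReal] using h.symm
    have h4 : Integrable (fun y : ℝ => (y - a) ^ 2) (gaussianReal a v) :=
      ((memLp_id_gaussianReal' 2 (by simp)).sub (memLp_const a)).integrable_sq
    have h5 : Integrable (fun y : ℝ => Real.log (1 + l / v) / 2 - (y - a) ^ 2 / (2 * v))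
        (gaussianReal a v) := (integrable_const _).sub (h4.div_const _)
    rw [integral_add h5 ((hsq _ _).div_const _),
      integral_sub (integrable_const _) (h4.div_const _), integral_div, integral_div,
      integral_div, h3,
      integral_sq_gaussianReal]
    simp
    field_simp
  simp_rw [h1]
  have h6 : Integrable (fun y : ℝ => (v : ℝ) + y ^ 2) (gaussianReal 0 l) :=
    (integrable_const _).add (hsq _ _)
  rw [integral_add (integrable_const _) (h6.div_const _),
    integral_div, integral_add (integrable_const _) (hsq _ _), integral_sq_gaussianReal]
  simp
  field_simp
  ring

end GaussianRatio

/-! ### Infinite products of independent densities. -/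

section ProductDensity

open Filter Topology InformationTheory

variable {Z : Type*} [MeasurableSpace Z] {ν : Measure Z}

lemma integral_prod_range_comp {𝕜 : Type*} [RCLike 𝕜] {β : Type*} [MeasurableSpace β]
    {ξ : ℕ → Z → β} (hind : iIndepFun ξ ν) (hm : ∀ k, AEMeasurable (ξ k) ν)
    {g : ℕ → β → 𝕜} (hg : ∀ k, Measurable (g k)) (n : ℕ) :
    ∫ z, ∏ k ∈ Finset.range n, g k (ξ k z) ∂ν
      = ∏ k ∈ Finset.range n, ∫ z, g k (ξ k z) ∂ν := by
  simp_rw [Finset.prod_range]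
  exact (hind.precomp (g := (Fin.val : Fin n → ℕ)) Fin.val_injective).integral_fun_prod_comp
    (f := fun k : Fin n => g k) (fun k => hm k) (fun k => (hg k).aestronglyMeasurable)

variable {ξ : ℕ → Z → ℝ}

lemma memLp_prod_range [IsProbabilityMeasure ν] (hind : iIndepFun ξ ν) (hm : ∀ k, Measurable (ξ k))
    (h2 : ∀ k, MemLp (ξ k) 2 ν) (n : ℕ) :
    MemLp (fun z => ∏ k ∈ Finset.range n, ξ k z) 2 ν := by
  induction n with
  | zero => simpa using memLp_const (1 : ℝ)
  | succ n ih =>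
    have hD : Measurable fun z => ∏ k ∈ Finset.range n, ξ k z := by fun_prop
    simp_rw [Finset.prod_range_succ]
    rw [memLp_two_iff_integrable_sq (by fun_prop)]
    have hi : IndepFun (fun z => (∏ k ∈ Finset.range n, ξ k z) ^ 2) (fun z => ξ n z ^ 2) ν := by
      have := (hind.indepFun_finsetProd_of_notMem hm (s := Finset.range n) (i := n) (by simp)).comp
        (φ := fun x : ℝ => x ^ 2) (ψ := fun x : ℝ => x ^ 2) (by fun_prop) (by fun_prop)
      simpa [Function.comp_def] using this
    simp_rw [mul_pow]
    exact hi.integrable_mul ih.integrable_sq (h2 n).integrable_sq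

/-- Indices below `n` occur twice and contribute a second moment, the others contribute a mean `1`.
This is the orthogonality of martingale increments. -/
lemma integral_prod_range_mul_prod_range (hind : iIndepFun ξ ν) (hm : ∀ k, Measurable (ξ k))
    (h1 : ∀ k, ∫ z, ξ k z ∂ν = 1) {q : ℕ → ℝ} (hq : ∀ k, ∫ z, ξ k z ^ 2 ∂ν = q k)
    {n m : ℕ} (hnm : n ≤ m) :
    ∫ z, (∏ k ∈ Finset.range n, ξ k z) * ∏ k ∈ Finset.range m, ξ k z ∂ν
      = ∏ k ∈ Finset.range n, q k := by
  have h := integral_prod_range_comp (𝕜 := ℝ) hind (fun k => (hm k).aemeasurable)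
    (g := fun k x => (if k < n then x else 1) * x) (fun k => by split_ifs <;> fun_prop) m
  have e (f : ℕ → ℝ) : ∏ k ∈ Finset.range m, (if k < n then f k else 1)
      = ∏ k ∈ Finset.range n, f k := by
    rw [← Finset.prod_filter]
    congr 1
    ext k
    simp only [Finset.mem_filter, Finset.mem_range]
    omega
  simp_rw [Finset.prod_mul_distrib, e] at h
  rw [h, ← e]
  refine Finset.prod_congr rfl fun k _ => ?_
  split_ifs
  · simp_rw [← hq, pow_two]
  · simp [h1]

/-- All factors but the one of index `j` integrate to `1`, so the value does not depend on `m > j`.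
-/
lemma integral_log_mul_prod_range (hind : iIndepFun ξ ν) (hm : ∀ k, Measurable (ξ k))
    (h1 : ∀ k, ∫ z, ξ k z ∂ν = 1) {j m : ℕ} (hjm : j < m) :
    ∫ z, Real.log (ξ j z) * ∏ k ∈ Finset.range m, ξ k z ∂ν
      = ∫ z, ξ j z * Real.log (ξ j z) ∂ν := by
  have h := integral_prod_range_comp (𝕜 := ℝ) hind (fun k => (hm k).aemeasurable)
    (g := fun k x => (if k = j then Real.log x else 1) * x)
    (fun k => by split_ifs <;> fun_prop) m
  have e (f : ℕ → ℝ) : ∏ k ∈ Finset.range m, (if k = j then f k else 1) = f j := by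
    rw [Finset.prod_ite_eq' (Finset.range m) j, if_pos (by simpa using hjm)]
  simp_rw [Finset.prod_mul_distrib, e] at h
  rw [h, ← e (fun k => ∫ z, ξ k z * Real.log (ξ k z) ∂ν)]
  refine Finset.prod_congr rfl fun k _ => ?_
  split_ifs
  · simp_rw [mul_comm]
  · simp [h1]

/-- The bound between a value of the entropy function and its tangents. -/
lemma mul_log_add_one_sub_le_klFun {x y : ℝ} (hx : 0 < x) (hy : 0 ≤ y) :
    y * Real.log x + 1 - x ≤ klFun y := by
  rw [klFun_apply]
  rcases hy.eq_or_lt with rfl | hy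
  · simp [hx.le]
  · have h := Real.log_le_sub_one_of_pos (div_pos hx hy)
    rw [Real.log_div hx.ne' hy.ne'] at h
    have := mul_le_mul_of_nonneg_left h hy.le
    have e : y * (x / y - 1) = x - y := by field_simp
    linarith

/-- A product of independent densities with a convergent product of second moments converges to a
density, whose Kullback-Leibler divergence is the sum of those of the factors. -/
theorem exists_density_of_iIndepFun [IsProbabilityMeasure ν] (hind : iIndepFun ξ ν)
    (hm : ∀ k, Measurable (ξ k))
    (hpos : ∀ k z, 0 < ξ k z) (h2 : ∀ k, MemLp (ξ k) 2 ν)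
    (hlog : ∀ k, MemLp (fun z => Real.log (ξ k z)) 2 ν) (h1 : ∀ k, ∫ z, ξ k z ∂ν = 1)
    {s I : ℕ → ℝ} (hq : ∀ k, ∫ z, ξ k z ^ 2 ∂ν = 1 + s k) (hs : Summable s)
    (hI : ∀ k, ∫ z, ξ k z * Real.log (ξ k z) ∂ν = I k) (hIs : Summable I) :
    ∃ D : Z → ℝ, Measurable D ∧ (∀ z, 0 ≤ D z) ∧ Integrable D ν ∧
      (∀ h : Z → ℂ, Measurable h → (∀ z, ‖h z‖ ≤ 1) →
        Tendsto (fun n => ∫ z, h z * ((∏ k ∈ Finset.range n, ξ k z : ℝ) : ℂ) ∂ν) atTop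
          (𝓝 (∫ z, h z * (D z : ℂ) ∂ν))) ∧
      klDiv (ν.withDensity fun z => ENNReal.ofReal (D z)) ν ≠ ∞ ∧
      HasSum I (klDiv (ν.withDensity fun z => ENNReal.ofReal (D z)) ν).toReal := by
  set G : ℕ → Z → ℝ := fun n z => ∏ k ∈ Finset.range n, ξ k z with hG
  have hGm (n : ℕ) : Measurable (G n) := by fun_prop
  have hGpos (n : ℕ) (z : Z) : 0 < G n z := Finset.prod_pos fun k _ => hpos k z
  have hG2 (n : ℕ) : MemLp (G n) 2 ν := memLp_prod_range hind hm h2 n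
  set q : ℕ → ℝ := fun n => ∏ k ∈ Finset.range n, (1 + s k) with hqdef
  -- Hence `‖G m - G n‖² = q m - q n` for `n ≤ m`, and convergence of the numbers `q n` makes `G`
  -- Cauchy in `L²`.
  have hinner {n m : ℕ} (hnm : n ≤ m) : inner ℝ (hG2 n).toLp (hG2 m).toLp = q n := by
    rw [L2.inner_def, hqdef]
    simp only
    rw [← integral_prod_range_mul_prod_range hind hm h1 hq hnm]
    refine integral_congr_ae ?_
    filter_upwards [(hG2 n).coeFn_toLp, (hG2 m).coeFn_toLp] with z hz1 hz2
    rw [hz1, hz2]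
    simp [hG, mul_comm]
  have hqc : CauchySeq q := by
    -- As the mean is `1`, `s k` is the variance of `ξ k`.
    have hs0 : ∀ k, 0 ≤ s k := by
      intro k
      have := variance_nonneg (ξ k) ν
      rw [variance_eq_sub (h2 k), h1] at this
      simp only [Pi.pow_apply, hq] at this
      linarith
    exact (Real.multipliable_one_add_of_summable hs).hasProd.tendsto_prod_nat.cauchySeq
  have hcauchy : CauchySeq fun n => (hG2 n).toLp := by
    rw [Metric.cauchySeq_iff'] at hqc ⊢
    intro ε hε
    obtain ⟨N, hN⟩ := hqc (ε ^ 2) (by positivity)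
    refine ⟨N, fun n hn => ?_⟩
    have h := hN n hn
    rw [Real.dist_eq] at h
    rw [dist_eq_norm]
    refine lt_of_pow_lt_pow_left₀ 2 hε.le ?_
    rw [norm_sub_sq_real, ← real_inner_self_eq_norm_sq, ← real_inner_self_eq_norm_sq,
      hinner le_rfl, hinner le_rfl, real_inner_comm, hinner hn]
    linarith [le_abs_self (q n - q N)]
  obtain ⟨d, hd⟩ := cauchySeq_tendsto_of_complete hcauchy
  have hde : Tendsto (fun n => eLpNorm (G n - (d : Z → ℝ)) 2 ν) atTop (𝓝 0) := by
    rw [Lp.tendsto_Lp_iff_tendsto_eLpNorm'] at hd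
    refine hd.congr fun n => eLpNorm_congr_ae ?_
    exact (hG2 n).coeFn_toLp.sub (ae_eq_refl _)
  -- Almost sure convergence along a subsequence gives the sign of the limit here and feeds Fatou's
  -- lemma below.
  obtain ⟨ns, hns, hae⟩ := (tendstoInMeasure_of_tendsto_eLpNorm two_ne_zero
    (fun n => (hGm n).aestronglyMeasurable) (Lp.aestronglyMeasurable d) hde).exists_seq_tendsto_ae
  have hd0 : ∀ᵐ z ∂ν, 0 ≤ d z := by
    filter_upwards [hae] with z hz
    exact ge_of_tendsto' hz fun n => (hGpos _ _).le
  -- A representative that is measurable and nonnegative everywhere, not only almost everywhere.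
  set D : Z → ℝ := fun z => max ((Lp.aestronglyMeasurable d).mk d z) 0 with hD
  have hDm : Measurable D :=
    (Lp.aestronglyMeasurable d).stronglyMeasurable_mk.measurable.max measurable_const
  have hDnn (z : Z) : 0 ≤ D z := le_max_right _ _
  have hDd : D =ᵐ[ν] d := by
    filter_upwards [hd0, (Lp.aestronglyMeasurable d).ae_eq_mk] with z h0 hz
    rw [hD]
    simp only
    rw [← hz, max_eq_left h0]
  have hD2 : MemLp D 2 ν := (memLp_congr_ae hDd).2 (Lp.memLp d)
  have hDi : Integrable D ν := hD2.integrable one_le_two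
  have hDe : Tendsto (fun n => eLpNorm (G n - D) 2 ν) atTop (𝓝 0) :=
    hde.congr fun n => eLpNorm_congr_ae ((ae_eq_refl _).sub hDd.symm)
  have hDae : ∀ᵐ z ∂ν, Tendsto (fun i => G (ns i) z) atTop (𝓝 (D z)) := by
    filter_upwards [hae, hDd] with z hz hz'
    rwa [hz']
  have hweak (h : Z → ℂ) (hhm : Measurable h) (hh : ∀ z, ‖h z‖ ≤ 1) :
      Tendsto (fun n => ∫ z, h z * (G n z : ℂ) ∂ν) atTop (𝓝 (∫ z, h z * (D z : ℂ) ∂ν)) := by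
    refine tendsto_integral_of_L1' _ ?_ ?_ ?_
    · exact (hDi.ofReal.bdd_mul hhm.aestronglyMeasurable (Eventually.of_forall hh)).1
    · exact Eventually.of_forall fun n => ((hG2 n).integrable one_le_two).ofReal.bdd_mul
        hhm.aestronglyMeasurable (Eventually.of_forall hh)
    · refine tendsto_of_tendsto_of_tendsto_of_le_of_le tendsto_const_nhds hDe (fun _ => zero_le)
        fun n => ?_
      refine (eLpNorm_le_eLpNorm_of_exponent_le one_le_two (by fun_prop)).trans
        (eLpNorm_mono fun z => ?_)
      simp only [Pi.sub_apply, ← mul_sub, ← Complex.ofReal_sub, norm_mul, Complex.norm_real]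
      exact mul_le_of_le_one_left (norm_nonneg _) (hh z)
  have hDint : ∫ z, D z ∂ν = 1 := by
    have h := hweak 1 measurable_one (by simp)
    simp only [Pi.one_apply, one_mul, integral_complex_ofReal] at h
    have h' : ∀ n, ∫ z, G n z ∂ν = 1 := by
      intro n
      have := integral_prod_range_mul_prod_range hind hm h1 hq n.zero_le
      simpa using this
    simp_rw [h'] at h
    exact_mod_cast (tendsto_nhds_unique h tendsto_const_nhds)
  -- Pairing with `log (ξ j) ∈ L²` is continuous, and along `G n` the pairing is constant once `n >
  -- j`.
  have hlogD (j : ℕ) : ∫ z, Real.log (ξ j z) * D z ∂ν = I j := by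
    have h := (tendsto_const_nhds (x := (hlog j).toLp)).inner hd (𝕜 := ℝ)
    have e (f : Lp ℝ 2 ν) : inner ℝ (hlog j).toLp f = ∫ z, Real.log (ξ j z) * f z ∂ν := by
      rw [L2.inner_def]
      refine integral_congr_ae ?_
      filter_upwards [(hlog j).coeFn_toLp] with z hz
      rw [hz]
      simp [mul_comm]
    simp_rw [e] at h
    have h' : (fun n => ∫ z, Real.log (ξ j z) * ((hG2 n).toLp (G n) : Lp ℝ 2 ν) z ∂ν) =ᶠ[atTop]
        fun _ => I j := by
      filter_upwards [eventually_gt_atTop j] with n hn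
      rw [← hI, ← integral_log_mul_prod_range hind hm h1 hn]
      refine integral_congr_ae ?_
      filter_upwards [(hG2 n).coeFn_toLp] with z hz
      rw [hz]
    have h3 := tendsto_nhds_unique (h.congr' h') tendsto_const_nhds
    rw [← h3]
    refine integral_congr_ae ?_
    filter_upwards [hDd] with z hz
    rw [hz]
  have hlogG (n : ℕ) (z : Z) : Real.log (G n z) = ∑ k ∈ Finset.range n, Real.log (ξ k z) :=
    Real.log_prod fun k _ => (hpos k z).ne'
  have hint1 (F : Z → ℝ) (hF : MemLp F 2 ν) (k : ℕ) :
      Integrable (fun z => Real.log (ξ k z) * F z) ν := (hlog k).integrable_mul hF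
  have hint2 (F : Z → ℝ) (hF : MemLp F 2 ν) (n : ℕ) :
      Integrable (fun z => F z * Real.log (G n z)) ν := by
    simp_rw [hlogG, Finset.mul_sum, mul_comm (F _)]
    exact integrable_finsetSum _ fun k _ => hint1 F hF k
  have hsumD (F : Z → ℝ) (hF : MemLp F 2 ν) (n : ℕ)
      (hFI : ∀ k < n, ∫ z, Real.log (ξ k z) * F z ∂ν = I k) :
      ∫ z, F z * Real.log (G n z) ∂ν = ∑ k ∈ Finset.range n, I k := by
    simp_rw [hlogG, Finset.mul_sum, mul_comm (F _)]
    rw [integral_finsetSum _ fun k _ => hint1 F hF k]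
    exact Finset.sum_congr rfl fun k hk => hFI k (Finset.mem_range.1 hk)
  have hGint (n : ℕ) : ∫ z, G n z ∂ν = 1 := by
    have := integral_prod_range_mul_prod_range hind hm h1 hq n.zero_le
    simpa using this
  have hklG (n : ℕ) : ∫⁻ z, ENNReal.ofReal (klFun (G n z)) ∂ν
      = ENNReal.ofReal (∑ k ∈ Finset.range n, I k) := by
    have hi : Integrable (fun z => klFun (G n z)) ν := by
      simp_rw [klFun_apply]
      exact ((hint2 _ (hG2 n) n).add (integrable_const _)).sub ((hG2 n).integrable one_le_two)
    rw [← ofReal_integral_eq_lintegral_ofReal hi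
      (Eventually.of_forall fun z => klFun_nonneg (hGpos n z).le)]
    congr 1
    simp_rw [klFun_apply]
    have hi2 : Integrable (fun z => G n z * Real.log (G n z) + 1) ν :=
      (hint2 _ (hG2 n) n).add (integrable_const _)
    rw [integral_sub hi2 ((hG2 n).integrable one_le_two),
      integral_add (hint2 _ (hG2 n) n) (integrable_const _), hGint, hsumD _ (hG2 n) n]
    · simp
    · intro k hk
      rw [integral_log_mul_prod_range hind hm h1 hk, hI]
  set μ := ν.withDensity fun z => ENNReal.ofReal (D z) with hμ
  have hfin : IsFiniteMeasure μ := isFiniteMeasure_withDensity_ofReal hDi.2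
  have hkl : klDiv μ ν = ∫⁻ z, ENNReal.ofReal (klFun (D z)) ∂ν := by
    rw [klDiv_eq_lintegral_klFun_of_ac (withDensity_absolutelyContinuous _ _)]
    refine lintegral_congr_ae ?_
    filter_upwards [Measure.rnDeriv_withDensity ν hDm.ennreal_ofReal] with z hz
    rw [hz, ENNReal.toReal_ofReal (hDnn z)]
  -- Upper bound by Fatou, as `klFun` is continuous and nonnegative at the values `G n z`.
  have hup : klDiv μ ν ≤ ENNReal.ofReal (∑' k, I k) := by
    rw [hkl]
    calc ∫⁻ z, ENNReal.ofReal (klFun (D z)) ∂ν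
        = ∫⁻ z, liminf (fun i => ENNReal.ofReal (klFun (G (ns i) z))) atTop ∂ν := by
          refine lintegral_congr_ae ?_
          filter_upwards [hDae] with z hz
          exact (Tendsto.liminf_eq (ENNReal.tendsto_ofReal
            ((continuous_klFun.tendsto _).comp hz))).symm
      _ ≤ liminf (fun i => ∫⁻ z, ENNReal.ofReal (klFun (G (ns i) z)) ∂ν) atTop :=
          lintegral_liminf_le fun i => (measurable_klFun.comp (hGm _)).ennreal_ofReal
      _ = ENNReal.ofReal (∑' k, I k) := by
          simp_rw [hklG]
          exact Tendsto.liminf_eq (ENNReal.tendsto_ofReal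
            (hIs.hasSum.tendsto_sum_nat.comp hns.tendsto_atTop))
  have hne : klDiv μ ν ≠ ∞ := ne_top_of_le_ne_top ENNReal.ofReal_ne_top hup
  have hkli : Integrable (fun z => klFun (D z)) ν := by
    refine ⟨(measurable_klFun.comp hDm).aestronglyMeasurable, ?_⟩
    rw [hasFiniteIntegral_iff_ofReal (Eventually.of_forall fun z => klFun_nonneg (hDnn z)), ← hkl]
    exact hne.lt_top
  have hklr : (klDiv μ ν).toReal = ∫ z, klFun (D z) ∂ν := by
    rw [hkl, integral_eq_lintegral_of_nonneg_ae
      (Eventually.of_forall fun z => klFun_nonneg (hDnn z))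
      (measurable_klFun.comp hDm).aestronglyMeasurable]
  -- Lower bound: the tangent inequality between `D` and `G n` integrates to `∫ D log G n`, which is
  -- the partial sum of `I`, because `D` and `G n` have the same mass.
  have hlow (n : ℕ) : ∑ k ∈ Finset.range n, I k ≤ (klDiv μ ν).toReal := by
    rw [hklr]
    have hi : Integrable (fun z => D z * Real.log (G n z) + 1) ν :=
      (hint2 D hD2 n).add (integrable_const _)
    have hGi := (hG2 n).integrable one_le_two
    calc ∑ k ∈ Finset.range n, I k = ∫ z, (D z * Real.log (G n z) + 1 - G n z) ∂ν := by
          rw [integral_sub hi hGi, integral_add (hint2 D hD2 n) (integrable_const _), hGint,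
            hsumD D hD2 n fun k _ => hlogD k]
          simp
      _ ≤ ∫ z, klFun (D z) ∂ν := integral_mono (hi.sub hGi) hkli fun z =>
          mul_log_add_one_sub_le_klFun (hGpos n z) (hDnn z)
  refine ⟨D, hDm, hDnn, hDi, hweak, hne, ?_⟩
  have hIeq : (klDiv μ ν).toReal = ∑' k, I k := by
    refine le_antisymm ?_ (le_of_tendsto' hIs.hasSum.tendsto_sum_nat hlow)
    have hnn : 0 ≤ ∑' k, I k := by
      refine tsum_nonneg fun k => ?_
      rw [← hI]
      have hi3 : Integrable (fun z => ξ k z * Real.log (ξ k z)) ν := (h2 k).integrable_mul (hlog k)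
      have : ∫ z, (ξ k z - 1) ∂ν ≤ ∫ z, ξ k z * Real.log (ξ k z) ∂ν := by
        refine integral_mono (((h2 k).integrable one_le_two).sub (integrable_const _)) hi3 ?_
        intro z
        have := klFun_nonneg (hpos k z).le
        rw [klFun_apply] at this
        simp only
        linarith
      rw [integral_sub ((h2 k).integrable one_le_two) (integrable_const _), h1] at this
      simpa using this
    exact ENNReal.toReal_le_of_le_ofReal hnn hup
  rw [hIeq]
  exact hIs.hasSum

end ProductDensity

/-! ### Gaussian families in `L²` through characteristic functions. -/

section GaussianSpace

open Filter Topology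

variable {Ω : Type*} [MeasurableSpace Ω] {P : Measure Ω}

lemma norm_cexp_I_mul_sub_le (x y : ℝ) :
    ‖Complex.exp (Complex.I * x) - Complex.exp (Complex.I * y)‖ ≤ ‖x - y‖ := by
  have e : Complex.exp (Complex.I * x) - Complex.exp (Complex.I * y)
      = Complex.exp (Complex.I * y) * (Complex.exp (Complex.I * ((x - y : ℝ) : ℂ)) - 1) := by
    rw [mul_sub, ← Complex.exp_add, mul_one]
    congr 2
    push_cast
    ring
  rw [e, norm_mul, Complex.norm_exp_I_mul_ofReal, one_mul]
  exact Real.norm_exp_I_mul_ofReal_sub_one_le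

lemma integrable_mul_cexp [IsProbabilityMeasure P] {h : Ω → ℂ} (hm : AEStronglyMeasurable h P)
    (hb : ∀ ω, ‖h ω‖ ≤ 1) {z : Ω → ℝ} (hz : AEStronglyMeasurable z P) :
    Integrable (fun ω => h ω * Complex.exp (Complex.I * z ω)) P := by
  refine Integrable.of_bound (C := 1) (by fun_prop) (Eventually.of_forall fun ω => ?_)
  rw [norm_mul, Complex.norm_exp_I_mul_ofReal, mul_one]
  exact hb ω

/-- The map `x ↦ exp (i x)` is `1`-Lipschitz and the weight is bounded by `1`, so the integrands
converge in `L¹`. -/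
lemma tendsto_integral_mul_cexp [IsProbabilityMeasure P] {h : Ω → ℂ}
    (hm : AEStronglyMeasurable h P) (hb : ∀ ω, ‖h ω‖ ≤ 1) {ι : Type*} {u : Filter ι}
    {z : ι → Lp ℝ 2 P} {z₀ : Lp ℝ 2 P} (hz : Tendsto z u (𝓝 z₀)) :
    Tendsto (fun i => ∫ ω, h ω * Complex.exp (Complex.I * (z i ω : ℂ)) ∂P) u
      (𝓝 (∫ ω, h ω * Complex.exp (Complex.I * (z₀ ω : ℂ)) ∂P)) := by
  have hi (z : Lp ℝ 2 P) := integrable_mul_cexp hm hb (Lp.aestronglyMeasurable z)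
  refine tendsto_integral_of_L1' _ (hi z₀).1 (Eventually.of_forall fun i => hi (z i)) ?_
  rw [Lp.tendsto_Lp_iff_tendsto_eLpNorm'] at hz
  refine tendsto_of_tendsto_of_tendsto_of_le_of_le tendsto_const_nhds hz (fun _ => zero_le)
    fun i => ?_
  refine (eLpNorm_le_eLpNorm_of_exponent_le one_le_two ((hi _).1.sub (hi _).1)).trans
    (eLpNorm_mono fun ω => ?_)
  simp only [Pi.sub_apply, ← mul_sub, norm_mul]
  exact (mul_le_of_le_one_left (norm_nonneg _) (hb ω)).trans (norm_cexp_I_mul_sub_le _ _)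

lemma map_eq_gaussianReal [IsProbabilityMeasure P] {z : Ω → ℝ} (hz : AEMeasurable z P) {v : NNReal}
    (h : ∀ t : ℝ, ∫ ω, Complex.exp (Complex.I * (t * z ω : ℝ)) ∂P
      = Complex.exp (-(v * t ^ 2 / 2 : ℝ))) :
    P.map z = gaussianReal 0 v := by
  have := Measure.isProbabilityMeasure_map hz
  refine Measure.ext_of_charFun ?_
  ext t
  rw [charFun_gaussianReal, charFun_apply_real, integral_map hz (by fun_prop)]
  convert h t using 3
  · push_cast
    ring_nf
  · push_cast
    ring_nf

variable {F : Type*} [AddCommGroup F] [Module ℝ F]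

/-- The hypothesis concerns frequency `1` only; linearity supplies frequency `t` through `t • f`. -/
lemma map_eq_gaussianReal_of_linear [IsProbabilityMeasure P] {u : F →ₗ[ℝ] Lp ℝ 2 P}
    (hu : ∀ f, ∫ ω, Complex.exp (Complex.I * (u f ω : ℂ)) ∂P
      = Complex.exp (-(‖u f‖ ^ 2 / 2 : ℝ))) (f : F) :
    P.map (u f) = gaussianReal 0 (‖u f‖₊ ^ 2) := by
  refine map_eq_gaussianReal (Lp.aestronglyMeasurable _).aemeasurable fun t => ?_
  have h := hu (t • f)
  rw [map_smul, norm_smul, mul_pow] at h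
  convert h using 1
  · refine integral_congr_ae ?_
    filter_upwards [Lp.coeFn_smul t (u f)] with ω hω
    rw [hω]
    simp
  · simp [mul_comm]

/-- The joint characteristic function at `t` is the value of the hypothesis at `∑ t i • g i`. By
Pythagoras the squared norm is a sum, so the exponential factors. -/
lemma iIndepFun_of_linear [IsProbabilityMeasure P] {u : F →ₗ[ℝ] Lp ℝ 2 P}
    (hu : ∀ f, ∫ ω, Complex.exp (Complex.I * (u f ω : ℂ)) ∂P
      = Complex.exp (-(‖u f‖ ^ 2 / 2 : ℝ))) {ι : Type*} {g : ι → F}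
    (hg : Pairwise fun i j => inner ℝ (u (g i)) (u (g j)) = 0) :
    iIndepFun (fun i => (u (g i) : Ω → ℝ)) P := by
  rw [iIndepFun_iff_finset]
  intro s
  have hm (f : F) : AEMeasurable (u f) P := (Lp.aestronglyMeasurable _).aemeasurable
  change iIndepFun (fun i : s => (u (g i) : Ω → ℝ)) P
  rw [iIndepFun_iff_charFun_pi fun i => hm _]
  intro t
  have e1 : charFun (P.map fun ω => WithLp.toLp 2 fun i : s => u (g i) ω) t
      = ∫ ω, Complex.exp (Complex.I * (u (∑ i : s, t i • g i) ω : ℂ)) ∂P := by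
    rw [charFun_apply, integral_map (by fun_prop) (by fun_prop)]
    refine integral_congr_ae ?_
    have h1 : ∀ᵐ ω ∂P, ∀ i : s, (t i • u (g i) : Lp ℝ 2 P) ω = t i * u (g i) ω := by
      rw [ae_all_iff]
      intro i
      filter_upwards [Lp.coeFn_smul (t i) (u (g i))] with ω hω
      rw [hω]
      simp
    rw [map_sum]
    simp_rw [map_smul]
    filter_upwards [h1, Lp.coeFn_finsetSum Finset.univ fun i : s => t i • u (g i)] with ω h1 h2
    rw [h2]
    simp only [Finset.sum_apply, h1, PiLp.inner_apply]
    rw [mul_comm]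
    simp
  have e2 : ‖u (∑ i : s, t i • g i)‖ ^ 2 = ∑ i : s, t i ^ 2 * ‖u (g i)‖ ^ 2 := by
    rw [map_sum, ← real_inner_self_eq_norm_sq, sum_inner]
    refine Finset.sum_congr rfl fun i _ => ?_
    rw [inner_sum, Finset.sum_eq_single i]
    · simp only [map_smul, real_inner_self_eq_norm_sq, norm_smul, mul_pow, Real.norm_eq_abs,
        sq_abs]
    · intro j _ hj
      simp only [map_smul, real_inner_smul_left, real_inner_smul_right]
      rw [hg (fun h => hj (Subtype.ext h.symm))]
      simp
    · simp
  have e3 (i : s) : charFun (P.map (u (g i))) (t i)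
      = Complex.exp (-(t i ^ 2 * ‖u (g i)‖ ^ 2 / 2 : ℝ)) := by
    rw [map_eq_gaussianReal_of_linear hu, charFun_gaussianReal]
    congr 1
    push_cast
    ring
  calc _ = _ := e1
    _ = _ := hu _
    _ = _ := by
      simp_rw [e3]
      rw [← Complex.exp_sum, e2]
      congr 1
      push_cast
      rw [Finset.sum_neg_distrib, Finset.sum_div]

/-- Rectangles form a generating π-system, and on them the product measure separates the two
independence statements. -/
lemma iIndepFun_prod_comp {α β ι : Type*} [MeasurableSpace α] [MeasurableSpace β]
    {μ : Measure α} {ν : Measure β} [IsProbabilityMeasure μ] [IsProbabilityMeasure ν]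
    {a : ι → α → ℝ} {b : ι → β → ℝ} (ha : iIndepFun a μ) (hb : iIndepFun b ν)
    (ham : ∀ i, Measurable (a i)) (hbm : ∀ i, Measurable (b i)) :
    iIndepFun (fun i (z : α × β) => (a i z.1, b i z.2)) (μ.prod ν) := by
  rw [iIndepFun_iff_iIndep]
  have hm (i : ι) : Measurable fun z : α × β => (a i z.1, b i z.2) := by fun_prop
  refine iIndepSets.iIndep (fun i => (hm i).comap_le)
    (fun i => {t | ∃ s ∈ Set.image2 (· ×ˢ ·) {s : Set ℝ | MeasurableSet s} {t : Set ℝ |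
      MeasurableSet t}, (fun z : α × β => (a i z.1, b i z.2)) ⁻¹' s = t})
    (fun i => isPiSystem_prod.comap _) (fun i => ?_) ?_
  · rw [← generateFrom_prod, MeasurableSpace.comap_generateFrom]
    rfl
  · rw [iIndepSets_iff]
    intro s f hf
    have hf' : ∀ i, ∃ A B : Set ℝ, MeasurableSet A ∧ MeasurableSet B ∧
        (i ∈ s → f i = (a i ⁻¹' A) ×ˢ (b i ⁻¹' B)) := by
      intro i
      by_cases hi : i ∈ s
      · obtain ⟨-, ⟨A, hA, B, hB, rfl⟩, h⟩ := hf i hi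
        exact ⟨A, B, hA, hB, fun _ => h.symm⟩
      · exact ⟨∅, ∅, .empty, .empty, fun h => absurd h hi⟩
    choose A B hA hB hAB using hf'
    have e1 : ⋂ i ∈ s, f i = (⋂ i ∈ s, a i ⁻¹' A i) ×ˢ (⋂ i ∈ s, b i ⁻¹' B i) := by
      ext z
      simp only [Set.mem_iInter, Set.mem_prod, Set.mem_preimage]
      constructor
      · intro h
        refine ⟨fun i hi => ?_, fun i hi => ?_⟩
        · have := h i hi
          rw [hAB i hi] at this
          exact this.1
        · have := h i hi
          rw [hAB i hi] at this
          exact this.2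
      · rintro ⟨h1, h2⟩ i hi
        rw [hAB i hi]
        exact ⟨h1 i hi, h2 i hi⟩
    rw [e1, Measure.prod_prod, ha.measure_inter_preimage_eq_mul s fun i _ => hA i,
      hb.measure_inter_preimage_eq_mul s fun i _ => hB i, ← Finset.prod_mul_distrib]
    refine Finset.prod_congr rfl fun i hi => ?_
    rw [hAB i hi, Measure.prod_prod]

end GaussianSpace

/-! ### Real Gaussian channels: covariances and characteristic functions. -/

section GaussianChannel

open Filter Topology InformationTheory

variable {Ω : Type*} [MeasurableSpace Ω] {P : Measure Ω}
  {F : Type*} [NormedAddCommGroup F] [InnerProductSpace ℝ F]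

/-- A real Gaussian signal `e` observed in white Gaussian noise `w`: `e` is a function of the source
`X`, `w` is independent of `X` and has covariance `v ⟪f, g⟫`, and `ψ j` are the principal directions
of the signal, with variances `l j`. -/
structure IsGaussianChannel {α : Type*} [MeasurableSpace α] (X : Ω → α) (e w : F →L[ℝ] Lp ℝ 2 P)
    (a : F → α → ℝ) (v : NNReal) (l : ℕ → NNReal) (ψ : ℕ → F) : Prop where
  measurable_source : Measurable X
  measurable_signal : ∀ f, Measurable (a f)
  signal_ae_eq : ∀ f, (fun ω => a f (X ω)) =ᵐ[P] e f
  indep : ∀ f, IndepFun X (w f) P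
  signal_law : ∀ f, ∫ ω, Complex.exp (Complex.I * (e f ω : ℂ)) ∂P
    = Complex.exp (-(‖e f‖ ^ 2 / 2 : ℝ))
  noise_law : ∀ f, ∫ ω, Complex.exp (Complex.I * (w f ω : ℂ)) ∂P
    = Complex.exp (-(‖w f‖ ^ 2 / 2 : ℝ))
  noise_inner : ∀ f g, inner ℝ (w f) (w g) = v * inner ℝ f g
  orthonormal : Orthonormal ℝ ψ
  signal_inner : ∀ i j, inner ℝ (e (ψ i)) (e (ψ j)) = if i = j then (l i : ℝ) else 0
  hasSum_signal : ∀ f, HasSum (fun j => inner ℝ (ψ j) f • e (ψ j)) (e f)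

namespace IsGaussianChannel

variable {α : Type*} [MeasurableSpace α] {X : Ω → α} {e w : F →L[ℝ] Lp ℝ 2 P} {a : F → α → ℝ}
  {v : NNReal} {l : ℕ → NNReal} {ψ : ℕ → F}

lemma indep_signal (h : IsGaussianChannel X e w a v l ψ) (f g : F) : IndepFun (e f) (w g) P :=
  ((h.indep g).comp (h.measurable_signal f) measurable_id).congr (h.signal_ae_eq f)
    (EventuallyEq.refl _ _)

lemma integral_noise [IsProbabilityMeasure P] (h : IsGaussianChannel X e w a v l ψ) (g : F) :
    ∫ ω, w g ω ∂P = 0 := by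
  have hl := map_eq_gaussianReal_of_linear (u := (w : F →ₗ[ℝ] Lp ℝ 2 P)) h.noise_law g
  simp only [ContinuousLinearMap.coe_coe] at hl
  rw [← integral_id_gaussianReal (μ := 0) (v := ‖w g‖₊ ^ 2), ← hl,
    integral_map (Lp.aestronglyMeasurable _).aemeasurable (by fun_prop)]

lemma inner_signal_noise [IsProbabilityMeasure P] (h : IsGaussianChannel X e w a v l ψ) (f g : F) :
    inner ℝ (e f) (w g) = 0 := by
  rw [L2.inner_def]
  have := (h.indep_signal f g).integral_fun_mul_eq_mul_integral (Lp.aestronglyMeasurable _)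
    (Lp.aestronglyMeasurable _)
  rw [h.integral_noise, mul_zero] at this
  rw [← this]
  simp [mul_comm]

lemma norm_add_sq [IsProbabilityMeasure P] (h : IsGaussianChannel X e w a v l ψ) (f : F) :
    ‖(e + w) f‖ ^ 2 = ‖e f‖ ^ 2 + v * ‖f‖ ^ 2 := by
  rw [add_apply, norm_add_sq_real, h.inner_signal_noise,
    ← real_inner_self_eq_norm_sq (w f), h.noise_inner, real_inner_self_eq_norm_sq]
  ring

/-- Given the source, the signal is fixed and the independent noise contributes its characteristic
function as a factor. -/
lemma integral_mul_cexp_add (h : IsGaussianChannel X e w a v l ψ) {g : α → ℂ}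
    (hg : Measurable g) (f : F) :
    ∫ ω, g (X ω) * Complex.exp (Complex.I * ((e + w) f ω : ℂ)) ∂P
      = (∫ ω, g (X ω) * Complex.exp (Complex.I * (e f ω : ℂ)) ∂P) *
        Complex.exp (-(v * ‖f‖ ^ 2 / 2 : ℝ)) := by
  have h1 := (h.indep f).integral_fun_comp_mul_comp
    (f := fun x => g x * Complex.exp (Complex.I * (a f x : ℂ)))
    (g := fun x : ℝ => Complex.exp (Complex.I * (x : ℂ))) h.measurable_source.aemeasurable
    (Lp.aestronglyMeasurable (w f)).aemeasurable
    (by have := h.measurable_signal f; fun_prop) (by fun_prop)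
  rw [h.noise_law, ← real_inner_self_eq_norm_sq (w f), h.noise_inner,
    real_inner_self_eq_norm_sq] at h1
  rw [← Complex.ofReal_neg] at h1 ⊢
  have e2 : ∫ ω, g (X ω) * Complex.exp (Complex.I * (e f ω : ℂ)) ∂P
      = ∫ ω, g (X ω) * Complex.exp (Complex.I * (a f (X ω) : ℂ)) ∂P := by
    refine integral_congr_ae ?_
    filter_upwards [h.signal_ae_eq f] with ω hω
    rw [hω]
  rw [e2, ← h1]
  refine integral_congr_ae ?_
  filter_upwards [h.signal_ae_eq f, Lp.coeFn_add (e f) (w f)] with ω h2 h3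
  rw [add_apply, h3, Pi.add_apply, h2]
  push_cast
  rw [mul_add, Complex.exp_add]
  ring

lemma received_law [IsProbabilityMeasure P] (h : IsGaussianChannel X e w a v l ψ) (f : F) :
    ∫ ω, Complex.exp (Complex.I * ((e + w) f ω : ℂ)) ∂P
      = Complex.exp (-(‖(e + w) f‖ ^ 2 / 2 : ℝ)) := by
  have := h.integral_mul_cexp_add (g := fun _ => 1) measurable_const f
  simp only [one_mul] at this
  rw [this, h.signal_law, ← Complex.exp_add, h.norm_add_sq]
  congr 1
  push_cast
  ring

lemma inner_received [IsProbabilityMeasure P] (h : IsGaussianChannel X e w a v l ψ) (f g : F) :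
    inner ℝ ((e + w) f) ((e + w) g) = inner ℝ (e f) (e g) + v * inner ℝ f g := by
  simp only [add_apply, inner_add_left, inner_add_right, h.noise_inner,
    h.inner_signal_noise]
  rw [real_inner_comm (e g) (w f), h.inner_signal_noise]
  ring

/-- The `ψ j` act as eigenvectors of the signal covariance: a test function orthogonal to `ψ j`
yields a signal uncorrelated with that of `ψ j`. -/
lemma inner_signal (h : IsGaussianChannel X e w a v l ψ) (j : ℕ) (f : F) :
    inner ℝ (e (ψ j)) (e f) = l j * inner ℝ (ψ j) f := by
  have h1 := (h.hasSum_signal f).mapL (innerSL ℝ (e (ψ j)))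
  simp only [innerSL_apply_apply, real_inner_smul_right, h.signal_inner] at h1
  have h2 := hasSum_single (f := fun i => inner ℝ (ψ i) f * if j = i then (l j : ℝ) else 0) j
    (fun i hi => by simp [hi.symm])
  have := h1.unique h2
  simpa [mul_comm] using this

end IsGaussianChannel

end GaussianChannel

/-! ### Conditional output laws along finitely many principal directions. -/

section GaussianChannel

open Filter Topology InformationTheory

variable {Ω : Type*} [MeasurableSpace Ω] {P : Measure Ω}
  {F : Type*} [NormedAddCommGroup F] [InnerProductSpace ℝ F]

namespace IsGaussianChannel

variable {α : Type*} [MeasurableSpace α] {X : Ω → α} {e w : F →L[ℝ] Lp ℝ 2 P} {a : F → α → ℝ}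
  {v : NNReal} {l : ℕ → NNReal} {ψ : ℕ → F}

lemma map_signal [IsProbabilityMeasure P] (h : IsGaussianChannel X e w a v l ψ) (k : ℕ) :
    P.map (e (ψ k)) = gaussianReal 0 (l k) := by
  have := map_eq_gaussianReal_of_linear (u := (e : F →ₗ[ℝ] Lp ℝ 2 P)) h.signal_law (ψ k)
  simp only [ContinuousLinearMap.coe_coe] at this
  rw [this]
  congr 1
  rw [← NNReal.coe_inj]
  push_cast
  rw [← real_inner_self_eq_norm_sq, h.signal_inner, if_pos rfl]

lemma norm_received_sq [IsProbabilityMeasure P] (h : IsGaussianChannel X e w a v l ψ) (k : ℕ) :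
    ‖(e + w) (ψ k)‖ ^ 2 = l k + v := by
  rw [h.norm_add_sq, ← real_inner_self_eq_norm_sq, h.signal_inner, if_pos rfl,
    h.orthonormal.norm_eq_one]
  simp

lemma map_received [IsProbabilityMeasure P] (h : IsGaussianChannel X e w a v l ψ) (k : ℕ) :
    P.map ((e + w) (ψ k)) = gaussianReal 0 (l k + v) := by
  have := map_eq_gaussianReal_of_linear (u := ((e + w : F →L[ℝ] Lp ℝ 2 P) : F →ₗ[ℝ] Lp ℝ 2 P))
    h.received_law (ψ k)
  simp only [ContinuousLinearMap.coe_coe] at this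
  rw [this]
  congr 1
  rw [← NNReal.coe_inj]
  push_cast
  exact h.norm_received_sq k

/-- The part of `f` orthogonal to the first `n` principal directions. -/
noncomputable def residual (ψ : ℕ → F) (f : F) (n : ℕ) : F :=
  f - ∑ k ∈ Finset.range n, inner ℝ (ψ k) f • ψ k

lemma inner_residual (h : IsGaussianChannel X e w a v l ψ) (f : F) {j n : ℕ} (hj : j < n) :
    inner ℝ (ψ j) (residual ψ f n) = 0 := by
  rw [residual, inner_sub_right, h.orthonormal.inner_right_sum _ (Finset.mem_range.2 hj), sub_self]

lemma norm_residual_sq [IsProbabilityMeasure P] (h : IsGaussianChannel X e w a v l ψ) (f : F) (n : ℕ) :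
    ‖residual ψ f n‖ ^ 2 = ‖f‖ ^ 2 - ∑ k ∈ Finset.range n, (inner ℝ (ψ k) f) ^ 2 := by
  have h1 : inner ℝ (residual ψ f n) (∑ k ∈ Finset.range n, inner ℝ (ψ k) f • ψ k) = 0 := by
    rw [inner_sum]
    refine Finset.sum_eq_zero fun k hk => ?_
    rw [real_inner_smul_right, real_inner_comm (ψ k), h.inner_residual f (Finset.mem_range.1 hk),
      mul_zero]
  have h2 : f = residual ψ f n + ∑ k ∈ Finset.range n, inner ℝ (ψ k) f • ψ k := by
    simp [residual]
  have h3 : ‖f‖ ^ 2 = ‖residual ψ f n‖ ^ 2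
      + ‖∑ k ∈ Finset.range n, inner ℝ (ψ k) f • ψ k‖ ^ 2 := by
    conv_lhs => rw [h2]
    rw [norm_add_sq_real, h1]
    ring
  rw [h3, ← real_inner_self_eq_norm_sq (∑ k ∈ Finset.range n, inner ℝ (ψ k) f • ψ k),
    h.orthonormal.inner_sum]
  simp [pow_two]

/-- The characteristic function of the received field under the density built from the first `n`
principal directions. -/
lemma integral_cexp_mul_prod_gaussRatio [IsProbabilityMeasure P]
    (h : IsGaussianChannel X e w a v l ψ) (hv : v ≠ 0) (f : F) (n : ℕ) (c : ℕ → ℝ) :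
    ∫ ω, Complex.exp (Complex.I * ((e + w) f ω : ℂ)) *
        ((∏ k ∈ Finset.range n, gaussRatio (l k) v (c k) ((e + w) (ψ k) ω) : ℝ) : ℂ) ∂P
      = Complex.exp (Complex.I * ((∑ k ∈ Finset.range n, inner ℝ (ψ k) f * c k : ℝ) : ℂ)) *
        Complex.exp (-(v * ‖f‖ ^ 2 / 2 + ‖e (residual ψ f n)‖ ^ 2 / 2 : ℝ)) := by
  set u : F →L[ℝ] Lp ℝ 2 P := e + w with hu
  set r := residual ψ f n with hr
  -- The value `none` indexes the residual, the others the principal directions. The corresponding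
  -- outputs are pairwise orthogonal, hence independent.
  set g : Option (Fin n) → F := fun o => o.elim r fun k => ψ k with hg
  have hort : Pairwise fun i j => inner ℝ (u (g i)) (u (g j)) = 0 := by
    have hs (k : Fin n) : inner ℝ (u (ψ k)) (u r) = 0 := by
      rw [h.inner_received, h.inner_signal, h.inner_residual f k.2]
      simp
    rintro (_ | i) (_ | j) hij
    · exact absurd rfl hij
    · simp only [hg, Option.elim]
      rw [real_inner_comm, hs]
    · exact hs i
    · have hij' : (i : ℕ) ≠ j := fun hh => hij (by rw [Fin.ext hh])
      simp only [hg, Option.elim]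
      rw [h.inner_received, h.signal_inner, if_neg hij', h.orthonormal.inner_eq_zero hij']
      simp
  have hind := iIndepFun_of_linear (u := (u : F →ₗ[ℝ] Lp ℝ 2 P)) h.received_law hort
  simp only [ContinuousLinearMap.coe_coe] at hind
  have hm (f : F) : AEMeasurable (u f) P := (Lp.aestronglyMeasurable _).aemeasurable
  have hprod := hind.integral_fun_prod_comp (fun i => hm _) (𝕜 := ℂ)
    (f := fun o (x : ℝ) => o.elim (Complex.exp (Complex.I * x)) fun k : Fin n =>
      Complex.exp (Complex.I * ((inner ℝ (ψ k) f * x : ℝ) : ℂ)) *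
        ((gaussRatio (l k) v (c k) x : ℝ) : ℂ)) (by
    rintro (_ | k)
    · exact Measurable.aestronglyMeasurable (by simp only [Option.elim]; fun_prop)
    · have := (measurable_gaussRatio (l k) v).of_uncurry_left (x := c k)
      exact Measurable.aestronglyMeasurable (by simp only [Option.elim]; fun_prop))
  simp only [Fintype.prod_option, Option.elim, hg] at hprod
  -- The weight changes the law of the `k`-th output from `N(0, l k + v)` to `N(c k, v)`, its law
  -- given the signal value `c k`.
  have hfac (k : Fin n) : ∫ ω, Complex.exp (Complex.I * ((inner ℝ (ψ k) f * u (ψ k) ω : ℝ) : ℂ)) *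
        ((gaussRatio (l k) v (c k) (u (ψ k) ω) : ℝ) : ℂ) ∂P
      = Complex.exp (Complex.I * (inner ℝ (ψ k) f * c k : ℝ) -
        (v * (inner ℝ (ψ k) f) ^ 2 / 2 : ℝ)) := by
    have h1 := integral_map (hm (ψ k)) (μ := P)
      (f := fun x : ℝ => gaussRatio (l k) v (c k) x • Complex.exp (Complex.I *
        ((inner ℝ (ψ k) f * x : ℝ) : ℂ))) (by
      have := (measurable_gaussRatio (l k) v).of_uncurry_left (x := c k)
      exact Measurable.aestronglyMeasurable (by fun_prop))
    rw [h.map_received, integral_gaussRatio_smul hv] at h1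
    have h2 := charFun_gaussianReal (μ := c k) (v := v) (inner ℝ (ψ k) f)
    rw [charFun_apply_real] at h2
    calc _ = ∫ ω, gaussRatio (l k) v (c k) (u (ψ k) ω) • Complex.exp (Complex.I *
        ((inner ℝ (ψ k) f * u (ψ k) ω : ℝ) : ℂ)) ∂P := by
          congr with ω
          rw [Complex.real_smul, mul_comm]
      _ = _ := h1.symm
      _ = ∫ x : ℝ, Complex.exp ((inner ℝ (ψ k) f : ℝ) * x * Complex.I) ∂(gaussianReal (c k) v) := by
          congr with x
          push_cast
          ring_nf
      _ = _ := by
          rw [h2]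
          congr 1
          push_cast
          ring
  simp_rw [hfac] at hprod
  have hlaw := h.received_law r
  rw [← hu] at hlaw
  rw [hlaw, ← Complex.exp_sum, ← Complex.exp_add] at hprod
  rw [← Complex.exp_add]
  convert hprod using 1
  · refine integral_congr_ae ?_
    have hsum : u f = u r + ∑ k ∈ Finset.range n, inner ℝ (ψ k) f • u (ψ k) := by
      simp_rw [← map_smul, ← map_sum, ← map_add]
      congr 1
      simp [hr, residual]
    have h1 : ∀ᵐ ω ∂P, ∀ k, (inner ℝ (ψ k) f • u (ψ k) : Lp ℝ 2 P) ω
        = inner ℝ (ψ k) f * u (ψ k) ω := by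
      rw [ae_all_iff]
      intro k
      filter_upwards [Lp.coeFn_smul (inner ℝ (ψ k) f) (u (ψ k))] with ω hω
      rw [hω]
      simp
    rw [hsum]
    filter_upwards [h1, Lp.coeFn_add (u r) (∑ k ∈ Finset.range n, inner ℝ (ψ k) f • u (ψ k)),
      Lp.coeFn_finsetSum (Finset.range n) fun k => inner ℝ (ψ k) f • u (ψ k)] with ω h1 h2 h3
    rw [h2, Pi.add_apply, h3, Finset.sum_apply]
    simp_rw [h1]
    rw [Finset.prod_mul_distrib, ← Complex.exp_sum, Finset.sum_range, Finset.prod_range,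
      ← mul_assoc, ← Complex.exp_add, ← Finset.mul_sum]
    push_cast
    rw [mul_add]
  -- By Pythagoras the noise variances of the residual and of the directions `ψ k` add up to `v
  -- ‖f‖²`; only the signal variance of the residual is left over.
  · congr 1
    rw [h.norm_add_sq, h.norm_residual_sq, Finset.sum_sub_distrib, ← Finset.mul_sum]
    simp_rw [← Complex.ofReal_sum]
    rw [← Finset.sum_range fun k => inner ℝ (ψ k) f * c k,
      ← Finset.sum_range fun k => v * (inner ℝ (ψ k) f) ^ 2 / 2, ← Finset.sum_div, ← Finset.mul_sum]
    push_cast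
    ring

/-- The residual itself need not tend to zero, since `ψ` may be incomplete; its signal does, because
`ψ` exhausts what `e` sees. -/
lemma tendsto_residual (h : IsGaussianChannel X e w a v l ψ) (f : F) :
    Tendsto (fun n => e (residual ψ f n)) atTop (𝓝 0) := by
  have h1 := (h.hasSum_signal f).tendsto_sum_nat
  have h2 := (tendsto_const_nhds (x := e f)).sub h1
  rw [sub_self] at h2
  refine h2.congr fun n => ?_
  simp [residual, map_sub, map_sum]

end IsGaussianChannel

end GaussianChannel

/-! ### Mutual information of a real Gaussian channel. -/

section GaussianChannel

open Filter Topology InformationTheory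

variable {Ω : Type*} [MeasurableSpace Ω] {P : Measure Ω} [IsProbabilityMeasure P]
  {F : Type*} [NormedAddCommGroup F] [InnerProductSpace ℝ F]

lemma iIndepFun_map_of_linear {γ : Type*} [MeasurableSpace γ] {V : Ω → γ} (hV : Measurable V)
    {b : ℕ → γ → ℝ} (hb : ∀ k, Measurable (b k)) {u : F →L[ℝ] Lp ℝ 2 P} {ψ : ℕ → F}
    (hbu : ∀ k, (fun ω => b k (V ω)) =ᵐ[P] u (ψ k))
    (hu : ∀ f, ∫ ω, Complex.exp (Complex.I * (u f ω : ℂ)) ∂P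
      = Complex.exp (-(‖u f‖ ^ 2 / 2 : ℝ)))
    (ho : Pairwise fun i j => inner ℝ (u (ψ i)) (u (ψ j)) = 0) : iIndepFun b (P.map V) := by
  have h1 := iIndepFun_of_linear (u := (u : F →ₗ[ℝ] Lp ℝ 2 P)) hu ho
  have h2 := h1.congr fun k => (hbu k).symm
  rw [iIndepFun_iff_measure_inter_preimage_eq_mul] at h2 ⊢
  intro s A hA
  have h3 := h2 s hA
  rw [Measure.map_apply hV (Finset.measurableSet_biInter _ fun k hk => hb k (hA k hk)),
    Set.preimage_iInter₂]
  refine h3.trans (Finset.prod_congr rfl fun k hk => ?_)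
  rw [Measure.map_apply hV (hb k (hA k hk))]
  rfl

/-- For fixed `A`, the slices `B ↦ μ (A ×ˢ B)` are finite measures to which `hdet` applies. Absolute
continuity with respect to `ρ` carries over to them; it matters because `hdet` determines only
measures dominated by `ρ`. -/
lemma ext_of_integral_indicator_mul {α β : Type*} [MeasurableSpace α] [MeasurableSpace β]
    {ρ : Measure β} {μ₁ μ₂ : Measure (α × β)} [IsFiniteMeasure μ₁] [IsFiniteMeasure μ₂]
    (h₁ : μ₁.map Prod.snd ≪ ρ) (h₂ : μ₂.map Prod.snd ≪ ρ) {ι : Type*} {q : ι → β → ℂ}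
    (hq : ∀ i, Measurable (q i))
    (hdet : ∀ ρ₁ ρ₂ : Measure β, IsFiniteMeasure ρ₁ → IsFiniteMeasure ρ₂ → ρ₁ ≪ ρ → ρ₂ ≪ ρ →
      (∀ i, ∫ b, q i b ∂ρ₁ = ∫ b, q i b ∂ρ₂) → ρ₁ = ρ₂)
    (h : ∀ A : Set α, MeasurableSet A → ∀ i, ∫ z, A.indicator 1 z.1 * q i z.2 ∂μ₁
      = ∫ z, A.indicator 1 z.1 * q i z.2 ∂μ₂) : μ₁ = μ₂ := by
  refine Measure.ext_prod fun {A B} hA hB => ?_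
  have hac (μ : Measure (α × β)) (hμ : μ.map Prod.snd ≪ ρ) :
      (μ.restrict (A ×ˢ Set.univ)).map Prod.snd ≪ ρ :=
    (Measure.absolutelyContinuous_of_le (Measure.map_mono Measure.restrict_le_self
      measurable_snd)).trans hμ
  have happ (μ : Measure (α × β)) :
      (μ.restrict (A ×ˢ Set.univ)).map Prod.snd B = μ (A ×ˢ B) := by
    rw [Measure.map_apply measurable_snd hB, Measure.restrict_apply (measurable_snd hB)]
    congr 1
    ext z
    simp [and_comm]
  rw [← happ, ← happ]
  congr 1
  refine hdet _ _ inferInstance inferInstance (hac _ h₁) (hac _ h₂) fun i => ?_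
  have hind (z : α × β) : (A ×ˢ Set.univ : Set (α × β)).indicator (fun z => q i z.2) z
      = A.indicator 1 z.1 * q i z.2 := by
    by_cases hx : z.1 ∈ A <;> simp [hx]
  have hAu : MeasurableSet (A ×ˢ Set.univ : Set (α × β)) := hA.prod .univ
  rw [integral_map measurable_snd.aemeasurable (hq i).aestronglyMeasurable,
    integral_map measurable_snd.aemeasurable (hq i).aestronglyMeasurable,
    ← integral_indicator hAu, ← integral_indicator hAu]
  simp_rw [hind]
  exact h A hA i

namespace IsGaussianChannel

variable {α β : Type*} [MeasurableSpace α] [MeasurableSpace β] {X : Ω → α} {Y : Ω → β}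
  {e w : F →L[ℝ] Lp ℝ 2 P} {a : F → α → ℝ} {v : NNReal} {l : ℕ → NNReal} {ψ : ℕ → F}
  {y : F → β → ℝ}

lemma iIndepFun_pair (h : IsGaussianChannel X e w a v l ψ) (hY : Measurable Y)
    (hy : ∀ f, Measurable (y f)) (hye : ∀ f, (fun ω => y f (Y ω)) =ᵐ[P] (e + w) f) :
    iIndepFun (fun k (z : α × β) => (a (ψ k) z.1, y (ψ k) z.2)) ((P.map X).prod (P.map Y)) := by
  have := Measure.isProbabilityMeasure_map (μ := P) h.measurable_source.aemeasurable
  have := Measure.isProbabilityMeasure_map (μ := P) hY.aemeasurable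
  refine iIndepFun_prod_comp ?_ ?_ (fun k => h.measurable_signal _) fun k => hy _
  · refine iIndepFun_map_of_linear h.measurable_source (fun k => h.measurable_signal _)
      (fun k => h.signal_ae_eq _) h.signal_law fun i j hij => ?_
    simp only [h.signal_inner, if_neg hij]
  · refine iIndepFun_map_of_linear hY (fun k => hy _) (fun k => hye (ψ k)) h.received_law
      fun i j hij => ?_
    simp only [h.inner_received, h.signal_inner, if_neg hij, h.orthonormal.inner_eq_zero hij]
    simp

lemma map_pair (h : IsGaussianChannel X e w a v l ψ) (hY : Measurable Y)
    (hy : ∀ f, Measurable (y f)) (hye : ∀ f, (fun ω => y f (Y ω)) =ᵐ[P] (e + w) f) (k : ℕ) :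
    MeasurePreserving (fun z : α × β => (a (ψ k) z.1, y (ψ k) z.2))
      ((P.map X).prod (P.map Y)) ((gaussianReal 0 (l k)).prod (gaussianReal 0 (l k + v))) := by
  have := Measure.isProbabilityMeasure_map (μ := P) h.measurable_source.aemeasurable
  have := Measure.isProbabilityMeasure_map (μ := P) hY.aemeasurable
  refine MeasurePreserving.prod (f := a (ψ k)) (g := y (ψ k)) ⟨h.measurable_signal _, ?_⟩
    ⟨hy _, ?_⟩
  · rw [Measure.map_map (h.measurable_signal _) h.measurable_source, ← h.map_signal k]
    exact Measure.map_congr (h.signal_ae_eq _)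
  · rw [Measure.map_map (hy _) hY, ← h.map_received k]
    exact Measure.map_congr (hye _)

/-- Together with the weak limit of the partial products, this identifies the limiting density with
that of the joint law: indicators on the source side and exponentials on the output side determine a
law on the product. -/
lemma tendsto_integral_prod_gaussRatio (h : IsGaussianChannel X e w a v l ψ) (hv : v ≠ 0)
    (hY : Measurable Y) (hy : ∀ f, Measurable (y f))
    (hye : ∀ f, (fun ω => y f (Y ω)) =ᵐ[P] (e + w) f)
    (hint : ∀ n, Integrable (fun z : α × β => ∏ k ∈ Finset.range n,
      gaussRatio (l k) v (a (ψ k) z.1) (y (ψ k) z.2)) ((P.map X).prod (P.map Y)))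
    {g : α → ℂ} (hg : Measurable g) (hg1 : ∀ x, ‖g x‖ ≤ 1) (f : F) :
    Tendsto (fun n => ∫ z, g z.1 * Complex.exp (Complex.I * (y f z.2 : ℂ)) *
      ((∏ k ∈ Finset.range n, gaussRatio (l k) v (a (ψ k) z.1) (y (ψ k) z.2) : ℝ) : ℂ)
      ∂((P.map X).prod (P.map Y))) atTop
      (𝓝 (∫ ω, g (X ω) * Complex.exp (Complex.I * (y f (Y ω) : ℂ)) ∂P)) := by
  have := Measure.isProbabilityMeasure_map (μ := P) h.measurable_source.aemeasurable
  have := Measure.isProbabilityMeasure_map (μ := P) hY.aemeasurable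
  -- The signal of the truncation of `f` to `n` directions tends to the signal of `f`, and the
  -- leftover variance tends to zero.
  have hlim : Tendsto (fun n => (∫ ω, g (X ω) * Complex.exp (Complex.I *
      (e (∑ k ∈ Finset.range n, inner ℝ (ψ k) f • ψ k) ω : ℂ)) ∂P) *
      Complex.exp (-(v * ‖f‖ ^ 2 / 2 + ‖e (residual ψ f n)‖ ^ 2 / 2 : ℝ))) atTop
      (𝓝 ((∫ ω, g (X ω) * Complex.exp (Complex.I * (e f ω : ℂ)) ∂P) *
        Complex.exp (-(v * ‖f‖ ^ 2 / 2 + ‖(0 : Lp ℝ 2 P)‖ ^ 2 / 2 : ℝ)))) := by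
    refine (tendsto_integral_mul_cexp (hg.comp h.measurable_source).aestronglyMeasurable
      (fun ω => hg1 _) ?_).mul ?_
    · simp_rw [map_sum, map_smul]
      exact (h.hasSum_signal f).tendsto_sum_nat
    · refine (Complex.continuous_exp.tendsto _).comp ?_
      exact ((Complex.continuous_ofReal.tendsto _).comp
        (tendsto_const_nhds.add (((h.tendsto_residual f).norm.pow 2).div_const 2))).neg
  have hR : ∫ ω, g (X ω) * Complex.exp (Complex.I * (y f (Y ω) : ℂ)) ∂P
      = (∫ ω, g (X ω) * Complex.exp (Complex.I * (e f ω : ℂ)) ∂P) *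
        Complex.exp (-(v * ‖f‖ ^ 2 / 2 + ‖(0 : Lp ℝ 2 P)‖ ^ 2 / 2 : ℝ)) := by
    have h1 := h.integral_mul_cexp_add hg f
    rw [norm_zero]
    rw [zero_pow two_ne_zero, zero_div, add_zero, ← h1]
    refine integral_congr_ae ?_
    filter_upwards [hye f] with ω hω
    rw [hω]
  rw [hR]
  refine hlim.congr fun n => ?_
  rw [integral_prod]
  swap
  · refine (hint n).ofReal.bdd_mul (c := 1) ?_ (Eventually.of_forall fun z => ?_)
    · have := hy f
      exact Measurable.aestronglyMeasurable (by fun_prop)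
    · rw [norm_mul, Complex.norm_exp_I_mul_ofReal, mul_one]
      exact hg1 _
  -- Integration over the output with the source frozen at `x`, which is the previous formula for `c
  -- k = a (ψ k) x`.
  have hinner (x : α) : ∫ b, g x * Complex.exp (Complex.I * (y f b : ℂ)) *
      ((∏ k ∈ Finset.range n, gaussRatio (l k) v (a (ψ k) x) (y (ψ k) b) : ℝ) : ℂ) ∂(P.map Y)
      = g x * (Complex.exp (Complex.I *
        ((∑ k ∈ Finset.range n, inner ℝ (ψ k) f * a (ψ k) x : ℝ) : ℂ)) *
        Complex.exp (-(v * ‖f‖ ^ 2 / 2 + ‖e (residual ψ f n)‖ ^ 2 / 2 : ℝ))) := by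
    have hm : Measurable fun b => ∏ k ∈ Finset.range n,
        gaussRatio (l k) v (a (ψ k) x) (y (ψ k) b) :=
      Finset.measurable_fun_prod _ fun k _ =>
        ((measurable_gaussRatio (l k) v).of_uncurry_left (x := a (ψ k) x)).comp (hy _)
    have hm' := hy f
    simp_rw [mul_assoc]
    rw [integral_const_mul, integral_map hY.aemeasurable
      (Measurable.aestronglyMeasurable (by fun_prop)),
      ← h.integral_cexp_mul_prod_gaussRatio hv f n fun k => a (ψ k) x]
    congr 1
    refine integral_congr_ae ?_
    have hall : ∀ᵐ ω ∂P, ∀ k, y (ψ k) (Y ω) = (e + w) (ψ k) ω := by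
      rw [ae_all_iff]
      exact fun k => hye _
    filter_upwards [hye f, hall] with ω h1 h2
    simp_rw [h1, h2]
  simp_rw [hinner, ← mul_assoc]
  have hma (k : ℕ) := h.measurable_signal (ψ k)
  rw [integral_mul_const, integral_map h.measurable_source.aemeasurable
    (Measurable.aestronglyMeasurable (by fun_prop))]
  congr 1
  refine integral_congr_ae ?_
  have hall : ∀ᵐ ω ∂P, ∀ k, (inner ℝ (ψ k) f • e (ψ k) : Lp ℝ 2 P) ω
      = inner ℝ (ψ k) f * a (ψ k) (X ω) := by
    rw [ae_all_iff]
    intro k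
    filter_upwards [Lp.coeFn_smul (inner ℝ (ψ k) f) (e (ψ k)), h.signal_ae_eq (ψ k)] with ω h1 h2
    rw [h1, h2]
    simp
  simp_rw [map_sum, map_smul]
  filter_upwards [hall, Lp.coeFn_finsetSum (Finset.range n)
    fun k => inner ℝ (ψ k) f • e (ψ k)] with ω h1 h2
  rw [h2, Finset.sum_apply]
  simp_rw [h1]

attribute [local irreducible] gaussRatio in
/-- The mutual information of a Gaussian channel, when the laws on the output space are determined
by the characteristic functions of the received field. -/
theorem klDiv_ne_top_and_hasSum (h : IsGaussianChannel X e w a v l ψ) (hv : v ≠ 0)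
    (hl : Summable l) (hY : Measurable Y) (hy : ∀ f, Measurable (y f))
    (hye : ∀ f, (fun ω => y f (Y ω)) =ᵐ[P] (e + w) f)
    (hdet : ∀ ρ₁ ρ₂ : Measure β, IsFiniteMeasure ρ₁ → IsFiniteMeasure ρ₂ → ρ₁ ≪ P.map Y →
      ρ₂ ≪ P.map Y → (∀ f, ∫ b, Complex.exp (Complex.I * (y f b : ℂ)) ∂ρ₁
        = ∫ b, Complex.exp (Complex.I * (y f b : ℂ)) ∂ρ₂) → ρ₁ = ρ₂) :
    klDiv (P.map fun ω => (X ω, Y ω)) ((P.map X).prod (P.map Y)) ≠ ∞ ∧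
      HasSum (fun k => Real.log (1 + l k / v) / 2)
        (klDiv (P.map fun ω => (X ω, Y ω)) ((P.map X).prod (P.map Y))).toReal := by
  have hX := h.measurable_source
  have := Measure.isProbabilityMeasure_map (μ := P) hX.aemeasurable
  have := Measure.isProbabilityMeasure_map (μ := P) hY.aemeasurable
  have hXY : Measurable fun ω => (X ω, Y ω) := hX.prodMk hY
  have := Measure.isProbabilityMeasure_map (μ := P) hXY.aemeasurable
  set ν := (P.map X).prod (P.map Y) with hν
  set ξ : ℕ → α × β → ℝ := fun k z => gaussRatio (l k) v (a (ψ k) z.1) (y (ψ k) z.2) with hξ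
  have hpair := h.map_pair hY hy hye
  have hma (k : ℕ) := h.measurable_signal (ψ k)
  have hmξ (k : ℕ) : Measurable (ξ k) := by
    have h1 : Measurable (Function.uncurry (gaussRatio (l k) v) ∘
      fun z : α × β => (a (ψ k) z.1, y (ψ k) z.2)) :=
      (measurable_gaussRatio (l k) v).comp (hpair k).measurable
    exact h1
  have hind : iIndepFun ξ ν := by
    have h1 : iIndepFun (fun k => Function.uncurry (gaussRatio (l k) v) ∘
      fun z : α × β => (a (ψ k) z.1, y (ψ k) z.2)) ν :=
      (h.iIndepFun_pair hY hy hye).comp (fun k => Function.uncurry (gaussRatio (l k) v))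
        fun k => measurable_gaussRatio (l k) v
    exact h1
  have hint (k : ℕ) (G : ℝ × ℝ → ℝ) (hG : Measurable G) :
      ∫ z, G (a (ψ k) z.1, y (ψ k) z.2) ∂ν
        = ∫ x, G x ∂((gaussianReal 0 (l k)).prod (gaussianReal 0 (l k + v))) := by
    rw [← (hpair k).map_eq, integral_map (hpair k).measurable.aemeasurable
      hG.aestronglyMeasurable]
  have hv' : (0 : ℝ) < v := by positivity
  have hs : Summable fun k => (l k / v : ℝ) := (NNReal.summable_coe.2 hl).div_const _
  have hmr (k : ℕ) : Measurable fun x : ℝ × ℝ => gaussRatio (l k) v x.1 x.2 :=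
    measurable_gaussRatio (l k) v
  have h2 (k : ℕ) : MemLp (ξ k) 2 ν := (memLp_gaussRatio (l k) v hv).comp_measurePreserving (hpair k)
  have hlog (k : ℕ) : MemLp (fun z => Real.log (ξ k z)) 2 ν :=
    (memLp_log_gaussRatio (l k) v hv).comp_measurePreserving (hpair k)
  have h1 (k : ℕ) : ∫ z, ξ k z ∂ν = 1 :=
    (hint k (fun x => gaussRatio (l k) v x.1 x.2) (hmr k)).trans (integral_gaussRatio (l k) v hv)
  have hq (k : ℕ) : ∫ z, ξ k z ^ 2 ∂ν = 1 + l k / v :=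
    (hint k (fun x => gaussRatio (l k) v x.1 x.2 ^ 2) ((hmr k).pow_const 2)).trans
      (integral_gaussRatio_sq (l k) v hv)
  have hI (k : ℕ) : ∫ z, ξ k z * Real.log (ξ k z) ∂ν = Real.log (1 + l k / v) / 2 :=
    (hint k (fun x => gaussRatio (l k) v x.1 x.2 * Real.log (gaussRatio (l k) v x.1 x.2))
      ((hmr k).mul (hmr k).log)).trans (integral_gaussRatio_mul_log (l k) v hv)
  -- Comparison through `log (1 + t) ≤ t`.
  have hIs : Summable fun k => Real.log (1 + l k / v) / 2 := by
    refine Summable.of_nonneg_of_le (fun k => ?_) (fun k => ?_) (hs.div_const 2)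
    · refine div_nonneg (Real.log_nonneg ?_) two_pos.le
      have : (0 : ℝ) ≤ l k / v := by positivity
      linarith
    · have := Real.log_le_sub_one_of_pos (show (0 : ℝ) < 1 + l k / v by positivity)
      linarith
  obtain ⟨D, hDm, hD0, hDi, hDw, hne, hsum⟩ := exists_density_of_iIndepFun hind hmξ
    (fun k z => gaussRatio_pos hv _ _) h2 hlog h1 hq hs hI hIs
  suffices hμ : P.map (fun ω => (X ω, Y ω)) = ν.withDensity fun z => ENNReal.ofReal (D z) by
    rw [hμ]
    exact ⟨hne, hsum⟩
  have hfin : IsFiniteMeasure (ν.withDensity fun z => ENNReal.ofReal (D z)) :=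
    isFiniteMeasure_withDensity_ofReal hDi.2
  have hmf (f : F) : Measurable fun b => Complex.exp (Complex.I * (y f b : ℂ)) := by
    have := hy f
    fun_prop
  -- Both output marginals must be dominated by the law of `Y`: one is this law, the other comes
  -- from a density with respect to the product law.
  refine ext_of_integral_indicator_mul ?_ ?_ hmf hdet fun A hA f => ?_
  · rw [Measure.map_map measurable_snd hXY]
    exact Measure.AbsolutelyContinuous.rfl
  · refine ((withDensity_absolutelyContinuous ν _).map measurable_snd).trans ?_
    rw [hν, Measure.map_snd_prod]
    simp [Measure.AbsolutelyContinuous.rfl]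
  · have hgm : Measurable (A.indicator 1 : α → ℂ) := measurable_one.indicator hA
    have hg1 (x : α) : ‖(A.indicator 1 x : ℂ)‖ ≤ 1 := by
      by_cases hx : x ∈ A <;> simp [hx]
    have hmz : Measurable fun z : α × β =>
        (A.indicator 1 z.1 : ℂ) * Complex.exp (Complex.I * (y f z.2 : ℂ)) :=
      (hgm.comp measurable_fst).mul ((hmf f).comp measurable_snd)
    have t1 := h.tendsto_integral_prod_gaussRatio hv hY hy hye
      (fun n => (memLp_prod_range hind hmξ h2 n).integrable one_le_two) hgm hg1 f
    have t2 := hDw _ hmz fun z => by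
      rw [norm_mul, Complex.norm_exp_I_mul_ofReal, mul_one]
      exact hg1 _
    rw [integral_map hXY.aemeasurable hmz.aestronglyMeasurable,
      integral_withDensity_eq_integral_toReal_smul hDm.ennreal_ofReal
        (Eventually.of_forall fun _ => ENNReal.ofReal_lt_top), tendsto_nhds_unique t1 t2]
    congr with z
    rw [ENNReal.toReal_ofReal (hD0 z), Complex.real_smul, mul_comm]

end IsGaussianChannel

end GaussianChannel

/-! ### Integrals of random fields against square-integrable functions. -/

section RandomIntegral

open Filter Topology

variable {T Ω : Type*} [MeasurableSpace T] [MeasurableSpace Ω] {w : Measure T} {P : Measure Ω}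
  [SFinite w] [SFinite P] {X : T → Ω → ℂ}

lemma ae_memLp_section (hX : MemLp (Function.uncurry X) 2 (w.prod P)) :
    ∀ᵐ ω ∂P, MemLp (fun t => X t ω) 2 w := by
  have h1 := ((memLp_two_iff_integrable_sq_norm hX.1).1 hX).swap.prod_right_ae
  have h2 := hX.1.prod_swap.prodMk_left
  filter_upwards [h1, h2] with ω h1 h2
  exact (memLp_two_iff_integrable_sq_norm h2).2 h1

lemma aestronglyMeasurable_integral_mul (hX : MemLp (Function.uncurry X) 2 (w.prod P))
    (h : Lp ℂ 2 w) : AEStronglyMeasurable (fun ω => ∫ t, h t * X t ω ∂w) P :=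
  AEStronglyMeasurable.integral_prod_right' (f := fun z : Ω × T => h z.2 * X z.2 z.1)
    ((Lp.aestronglyMeasurable h).comp_snd.mul hX.1.prod_swap)

lemma eLpNorm_two_sq {α : Type*} [MeasurableSpace α] (μ : Measure α) (f : α → ℂ) :
    eLpNorm f 2 μ ^ 2 = ∫⁻ x, ‖f x‖ₑ ^ 2 ∂μ := by
  rw [eLpNorm_eq_lintegral_rpow_enorm_toReal two_ne_zero (by simp), ← ENNReal.rpow_natCast,
    ← ENNReal.rpow_mul]
  simp

/-- Cauchy–Schwarz for each outcome, then Tonelli; this is the Hilbert–Schmidt bound of the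
operator. -/
lemma eLpNorm_integral_mul_le (hX : MemLp (Function.uncurry X) 2 (w.prod P)) (h : Lp ℂ 2 w) :
    eLpNorm (fun ω => ∫ t, h t * X t ω ∂w) 2 P
      ≤ eLpNorm (Function.uncurry X) 2 (w.prod P) * eLpNorm h 2 w := by
  refine (ENNReal.pow_le_pow_left_iff two_ne_zero).1 ?_
  rw [mul_pow, eLpNorm_two_sq, eLpNorm_two_sq, ← lintegral_prod_swap]
  have hm : AEMeasurable (fun z : Ω × T => ‖Function.uncurry X z.swap‖ₑ ^ 2) (P.prod w) :=
    (hX.1.prod_swap.enorm).pow_const 2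
  rw [lintegral_prod _ hm, ← lintegral_mul_const'' _ hm.lintegral_prod_right']
  refine lintegral_mono_ae ?_
  filter_upwards [ae_memLp_section hX] with ω hω
  have h1 : ‖∫ t, h t * X t ω ∂w‖ₑ ≤ eLpNorm h 2 w * eLpNorm (fun t => X t ω) 2 w := by
    refine (enorm_integral_le_lintegral_enorm _).trans ?_
    have h2 := eLpNorm_smul_le_mul_eLpNorm (p := 2) (q := 2) (r := 1) (μ := w) (φ := (h : T → ℂ))
      (f := fun t => X t ω) hω.1 (Lp.aestronglyMeasurable h)
    rw [eLpNorm_one_eq_lintegral_enorm] at h2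
    exact h2
  calc ‖∫ t, h t * X t ω ∂w‖ₑ ^ 2
      ≤ (eLpNorm h 2 w * eLpNorm (fun t => X t ω) 2 w) ^ 2 := pow_le_pow_left₀ zero_le h1 2
    _ = _ := by
      rw [mul_pow, eLpNorm_two_sq w fun t => X t ω, mul_comm]
      rfl

lemma memLp_integral_mul (hX : MemLp (Function.uncurry X) 2 (w.prod P)) (h : Lp ℂ 2 w) :
    MemLp (fun ω => ∫ t, h t * X t ω ∂w) 2 P :=
  ⟨aestronglyMeasurable_integral_mul hX h, (eLpNorm_integral_mul_le hX h).trans_lt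
    (ENNReal.mul_lt_top hX.2 (Lp.memLp h).2)⟩

/-- The operator `h ↦ ∫ h(t) X(t) dw(t)` from square-integrable functions to square-integrable
random variables. -/
noncomputable def randomIntegral (hX : MemLp (Function.uncurry X) 2 (w.prod P)) :
    Lp ℂ 2 w →L[ℂ] Lp ℂ 2 P :=
  LinearMap.mkContinuous
    { toFun := fun h => (memLp_integral_mul hX h).toLp _
      map_add' := fun f g => by
        rw [← MemLp.toLp_add]
        refine MemLp.toLp_congr _ _ ?_
        filter_upwards [ae_memLp_section hX] with ω hω
        have hf : Integrable (fun t => f t * X t ω) w := (Lp.memLp f).integrable_mul hω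
        have hg : Integrable (fun t => g t * X t ω) w := (Lp.memLp g).integrable_mul hω
        rw [Pi.add_apply, ← integral_add hf hg]
        refine integral_congr_ae ?_
        filter_upwards [Lp.coeFn_add f g] with t ht
        rw [ht, Pi.add_apply, add_mul]
      map_smul' := fun c f => by
        rw [RingHom.id_apply, ← MemLp.toLp_const_smul]
        refine MemLp.toLp_congr _ _ (Eventually.of_forall fun ω => ?_)
        simp only [Pi.smul_apply, smul_eq_mul]
        rw [← integral_const_mul]
        refine integral_congr_ae ?_
        filter_upwards [Lp.coeFn_smul c f] with t ht
        rw [ht, Pi.smul_apply, smul_eq_mul, mul_assoc] }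
    (eLpNorm (Function.uncurry X) 2 (w.prod P)).toReal fun h => by
      simp only [LinearMap.coe_mk, AddHom.coe_mk]
      rw [Lp.norm_toLp, Lp.norm_def, ← ENNReal.toReal_mul]
      exact ENNReal.toReal_mono (ENNReal.mul_ne_top hX.2.ne (Lp.memLp h).2.ne)
        (eLpNorm_integral_mul_le hX h)

lemma randomIntegral_ae_eq (hX : MemLp (Function.uncurry X) 2 (w.prod P)) (h : Lp ℂ 2 w) :
    randomIntegral hX h =ᵐ[P] fun ω => ∫ t, h t * X t ω ∂w :=
  (memLp_integral_mul hX h).coeFn_toLp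

lemma norm_randomIntegral_le (hX : MemLp (Function.uncurry X) 2 (w.prod P)) :
    ‖randomIntegral hX‖ ≤ (eLpNorm (Function.uncurry X) 2 (w.prod P)).toReal :=
  LinearMap.mkContinuous_norm_le _ ENNReal.toReal_nonneg _

/-- By Fubini, the pathwise integral is the weak integral of `h t • ξ t` in `L²(P)`. -/
lemma inner_randomIntegral (hX : MemLp (Function.uncurry X) 2 (w.prod P)) {ξ : T → Lp ℂ 2 P}
    (hξ : ∀ᵐ t ∂w, ξ t =ᵐ[P] X t) (V : Lp ℂ 2 P) (h : Lp ℂ 2 w) :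
    inner ℂ V (randomIntegral hX h) = ∫ t, h t * inner ℂ V (ξ t) ∂w := by
  have hV : MemLp (fun z : T × Ω => h z.1 * conj (V z.2)) 2 (w.prod P) := by
    have h1 : MemLp (fun ω => conj (V ω)) 2 P := by
      have := (Lp.memLp V).star
      exact this
    refine ⟨(Lp.aestronglyMeasurable h).comp_fst.mul h1.1.comp_snd, ?_⟩
    refine (ENNReal.pow_lt_top_iff.1 (?_ : _ ^ 2 < ∞)).resolve_right two_ne_zero
    rw [eLpNorm_two_sq]
    simp_rw [enorm_mul, mul_pow]
    rw [lintegral_prod_mul ((Lp.aestronglyMeasurable h).enorm.pow_const 2)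
      (h1.1.enorm.pow_const 2), ← eLpNorm_two_sq, ← eLpNorm_two_sq]
    exact ENNReal.mul_lt_top (ENNReal.pow_lt_top (Lp.memLp h).2) (ENNReal.pow_lt_top h1.2)
  have hi : Integrable (fun z : T × Ω => h z.1 * conj (V z.2) * X z.1 z.2) (w.prod P) :=
    hV.integrable_mul hX
  rw [L2.inner_def]
  calc ∫ ω, inner ℂ (V ω) (randomIntegral hX h ω) ∂P
      = ∫ ω, ∫ t, h t * conj (V ω) * X t ω ∂w ∂P := by
        refine integral_congr_ae ?_
        filter_upwards [randomIntegral_ae_eq hX h] with ω hω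
        rw [hω, RCLike.inner_apply, mul_comm, ← integral_const_mul]
        congr with t
        ring
    _ = ∫ t, ∫ ω, h t * conj (V ω) * X t ω ∂P ∂w := (integral_integral_swap hi).symm
    _ = ∫ t, h t * inner ℂ V (ξ t) ∂w := by
        refine integral_congr_ae ?_
        filter_upwards [hξ] with t ht
        simp_rw [mul_assoc]
        rw [integral_const_mul, L2.inner_def]
        congr 1
        refine integral_congr_ae ?_
        filter_upwards [ht] with ω hω
        rw [hω, RCLike.inner_apply, mul_comm]

/-- A vector orthogonal to `K` is orthogonal to every `ξ t`, hence to the weak integral; and a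
closed `K` is its own double orthogonal. -/
lemma randomIntegral_mem (hX : MemLp (Function.uncurry X) 2 (w.prod P)) {ξ : T → Lp ℂ 2 P}
    (hξ : ∀ᵐ t ∂w, ξ t =ᵐ[P] X t) {K : Submodule ℂ (Lp ℂ 2 P)} (hK : IsClosed (K : Set (Lp ℂ 2 P)))
    (hmem : ∀ t, ξ t ∈ K) (h : Lp ℂ 2 w) : randomIntegral hX h ∈ K := by
  have : CompleteSpace K := hK.completeSpace_coe
  rw [← Submodule.orthogonal_orthogonal K, Submodule.mem_orthogonal]
  intro V hV
  rw [inner_randomIntegral hX hξ]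
  refine integral_eq_zero_of_ae (Eventually.of_forall fun t => ?_)
  have := (Submodule.mem_orthogonal' K V).1 hV (ξ t) (hmem t)
  simp [this]

end RandomIntegral

/-! ### Spaces of circularly symmetric Gaussian variables. -/

section CircularGaussian

open Filter Topology

variable {Ω : Type*} [MeasurableSpace Ω] {P : Measure Ω}

/-- The real part of a square-integrable random variable. -/
noncomputable def reLp (P : Measure Ω) : Lp ℂ 2 P →L[ℝ] Lp ℝ 2 P := Complex.reCLM.compLpL 2 P

lemma reLp_ae_eq (z : Lp ℂ 2 P) : reLp P z =ᵐ[P] fun ω => (z ω).re :=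
  Complex.reCLM.coeFn_compLpL z

/-- A space of circularly symmetric Gaussian random variables. -/
def IsGaussianSpace (K : Submodule ℂ (Lp ℂ 2 P)) : Prop :=
  ∀ z ∈ K, ∫ ω, Complex.exp (Complex.I * (reLp P z ω : ℂ)) ∂P
    = Complex.exp (-(‖z‖ ^ 2 / 4 : ℝ))

/-- Both sides of the defining identity are continuous in `z` for the `L²` norm. -/
lemma IsGaussianSpace.topologicalClosure [IsProbabilityMeasure P] {K : Submodule ℂ (Lp ℂ 2 P)}
    (hK : IsGaussianSpace K) : IsGaussianSpace K.topologicalClosure := by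
  have hc : Continuous fun z : Lp ℂ 2 P =>
      ∫ ω, Complex.exp (Complex.I * (reLp P z ω : ℂ)) ∂P := by
    refine continuous_iff_continuousAt.2 fun z => ?_
    have := tendsto_integral_mul_cexp (P := P) (h := fun _ => 1) aestronglyMeasurable_const
      (by simp) ((reLp P).continuous.tendsto z)
    simp only [one_mul] at this
    exact this
  have hcl := isClosed_eq hc (g := fun z : Lp ℂ 2 P => Complex.exp (-(‖z‖ ^ 2 / 4 : ℝ)))
    (by fun_prop)
  exact fun z hz => closure_minimal (s := (K : Set (Lp ℂ 2 P))) hK hcl hz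

lemma IsGaussianSpace.norm_reLp_sq [IsProbabilityMeasure P] {K : Submodule ℂ (Lp ℂ 2 P)}
    (hK : IsGaussianSpace K) {z : Lp ℂ 2 P} (hz : z ∈ K) : ‖reLp P z‖ ^ 2 = ‖z‖ ^ 2 / 2 := by
  have h1 : P.map (reLp P z) = gaussianReal 0 (‖z‖₊ ^ 2 / 2) := by
    refine map_eq_gaussianReal (Lp.aestronglyMeasurable _).aemeasurable fun t => ?_
    have h := hK ((t : ℂ) • z) (K.smul_mem _ hz)
    have e : reLp P ((t : ℂ) • z) = t • reLp P z := by
      rw [← map_smul]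
      congr 1
    rw [e, norm_smul, mul_pow, Complex.norm_real, Real.norm_eq_abs, sq_abs] at h
    convert h using 1
    · refine integral_congr_ae ?_
      filter_upwards [Lp.coeFn_smul t (reLp P z)] with ω hω
      rw [hω]
      simp
    · congr 1
      push_cast
      ring
  have h2 := integral_sq_gaussianReal (v := ‖z‖₊ ^ 2 / 2) 0
  rw [← h1, integral_map (Lp.aestronglyMeasurable _).aemeasurable (by fun_prop)] at h2
  rw [← real_inner_self_eq_norm_sq, L2.inner_def]
  simp only [RCLike.inner_apply, conj_trivial, ← pow_two]
  rw [h2]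
  simp

/-- Polarization of the halving of variances. -/
lemma IsGaussianSpace.inner_reLp [IsProbabilityMeasure P] {K : Submodule ℂ (Lp ℂ 2 P)}
    (hK : IsGaussianSpace K) {z₁ z₂ : Lp ℂ 2 P} (h₁ : z₁ ∈ K) (h₂ : z₂ ∈ K) :
    inner ℝ (reLp P z₁) (reLp P z₂) = (inner ℂ z₁ z₂ : ℂ).re / 2 := by
  have h := hK.norm_reLp_sq (K.add_mem h₁ h₂)
  rw [map_add, norm_add_sq_real, hK.norm_reLp_sq h₁, hK.norm_reLp_sq h₂,
    norm_add_sq (𝕜 := ℂ)] at h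
  simp only [RCLike.re_to_complex] at h
  linarith

namespace IsCircularGaussian

variable {T : Type*} {X : T → Ω → ℂ}

lemma memLp (hX : IsCircularGaussian X P) (t : T) : MemLp (X t) 2 P :=
  (hX.gaussian.hasGaussianLaw_eval t).memLp_two

/-- The values of a circularly symmetric Gaussian field in `L²(P)`. -/
noncomputable def toLp (hX : IsCircularGaussian X P) (t : T) : Lp ℂ 2 P := (hX.memLp t).toLp (X t)

lemma toLp_ae_eq (hX : IsCircularGaussian X P) (t : T) : hX.toLp t =ᵐ[P] X t :=
  (hX.memLp t).coeFn_toLp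

lemma inner_toLp (hX : IsCircularGaussian X P) (s t : T) :
    inner ℂ (hX.toLp s) (hX.toLp t) = autocorr X P t s := by
  rw [L2.inner_def, autocorr]
  refine integral_congr_ae ?_
  filter_upwards [hX.toLp_ae_eq s, hX.toLp_ae_eq t] with ω h1 h2
  rw [h1, h2, RCLike.inner_apply]

lemma isGaussianSpace_span (hX : IsCircularGaussian X P) :
    IsGaussianSpace (Submodule.span ℂ (Set.range hX.toLp)) := by
  have := hX.gaussian.isProbabilityMeasure
  intro z hz
  obtain ⟨c, rfl⟩ := Finsupp.mem_span_range_iff_exists_finsupp.1 hz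
  set z := c.sum fun t a => a • hX.toLp t with hzdef
  set Z : Ω → ℂ := fun ω => ∑ t ∈ c.support, c t * X t ω with hZ
  have hzZ : z =ᵐ[P] Z := by
    have hall : ∀ᵐ ω ∂P, ∀ t ∈ c.support, (c t • hX.toLp t : Lp ℂ 2 P) ω = c t * X t ω := by
      rw [Finset.eventually_all]
      intro t _
      filter_upwards [Lp.coeFn_smul (c t) (hX.toLp t), hX.toLp_ae_eq t] with ω h1 h2
      rw [h1, Pi.smul_apply, h2, smul_eq_mul]
    rw [hzdef, Finsupp.sum]
    filter_upwards [hall, Lp.coeFn_finsetSum c.support fun t => c t • hX.toLp t] with ω h1 h2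
    rw [h2, Finset.sum_apply, hZ]
    exact Finset.sum_congr rfl fun t ht => h1 t ht
  have hZm : MemLp Z 2 P := (memLp_congr_ae hzZ).1 (Lp.memLp z)
  have hZ0 : ∫ ω, Z ω ∂P = 0 := by
    rw [hZ, integral_finsetSum _ fun t _ => ((hX.memLp t).integrable one_le_two).const_mul _]
    refine Finset.sum_eq_zero fun t _ => ?_
    rw [integral_const_mul, hX.mean_zero, mul_zero]
  have hZZ : ∫ ω, Z ω * Z ω ∂P = 0 := by
    have e (ω : Ω) : Z ω * Z ω
        = ∑ s ∈ c.support, ∑ t ∈ c.support, c s * c t * (X s ω * X t ω) := by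
      simp only [hZ, Finset.sum_mul_sum]
      exact Finset.sum_congr rfl fun s _ => Finset.sum_congr rfl fun t _ => by ring
    simp_rw [e]
    have hi (s t : T) : Integrable (fun ω => c s * c t * (X s ω * X t ω)) P :=
      ((hX.memLp s).integrable_mul (hX.memLp t)).const_mul _
    rw [integral_finsetSum _ fun s _ => integrable_finsetSum _ fun t _ => hi s t]
    refine Finset.sum_eq_zero fun s _ => ?_
    rw [integral_finsetSum _ fun t _ => hi s t]
    refine Finset.sum_eq_zero fun t _ => ?_
    rw [integral_const_mul, hX.pseudoCov_zero, mul_zero]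
  have hG : HasGaussianLaw (fun ω => (Z ω).re) P := by
    have h1 : IsGaussianProcess (fun t ω => (c t * X t ω).re) P :=
      hX.gaussian.comp_left fun t =>
        Complex.reCLM ∘L ((ContinuousLinearMap.mul ℝ ℂ (c t)) : ℂ →L[ℝ] ℂ)
    have h2 := h1.hasGaussianLaw_fun_sum (I := c.support)
    have e : (fun ω => (Z ω).re) = fun ω => ∑ t ∈ c.support, (c t * X t ω).re := by
      ext ω
      simp only [hZ, Complex.re_sum]
    rw [e]
    exact h2
  have hmean : ∫ ω, (Z ω).re ∂P = 0 := by
    have := integral_re (hZm.integrable one_le_two)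
    simp only [RCLike.re_to_complex] at this
    rw [this, hZ0, Complex.zero_re]
  have hnorm : ∫ ω, ‖Z ω‖ ^ 2 ∂P = ‖z‖ ^ 2 := by
    rw [← inner_self_eq_norm_sq (𝕜 := ℂ), L2.inner_def]
    rw [← integral_re (L2.integrable_inner z z)]
    refine integral_congr_ae ?_
    filter_upwards [hzZ] with ω hω
    rw [hω, inner_self_eq_norm_sq (𝕜 := ℂ)]
  have hvar : Var[fun ω => (Z ω).re; P] = ‖z‖ ^ 2 / 2 := by
    rw [variance_of_integral_eq_zero hG.aemeasurable hmean]
    -- The second term has mean zero by the vanishing pseudo-covariance, so the real part carries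
    -- half of the power.
    have e (ω : Ω) : (Z ω).re ^ 2 = (‖Z ω‖ ^ 2 + (Z ω * Z ω).re) / 2 := by
      rw [← Complex.normSq_eq_norm_sq, Complex.normSq_apply, Complex.mul_re]
      ring
    have hi : Integrable (fun ω => Z ω * Z ω) P := hZm.integrable_mul hZm
    have hre := integral_re hi
    simp only [RCLike.re_to_complex] at hre
    have hire : Integrable (fun ω => (Z ω * Z ω).re) P := hi.re
    simp_rw [e]
    rw [integral_div, integral_add ((memLp_two_iff_integrable_sq_norm hZm.1).1 hZm) hire, hnorm,
      hre, hZZ]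
    simp
  have hmap := hG.map_eq_gaussianReal
  rw [hmean, hvar] at hmap
  have hcf := charFun_gaussianReal (μ := 0) (v := (‖z‖ ^ 2 / 2).toNNReal) 1
  rw [← hmap, charFun_apply_real, integral_map hG.aemeasurable (by fun_prop),
    Real.coe_toNNReal _ (by positivity)] at hcf
  calc ∫ ω, Complex.exp (Complex.I * (reLp P z ω : ℂ)) ∂P
      = ∫ ω, Complex.exp ((1 : ℝ) * ((Z ω).re : ℂ) * Complex.I) ∂P := by
        refine integral_congr_ae ?_
        filter_upwards [reLp_ae_eq z, hzZ] with ω h1 h2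
        rw [h1, h2]
        simp [mul_comm]
    _ = _ := by
        rw [hcf]
        congr 1
        push_cast
        ring

/-- The closed linear span of a circularly symmetric Gaussian field. -/
noncomputable def gaussianSpace (hX : IsCircularGaussian X P) : Submodule ℂ (Lp ℂ 2 P) :=
  (Submodule.span ℂ (Set.range hX.toLp)).topologicalClosure

lemma isClosed_gaussianSpace (hX : IsCircularGaussian X P) :
    IsClosed (hX.gaussianSpace : Set (Lp ℂ 2 P)) :=
  Submodule.isClosed_topologicalClosure _

lemma isGaussianSpace (hX : IsCircularGaussian X P) : IsGaussianSpace hX.gaussianSpace := by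
  have := hX.gaussian.isProbabilityMeasure
  exact hX.isGaussianSpace_span.topologicalClosure

lemma toLp_mem (hX : IsCircularGaussian X P) (t : T) : hX.toLp t ∈ hX.gaussianSpace :=
  Submodule.le_topologicalClosure _ (Submodule.subset_span ⟨t, rfl⟩)

/-- The variables measurable with respect to the field form a closed subspace that contains its
values; the factorization through the field is Doob–Dynkin. -/
lemma exists_measurable_comp (hX : IsCircularGaussian X P)
    (hm : Measurable fun ω t => X t ω) {z : Lp ℂ 2 P} (hz : z ∈ hX.gaussianSpace) :
    ∃ g : (T → ℂ) → ℂ, Measurable g ∧ (fun ω => g fun t => X t ω) =ᵐ[P] z := by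
  have h1 : hX.gaussianSpace
      ≤ lpMeas ℂ ℂ (MeasurableSpace.comap (fun ω t => X t ω) MeasurableSpace.pi) 2 P := by
    refine Submodule.topologicalClosure_minimal _ (Submodule.span_le.2 ?_)
      (isClosed_aestronglyMeasurable hm.comap_le)
    rintro _ ⟨t, rfl⟩
    have h2 : Measurable[MeasurableSpace.comap (fun ω t => X t ω) MeasurableSpace.pi] (X t) :=
      (measurable_pi_apply t).comp (comap_measurable fun ω t => X t ω)
    exact ⟨X t, h2.stronglyMeasurable, hX.toLp_ae_eq t⟩
  obtain ⟨g, hg, hgz⟩ := mem_lpMeas_iff_aestronglyMeasurable.1 (h1 hz)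
  obtain ⟨k, hk, hkg⟩ := hg.measurable.exists_eq_measurable_comp
  exact ⟨k, hk, by rw [hkg] at hgz; exact hgz.symm⟩

end IsCircularGaussian

end CircularGaussian

/-! ### White noise as a bounded operator. -/

section WhiteNoise

variable {Ω : Type*} [MeasurableSpace Ω] {P : Measure Ω}

/-- A map that multiplies inner products by a constant is linear. -/
noncomputable def linearMapOfInner {𝕜 E H : Type*} [RCLike 𝕜] [NormedAddCommGroup E]
    [InnerProductSpace 𝕜 E] [NormedAddCommGroup H] [InnerProductSpace 𝕜 H] (U : E → H) (c : 𝕜)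
    (hU : ∀ f g, inner 𝕜 (U f) (U g) = c * inner 𝕜 f g) : E →ₗ[𝕜] H where
  toFun := U
  map_add' f g := by
    rw [← sub_eq_zero, ← inner_self_eq_zero (𝕜 := 𝕜)]
    simp only [inner_sub_left, inner_sub_right, inner_add_left, inner_add_right, hU]
    ring
  map_smul' a f := by
    rw [RingHom.id_apply, ← sub_eq_zero, ← inner_self_eq_zero (𝕜 := 𝕜)]
    simp only [inner_sub_left, inner_sub_right, inner_smul_left, inner_smul_right, hU]
    ring

namespace IsWhiteNoise

variable {L σ2 : ℝ} {W : TestFun L → Ω → ℂ}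

lemma inner_toLp (hW : IsWhiteNoise L σ2 W P) (f g : TestFun L) :
    inner ℂ (hW.circularGaussian.toLp f) (hW.circularGaussian.toLp g)
      = (σ2 : ℂ) * inner ℂ f g := by
  rw [IsCircularGaussian.inner_toLp, hW.autocorr_eq, L2.inner_def]
  rfl

/-- White noise as an operator into `L²(P)`. -/
noncomputable def toCLM (hW : IsWhiteNoise L σ2 W P) : TestFun L →L[ℂ] Lp ℂ 2 P :=
  -- Linearity of the noise is not assumed; in `L²` it follows from the covariance. The absolute
  -- value makes the bound meaningful without a sign condition on `σ2`.
  (linearMapOfInner _ _ hW.inner_toLp).mkContinuous (Real.sqrt |σ2|) fun f => by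
    have h := hW.inner_toLp f f
    have h' := congrArg Complex.re h
    rw [Complex.re_ofReal_mul] at h'
    have e1 : (inner ℂ f f : ℂ).re = ‖f‖ ^ 2 := inner_self_eq_norm_sq (𝕜 := ℂ) f
    have e2 : (inner ℂ (hW.circularGaussian.toLp f) (hW.circularGaussian.toLp f) : ℂ).re
      = ‖hW.circularGaussian.toLp f‖ ^ 2 := inner_self_eq_norm_sq (𝕜 := ℂ) _
    rw [e1, e2] at h'
    refine le_of_pow_le_pow_left₀ two_ne_zero (by positivity) ?_
    rw [mul_pow, Real.sq_sqrt (abs_nonneg _)]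
    refine h'.le.trans ?_
    gcongr
    exact le_abs_self _

lemma toCLM_apply (hW : IsWhiteNoise L σ2 W P) (f : TestFun L) :
    hW.toCLM f = hW.circularGaussian.toLp f := rfl

end IsWhiteNoise

end WhiteNoise

/-! ### Eigenvector bases and orthogonal expansions. -/

section Spectral

lemma countable_of_orthonormal {ι H : Type*} [NormedAddCommGroup H] [InnerProductSpace ℂ H]
    [TopologicalSpace.SeparableSpace H] {v : ι → H} (hv : Orthonormal ℂ v) : Countable ι := by
  have hdist (i j : ι) (hij : i ≠ j) : 1 ≤ dist (v i) (v j) := by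
    rw [dist_eq_norm]
    have h1 := norm_sub_sq (𝕜 := ℂ) (v i) (v j)
    rw [hv.1, hv.1, hv.2 hij] at h1
    simp only [map_zero] at h1
    nlinarith [norm_nonneg (v i - v j)]
  have hd : Pairwise (Function.onFun Disjoint fun i => Metric.ball (v i) (1 / 2)) := by
    intro i j hij
    refine Metric.ball_disjoint_ball ?_
    have := hdist i j hij
    linarith
  have := Set.PairwiseDisjoint.countable_of_isOpen (s := fun i => Metric.ball (v i) (1 / 2))
    (a := Set.univ) (fun i _ j _ hij => hd hij) (fun i _ => Metric.isOpen_ball)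
    (fun i _ => ⟨v i, Metric.mem_ball_self (by norm_num)⟩)
  exact Set.countable_univ_iff.1 this

/-- Hilbert bases of all eigenspaces, the kernel included, are glued together. Separability and
infinite dimension make the index set countably infinite, so `ℕ` can enumerate it. -/
lemma exists_orthonormal_eigenvectors {H : Type*} [NormedAddCommGroup H] [InnerProductSpace ℂ H]
    [CompleteSpace H] [TopologicalSpace.SeparableSpace H] (hH : ¬ FiniteDimensional ℂ H)
    {T : H →L[ℂ] H} (hT : IsCompactOperator T) (hs : (T : H →ₗ[ℂ] H).IsSymmetric) :
    ∃ (ψ : ℕ → H) (μ : ℕ → ℂ), Orthonormal ℂ ψ ∧ (∀ x, (∀ k, inner ℂ (ψ k) x = 0) → x = 0) ∧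
      ∀ k, T (ψ k) = μ k • ψ k := by
  have horth := hs.orthogonalFamily_eigenspaces
  have hbot := ContinuousLinearMap.orthogonalComplement_iSup_eigenspaces_eq_bot hT hs
  have hcomplete (μ : ℂ) : CompleteSpace (Module.End.eigenspace (T : H →ₗ[ℂ] H) μ) := by
    have : IsClosed (Module.End.eigenspace (T : H →ₗ[ℂ] H) μ : Set H) := by
      have e : (Module.End.eigenspace (T : H →ₗ[ℂ] H) μ : Set H) = {x | T x = μ • x} := by
        ext x
        simp
      rw [e]
      exact isClosed_eq T.continuous (continuous_const_smul μ)
    exact this.completeSpace_coe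
  choose s b hb using fun μ : ℂ =>
    exists_hilbertBasis ℂ (Module.End.eigenspace (T : H →ₗ[ℂ] H) μ)
  have hortho : Orthonormal ℂ fun a : Σ μ, s μ => ((b a.1 a.2 : Module.End.eigenspace _ a.1) : H) :=
    horth.orthonormal_sigma_orthonormal fun μ => (b μ).orthonormal
  have hspan : (Submodule.span ℂ (Set.range fun a : Σ μ, s μ =>
      ((b a.1 a.2 : Module.End.eigenspace _ a.1) : H)))ᗮ = ⊥ := by
    rw [← hbot]
    refine le_antisymm ?_ (Submodule.orthogonal_le (Submodule.span_le.2 ?_))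
    · intro x hx
      rw [Submodule.mem_orthogonal'] at hx ⊢
      intro u hu
      refine Submodule.iSup_induction _ (motive := fun u => inner ℂ x u = 0) hu ?_ (by simp) ?_
      · intro μ y hy
        have h1 := (b μ).hasSum_repr ⟨y, hy⟩
        have h2 := h1.mapL ((innerSL ℂ x).comp (Submodule.subtypeL _))
        refine h2.unique ?_
        convert hasSum_zero with k
        simp only [ContinuousLinearMap.comp_apply, map_smul, Submodule.subtypeL_apply,
          innerSL_apply_apply, smul_eq_mul]
        rw [hx _ (Submodule.subset_span ⟨⟨μ, k⟩, rfl⟩), mul_zero]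
      · intro y z hy hz
        rw [inner_add_right, hy, hz, add_zero]
    · rintro _ ⟨a, rfl⟩
      exact Submodule.mem_iSup_of_mem a.1 (b a.1 a.2).2
  let B := HilbertBasis.mkOfOrthogonalEqBot hortho hspan
  have hcount := countable_of_orthonormal hortho
  have hinf : Infinite (Σ μ, s μ) := by
    by_contra hfin
    rw [not_infinite_iff_finite] at hfin
    have := Fintype.ofFinite (Σ μ, s μ)
    exact hH B.toOrthonormalBasis.toBasis.finiteDimensional_of_finite
  obtain ⟨e⟩ := nonempty_equiv_of_countable (α := ℕ) (β := Σ μ, s μ)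
  refine ⟨fun k => b (e k).1 (e k).2, fun k => (e k).1, hortho.comp e e.injective, fun x hx => ?_,
    fun k => Module.End.mem_eigenspace_iff.1 (b (e k).1 (e k).2).2⟩
  rw [← Submodule.mem_bot ℂ, ← hspan]
  refine (Submodule.mem_orthogonal _ _).2 fun u hu => ?_
  induction hu using Submodule.span_induction with
  | mem u hu =>
    obtain ⟨a, rfl⟩ := hu
    obtain ⟨k, rfl⟩ := e.surjective a
    exact hx k
  | zero => simp
  | add u v _ _ hu hv => rw [inner_add_left, hu, hv, add_zero]
  | smul c u _ hu => rw [inner_smul_left, hu, mul_zero]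

/-- After extension of `v` to a Hilbert basis, the added vectors contribute zero. The form of `hx`
covers two uses: vectors orthogonal to `v` are orthogonal to `x`, or are killed by `f`. -/
lemma hasSum_inner_smul_of_orthonormal {ι 𝕜 H G : Type*} [RCLike 𝕜] [NormedAddCommGroup H]
    [InnerProductSpace 𝕜 H] [CompleteSpace H] [NormedAddCommGroup G] [NormedSpace 𝕜 G] {v : ι → H}
    (hv : Orthonormal 𝕜 v) (f : H →L[𝕜] G) {x : H}
    (hx : ∀ V, (∀ k, inner 𝕜 (v k) V = 0) → inner 𝕜 V x • f V = 0) :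
    HasSum (fun k => inner 𝕜 (v k) x • f (v k)) (f x) := by
  obtain ⟨w, b, hw, hb⟩ := hv.toSubtypeRange.exists_hilbertBasis_extension
  have h1 : HasSum (fun i => inner 𝕜 (b i) x • f (b i)) (f x) := by
    have := (b.hasSum_repr x).mapL f
    simpa only [map_smul, b.repr_apply_apply] using this
  let g : ι → w := fun k => ⟨v k, hw ⟨k, rfl⟩⟩
  have hg : Function.Injective g := fun j k h => hv.linearIndependent.injective congr($h)
  have hbg (k : ι) : b (g k) = v k := by rw [hb]
  rw [← hg.hasSum_iff] at h1
  · simpa only [Function.comp_def, hbg] using h1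
  · intro i hi
    refine hx _ fun k => ?_
    rw [← hbg, b.orthonormal.2]
    exact fun h => hi ⟨k, h⟩

/-- The nonzero `v k` are normalized; a `v k` with `lam k = 0` vanishes, and its term is `0 / 0 =
0`. -/
lemma hasSum_inner_mul_inner_of_orthogonal {ι H : Type*} [DecidableEq ι] [NormedAddCommGroup H]
    [InnerProductSpace ℂ H] [CompleteSpace H] {v : ι → H} {lam : ι → ℝ}
    (hv : ∀ j k, inner ℂ (v j) (v k) = if j = k then (lam k : ℂ) else 0) {x : H}
    (hx : ∀ V, (∀ k, inner ℂ (v k) V = 0) → inner ℂ V x = 0) (y : H) :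
    HasSum (fun k => inner ℂ y (v k) * inner ℂ (v k) x / (lam k : ℂ)) (inner ℂ y x) := by
  have hnorm (k : ι) : ‖v k‖ ^ 2 = lam k := by
    have h := hv k k
    rw [if_pos rfl, inner_self_eq_norm_sq_to_K] at h
    exact Complex.ofReal_injective (by simpa using h)
  let s : Set ι := {k | lam k ≠ 0}
  have hv0 (k : ι) (hk : k ∉ s) : v k = 0 := by
    have h := hnorm k
    rw [show lam k = 0 from not_not.1 hk] at h
    simpa using h
  let u : s → H := fun k => ((‖v k‖⁻¹ : ℝ) : ℂ) • v k
  have hpos (k : s) : ‖v k‖ ≠ 0 := fun h => k.2 (by rw [← hnorm, h]; simp)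
  have hu : Orthonormal ℂ u := by
    refine ⟨fun k => ?_, fun i j hij => ?_⟩
    · rw [norm_smul, Complex.norm_real, norm_inv, norm_norm, inv_mul_cancel₀ (hpos k)]
    · simp only [u, inner_smul_left, inner_smul_right]
      rw [hv, if_neg fun h => hij (Subtype.ext h)]
      simp
  have h1 := hasSum_inner_smul_of_orthonormal hu (innerSL ℂ y) (x := x) fun V hV => by
    rw [hx V fun k => ?_, zero_smul]
    by_cases hk : k ∈ s
    · have := hV ⟨k, hk⟩
      simp only [u, inner_smul_left] at this
      simpa [hpos ⟨k, hk⟩] using this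
    · rw [hv0 k hk, inner_zero_left]
  rw [← Subtype.val_injective.hasSum_iff (f := fun k => _)]
  · have e : (fun k => inner ℂ y (v k) * inner ℂ (v k) x / (lam k : ℂ)) ∘ Subtype.val
        = fun k : s => inner ℂ (u k) x • (innerSL ℂ y) (u k) := by
      ext k
      simp only [Function.comp_apply, u, innerSL_apply_apply, inner_smul_left, inner_smul_right,
        Complex.conj_ofReal, smul_eq_mul, ← hnorm]
      push_cast
      field_simp
    rw [e]
    exact h1
  · intro k hk
    have : k ∉ s := fun h => hk ⟨⟨k, h⟩, rfl⟩
    rw [hv0 k this]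
    simp

end Spectral
open Filter Topology
-- The segment `[0, L]`.
section Destination
variable {L : ℝ}

instance : IsFiniteMeasure (volume : Measure (Destination L)) :=
  ⟨by rw [Measure.Subtype.volume_univ measurableSet_Icc.nullMeasurableSet, Real.volume_Icc]
      exact ENNReal.ofReal_lt_top⟩

instance : TopologicalSpace.SeparableSpace (TestFun L) := by
  have : Fact ((2 : ℝ≥0∞) ≠ ∞) := ⟨by simp⟩
  infer_instance

lemma volume_destination_preimage {s : Set ℝ} (hs : MeasurableSet s) :
    volume ((↑) ⁻¹' s : Set (Destination L)) = volume (s ∩ Set.Icc 0 L) := by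
  rw [← Measure.map_apply measurable_subtype_coe hs]
  exact (congrArg (fun m : Measure ℝ => m s) (map_comap_subtype_coe measurableSet_Icc volume)).trans
    (Measure.restrict_apply hs)

/-- Lebesgue measure charges every nonempty relatively open subset of `[0, L]`, endpoints included,
because `L > 0`. -/
lemma eq_of_ae_eq_of_continuous (hL : 0 < L) {E : Type*} [TopologicalSpace E] [T2Space E]
    {f g : Destination L → E} (hf : Continuous f) (hg : Continuous g)
    (h : f =ᵐ[volume] g) : f = g := by
  have hd : Dense {r | f r = g r} := by
    have : (volume : Measure (Destination L)).IsOpenPosMeasure := by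
      refine ⟨fun U hU ⟨r, hr⟩ => ?_⟩
      obtain ⟨V, hV, rfl⟩ := isOpen_induced_iff.1 hU
      rw [volume_destination_preimage hV.measurableSet]
      have h1 : (r : ℝ) ∈ closure (Set.Ioo 0 L) := by
        rw [closure_Ioo hL.ne]
        exact r.2
      have h2 : (V ∩ Set.Ioo 0 L).Nonempty := mem_closure_iff.1 h1 V hV hr
      have h3 := (hV.inter isOpen_Ioo).measure_ne_zero volume h2
      exact fun h0 => h3 (measure_mono_null (Set.inter_subset_inter_right _ Set.Ioo_subset_Icc_self)
        h0)
    exact Measure.dense_of_ae h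
  exact Continuous.ext_on hd hf hg fun r hr => hr

/-- Indicators of the disjoint intervals `(L / (n + 2), L / (n + 1)]` are nonzero and orthogonal. -/
lemma not_finiteDimensional_testFun (hL : 0 < L) : ¬ FiniteDimensional ℂ (TestFun L) := by
  intro hfin
  let s : ℕ → Set ℝ := fun n => Set.Ioc (L / (n + 2)) (L / (n + 1))
  have hsm (n : ℕ) : MeasurableSet ((↑) ⁻¹' s n : Set (Destination L)) :=
    measurable_subtype_coe measurableSet_Ioc
  let v : ℕ → TestFun L := fun n => indicatorConstLp 2 (hsm n) (measure_ne_top _ _) (1 : ℂ)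
  have hv0 (n : ℕ) : v n ≠ 0 := by
    intro h
    have hn := congrArg norm h
    have hpos : volume ((↑) ⁻¹' s n : Set (Destination L)) ≠ 0 := by
      rw [volume_destination_preimage measurableSet_Ioc, Set.inter_eq_left.2, Real.volume_Ioc]
      · have : L / (n + 2) < L / (n + 1) := by gcongr; norm_num
        simpa using this
      · intro x hx
        have h1 : 0 ≤ L / (n + 2) := by positivity
        have h2 : L / (n + 1) ≤ L := div_le_self hL.le (by linarith [n.cast_nonneg (α := ℝ)])
        exact ⟨h1.trans hx.1.le, hx.2.trans h2⟩
    rw [norm_indicatorConstLp two_ne_zero (by simp), norm_zero] at hn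
    have h1 : (volume : Measure (Destination L)).real ((↑) ⁻¹' s n) ≠ 0 :=
      (ENNReal.toReal_ne_zero.2 ⟨hpos, measure_ne_top _ _⟩)
    simp [Real.rpow_eq_zero, measureReal_nonneg, h1] at hn
  have horth : Pairwise fun i j => inner ℂ (v i) (v j) = 0 := by
    intro i j hij
    have hd : (↑) ⁻¹' s i ∩ (↑) ⁻¹' s j = (∅ : Set (Destination L)) := by
      have key (i j : ℕ) (hij : i < j) (x : ℝ) (h1 : x ∈ s i) (h2 : x ∈ s j) : False := by
        have h3 : L / (j + 1) ≤ L / (i + 2) := by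
          have : (i : ℝ) + 1 ≤ j := by exact_mod_cast hij
          exact div_le_div_of_nonneg_left hL.le (by positivity) (by linarith)
        linarith [h1.1, h2.2]
      ext x
      simp only [Set.mem_inter_iff, Set.mem_preimage, Set.mem_empty_iff_false, iff_false, not_and]
      intro h1 h2
      rcases lt_or_gt_of_ne hij with h | h
      · exact key i j h x h1 h2
      · exact key j i h x h2 h1
    simp [v, L2.inner_indicatorConstLp_indicatorConstLp, hd]
  have hli := linearIndependent_of_ne_zero_of_inner_eq_zero hv0 horth
  exact not_finite_iff_infinite.2 inferInstance hli.finite_of_isNoetherian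

end Destination

/-! ### Compactness of the signal operator. -/

section Compact

variable {T Ω : Type*} [MeasurableSpace T] [MeasurableSpace Ω] {w : Measure T} {P : Measure Ω}
  [SFinite P] {X : T → Ω → ℂ}

lemma randomIntegral_sub [SFinite w] {X Y : T → Ω → ℂ} (hX : MemLp (Function.uncurry X) 2 (w.prod P))
    (hY : MemLp (Function.uncurry Y) 2 (w.prod P))
    (hXY : MemLp (Function.uncurry (X - Y)) 2 (w.prod P)) :
    randomIntegral hX - randomIntegral hY = randomIntegral hXY := by
  refine ContinuousLinearMap.ext fun h => Lp.ext ?_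
  filter_upwards [Lp.coeFn_sub (randomIntegral hX h) (randomIntegral hY h),
    randomIntegral_ae_eq hX h, randomIntegral_ae_eq hY h, randomIntegral_ae_eq hXY h,
    ae_memLp_section hX, ae_memLp_section hY] with ω h1 h2 h3 h4 h5 h6
  rw [_root_.sub_apply, h1, Pi.sub_apply, h2, h3, h4,
    ← integral_sub (f := fun t => h t * X t ω) (g := fun t => h t * Y t ω)
      ((Lp.memLp h).integrable_mul h5) ((Lp.memLp h).integrable_mul h6)]
  simp only [Pi.sub_apply, mul_sub]

lemma eLpNorm_uncurry_sq (hX : AEStronglyMeasurable (Function.uncurry X) (w.prod P))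
    {ξ : T → Lp ℂ 2 P} (hξ : ∀ᵐ t ∂w, ξ t =ᵐ[P] X t) :
    eLpNorm (Function.uncurry X) 2 (w.prod P) ^ 2 = ∫⁻ t, ‖ξ t‖ₑ ^ 2 ∂w := by
  rw [eLpNorm_two_sq, lintegral_prod _ (hX.enorm.pow_const 2)]
  refine lintegral_congr_ae ?_
  filter_upwards [hξ] with t ht
  rw [Lp.enorm_def, eLpNorm_congr_ae ht, eLpNorm_two_sq]
  rfl

variable [IsFiniteMeasure w]

lemma memLp_uncurry_of_norm_le (hX : AEStronglyMeasurable (Function.uncurry X) (w.prod P))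
    {ξ : T → Lp ℂ 2 P} (hξ : ∀ᵐ t ∂w, ξ t =ᵐ[P] X t) {C : ℝ} (hC : ∀ t, ‖ξ t‖ ≤ C) :
    MemLp (Function.uncurry X) 2 (w.prod P) := by
  refine ⟨hX, (ENNReal.pow_lt_top_iff.1 (?_ : _ ^ 2 < ∞)).resolve_right two_ne_zero⟩
  rw [eLpNorm_uncurry_sq hX hξ]
  calc ∫⁻ t, ‖ξ t‖ₑ ^ 2 ∂w ≤ ∫⁻ _, ENNReal.ofReal C ^ 2 ∂w := by
        refine lintegral_mono fun t => ?_
        gcongr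
        rw [← ofReal_norm]
        exact ENNReal.ofReal_le_ofReal (hC t)
    _ < ∞ := by
        rw [lintegral_const]
        exact ENNReal.mul_lt_top (ENNReal.pow_lt_top ENNReal.ofReal_lt_top) (measure_lt_top _ _)

lemma isCompactOperator_of_range_subset {F G : Type*} [NormedAddCommGroup F] [NormedSpace ℂ F]
    [NormedAddCommGroup G] [NormedSpace ℂ G] (A : F →L[ℂ] G) (K : Submodule ℂ G)
    [FiniteDimensional ℂ K] (hA : ∀ x, A x ∈ K) : IsCompactOperator A := by
  have : ProperSpace K := FiniteDimensional.proper ℂ K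
  have h : IsCompactOperator (A.codRestrict K hA) := by
    refine ⟨Metric.closedBall 0 ‖A.codRestrict K hA‖, isCompact_closedBall _ _, ?_⟩
    filter_upwards [Metric.ball_mem_nhds 0 one_pos] with x hx
    rw [mem_ball_zero_iff] at hx
    rw [Set.mem_preimage, mem_closedBall_zero_iff]
    exact (A.codRestrict K hA).unit_le_opNorm x hx.le
  exact h.clm_comp K.subtypeL

/-- Freezing the field at finitely many points gives operators of finite rank. They converge in
norm, since the Hilbert–Schmidt bound of the difference tends to zero by dominated convergence. -/
lemma isCompactOperator_randomIntegral [Nonempty T] [TopologicalSpace T] [CompactSpace T]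
    [TopologicalSpace.PseudoMetrizableSpace T] [BorelSpace T]
    (hX : MemLp (Function.uncurry X) 2 (w.prod P)) (hXm : Measurable (Function.uncurry X))
    {ξ : T → Lp ℂ 2 P} (hξ : ∀ t, ξ t =ᵐ[P] X t) (hc : Continuous ξ) :
    IsCompactOperator (randomIntegral hX) := by
  let _ := TopologicalSpace.pseudoMetrizableSpacePseudoMetric T
  obtain ⟨C, hC⟩ := (isCompact_range hc).isBounded.exists_norm_le
  replace hC (t : T) : ‖ξ t‖ ≤ C := hC _ ⟨t, rfl⟩
  let τ : ℕ → SimpleFunc T T := fun n =>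
    SimpleFunc.approxOn id measurable_id Set.univ (Classical.arbitrary T) (Set.mem_univ _) n
  have hτ (t : T) : Tendsto (fun n => τ n t) atTop (𝓝 t) :=
    SimpleFunc.tendsto_approxOn measurable_id _ (by simp)
  let X' : ℕ → T → Ω → ℂ := fun n t ω => X (τ n t) ω
  have hX'm (n : ℕ) : Measurable (Function.uncurry (X' n)) :=
    hXm.comp (((τ n).measurable.comp measurable_fst).prodMk measurable_snd)
  have hξ' (n : ℕ) : ∀ᵐ t ∂w, ξ (τ n t) =ᵐ[P] X' n t := Eventually.of_forall fun t => hξ _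
  have hX' (n : ℕ) : MemLp (Function.uncurry (X' n)) 2 (w.prod P) :=
    memLp_uncurry_of_norm_le (hX'm n).aestronglyMeasurable (hξ' n) fun t => hC _
  have hsub (n : ℕ) : ∀ᵐ t ∂w, ((ξ (τ n t) - ξ t : Lp ℂ 2 P) : Ω → ℂ) =ᵐ[P] (X' n - X) t :=
    Eventually.of_forall fun t => (Lp.coeFn_sub _ _).trans ((hξ _).sub (hξ t))
  have hXX (n : ℕ) : MemLp (Function.uncurry (X' n - X)) 2 (w.prod P) := (hX' n).sub hX
  refine isCompactOperator_of_tendsto (l := atTop) (F := fun n => randomIntegral (hX' n)) ?_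
    (Eventually.of_forall fun n => ?_)
  · rw [tendsto_iff_norm_sub_tendsto_zero]
    have hlim : Tendsto (fun n => ∫⁻ t, ‖ξ (τ n t) - ξ t‖ₑ ^ 2 ∂w) atTop (𝓝 0) := by
      have h0 : ∫⁻ _ : T, 0 ∂w = 0 := by simp
      rw [← h0]
      refine tendsto_lintegral_of_dominated_convergence (fun _ => ENNReal.ofReal (C + C) ^ 2) ?_ ?_ ?_
        ?_
      · intro n
        have h1 : StronglyMeasurable fun t => ξ (τ n t) - ξ t :=
          ((τ n).map ξ).stronglyMeasurable.sub hc.stronglyMeasurable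
        exact h1.enorm.pow_const 2
      · refine fun n => Eventually.of_forall fun t => ?_
        dsimp only
        gcongr
        rw [← ofReal_norm]
        exact ENNReal.ofReal_le_ofReal ((norm_sub_le _ _).trans (add_le_add (hC _) (hC _)))
      · rw [lintegral_const]
        exact ENNReal.mul_ne_top (by simp) (measure_ne_top _ _)
      · refine Eventually.of_forall fun t => ?_
        have h1 : Tendsto (fun n => ξ (τ n t) - ξ t) atTop (𝓝 (ξ t - ξ t)) :=
          ((hc.tendsto t).comp (hτ t)).sub_const _
        have h2 := (((ENNReal.continuous_pow 2).comp continuous_enorm).tendsto _).comp h1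
        simpa [Function.comp_def] using h2
    have hlim2 : Tendsto (fun n => (eLpNorm (Function.uncurry (X' n - X)) 2 (w.prod P)).toReal) atTop
        (𝓝 0) := by
      have h1 : Tendsto (fun n => eLpNorm (Function.uncurry (X' n - X)) 2 (w.prod P) ^ 2) atTop
          (𝓝 0) := by
        simp_rw [eLpNorm_uncurry_sq (hXX _).1 (hsub _)]
        exact hlim
      have h2 := (ENNReal.continuous_rpow_const (y := (1 / 2 : ℝ))).tendsto 0 |>.comp h1
      rw [ENNReal.zero_rpow_of_pos (by norm_num)] at h2
      have h3 := (ENNReal.tendsto_toReal ENNReal.zero_ne_top).comp h2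
      refine h3.congr fun n => ?_
      simp only [Function.comp_apply]
      rw [← ENNReal.rpow_natCast, ← ENNReal.rpow_mul]
      norm_num
    refine squeeze_zero (fun _ => norm_nonneg _) (fun n => ?_) hlim2
    rw [randomIntegral_sub (hX' n) hX (hXX n)]
    exact norm_randomIntegral_le _
  · have : FiniteDimensional ℂ (Submodule.span ℂ (ξ '' (τ n).range)) :=
      FiniteDimensional.span_of_finite ℂ ((τ n).range.finite_toSet.image ξ)
    refine isCompactOperator_of_range_subset _ (Submodule.span ℂ (ξ '' (τ n).range)) ?_
    exact randomIntegral_mem (hX' n) (hξ' n) (Submodule.closed_of_finiteDimensional _)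
      fun t => Submodule.subset_span ⟨_, SimpleFunc.mem_range_self _ _, rfl⟩

end Compact

/-! ### Mercer expansions. -/

section Mercer

open Filter Topology

variable {L : ℝ} {Ω : Type*} [MeasurableSpace Ω] {P : Measure Ω}

/-- `ξ` is a mean-square continuous version in `L²(P)` of the measurable field `E`. -/
structure IsContinuousField (E : Destination L → Ω → ℂ) (ξ : Destination L → Lp ℂ 2 P) : Prop where
  measurable : Measurable (Function.uncurry E)
  ae_eq : ∀ r, ξ r =ᵐ[P] E r
  continuous : Continuous ξ

namespace IsContinuousField

variable {E : Destination L → Ω → ℂ} {ξ : Destination L → Lp ℂ 2 P}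

lemma exists_norm_le (h : IsContinuousField E ξ) : ∃ C, ∀ r, ‖ξ r‖ ≤ C := by
  obtain ⟨C, hC⟩ := (isCompact_range h.continuous).isBounded.exists_norm_le
  exact ⟨C, fun r => hC _ ⟨r, rfl⟩⟩

lemma autocorr_eq (h : IsContinuousField E ξ) (r r' : Destination L) :
    autocorr E P r r' = inner ℂ (ξ r') (ξ r) := by
  rw [L2.inner_def, autocorr]
  refine integral_congr_ae ?_
  filter_upwards [h.ae_eq r, h.ae_eq r'] with ω h1 h2
  rw [h1, h2, RCLike.inner_apply]

lemma memLp_inner (h : IsContinuousField E ξ) (V : Lp ℂ 2 P) :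
    MemLp (fun r => inner ℂ (ξ r) V : Destination L → ℂ) 2 volume := by
  obtain ⟨C, hC⟩ := h.exists_norm_le
  have hc : Continuous fun r => inner ℂ (ξ r) V := h.continuous.inner continuous_const
  exact MemLp.of_bound hc.aestronglyMeasurable (C * ‖V‖)
    (Eventually.of_forall fun r => (norm_inner_le_norm _ _).trans
      (mul_le_mul_of_nonneg_right (hC r) (norm_nonneg _)))

variable [IsFiniteMeasure P]

lemma memLp (h : IsContinuousField E ξ) : MemLp (Function.uncurry E) 2 (volume.prod P) := by
  obtain ⟨C, hC⟩ := h.exists_norm_le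
  exact memLp_uncurry_of_norm_le h.measurable.aestronglyMeasurable (Eventually.of_forall h.ae_eq) hC

/-- The operator `f ↦ ∫ f(r) E(r) dr`. -/
noncomputable def op (h : IsContinuousField E ξ) : TestFun L →L[ℂ] Lp ℂ 2 P :=
  randomIntegral h.memLp

lemma inner_op (h : IsContinuousField E ξ) (V : Lp ℂ 2 P) (f : TestFun L) :
    inner ℂ V (h.op f) = ∫ r, f r * inner ℂ V (ξ r) :=
  inner_randomIntegral h.memLp (Eventually.of_forall h.ae_eq) V f

lemma adjoint_op_ae_eq (h : IsContinuousField E ξ) (V : Lp ℂ 2 P) :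
    h.op.adjoint V =ᵐ[volume] fun r => inner ℂ (ξ r) V := by
  have e : h.op.adjoint V = (h.memLp_inner V).toLp _ := by
    refine ext_inner_right ℂ fun f => ?_
    rw [ContinuousLinearMap.adjoint_inner_left, h.inner_op, L2.inner_def]
    refine integral_congr_ae ?_
    filter_upwards [(h.memLp_inner V).coeFn_toLp] with r hr
    rw [hr, RCLike.inner_apply, inner_conj_symm]
  rw [e]
  exact (h.memLp_inner V).coeFn_toLp

lemma inner_op_left (h : IsContinuousField E ξ) (r' : Destination L) (f : TestFun L) :
    inner ℂ (h.op f) (ξ r') = ∫ r, autocorr E P r' r * conj (f r) := by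
  rw [← inner_conj_symm, h.inner_op, ← integral_conj]
  congr with r
  rw [map_mul, inner_conj_symm, h.autocorr_eq, mul_comm]

/-- Mean-square continuity upgrades an almost everywhere identity to every point, which the
pointwise expansion requires. -/
lemma inner_eq_zero_of_adjoint_eq_zero (hL : 0 < L) (h : IsContinuousField E ξ) {V : Lp ℂ 2 P}
    (hV : h.op.adjoint V = 0) (r : Destination L) : inner ℂ (ξ r) V = 0 := by
  have h1 := h.adjoint_op_ae_eq V
  rw [hV] at h1
  have h2 : (fun r => inner ℂ (ξ r) V) =ᵐ[volume] fun _ => (0 : ℂ) :=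
    h1.symm.trans (Lp.coeFn_zero _ _ _)
  exact congrFun (eq_of_ae_eq_of_continuous hL (h.continuous.inner continuous_const)
    continuous_const h2) r

lemma isCompactOperator_op (hL : 0 < L) (h : IsContinuousField E ξ) : IsCompactOperator h.op := by
  have : Nonempty (Destination L) := ⟨⟨0, le_rfl, hL.le⟩⟩
  exact isCompactOperator_randomIntegral h.memLp h.measurable h.ae_eq h.continuous

/-- Eigenvectors `ψ k` of `A* A` give orthogonal variables `A ψ k`. Expanding `ξ r` along them
yields the kernel at every pair of points. -/
lemma exists_isMercerExpansion (hL : 0 < L) (h : IsContinuousField E ξ) :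
    ∃ lam φ, IsMercerExpansion (autocorr E P) lam φ := by
  obtain ⟨ψ, μ, hψ, hker, hμ⟩ := exists_orthonormal_eigenvectors
    (T := h.op.adjoint ∘L h.op) (not_finiteDimensional_testFun hL)
    ((h.isCompactOperator_op hL).clm_comp h.op.adjoint) (fun f g => by
      simp [ContinuousLinearMap.adjoint_inner_left, ContinuousLinearMap.adjoint_inner_right])
  have hinner (j k : ℕ) : inner ℂ (h.op (ψ j)) (h.op (ψ k)) = if j = k then μ k else 0 := by
    rw [← ContinuousLinearMap.adjoint_inner_right]
    have := hμ k
    rw [ContinuousLinearMap.comp_apply] at this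
    rw [this, inner_smul_right, orthonormal_iff_ite.1 hψ]
    simp
  have hμre (k : ℕ) : μ k = ((‖h.op (ψ k)‖ ^ 2 : ℝ) : ℂ) := by
    have := hinner k k
    rw [if_pos rfl, inner_self_eq_norm_sq_to_K] at this
    rw [← this]
    simp
  set lam : ℕ → ℝ := fun k => ‖h.op (ψ k)‖ ^ 2 with hlam
  replace hinner (j k : ℕ) :
      inner ℂ (h.op (ψ j)) (h.op (ψ k)) = if j = k then (lam k : ℂ) else 0 := by
    rw [hinner, hμre]
  have hzero (k : ℕ) (hk : lam k = 0) : h.op (ψ k) = 0 := by simpa [hlam] using hk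
  -- The eigen-equation must hold at every point, so for a nonzero eigenvalue the continuous version
  -- is taken. For eigenvalue zero any representative will do, since `A ψ k = 0`.
  let φ : ℕ → Destination L → ℂ := fun k r =>
    if lam k = 0 then conj (ψ k r) else inner ℂ (h.op (ψ k)) (ξ r) / lam k
  have hφ (k : ℕ) : φ k =ᵐ[volume] fun r => conj (ψ k r) := by
    by_cases hk : lam k = 0
    · exact Eventually.of_forall fun r => if_pos hk
    · have h1 := h.adjoint_op_ae_eq (h.op (ψ k))
      rw [← ContinuousLinearMap.comp_apply, hμ k, hμre] at h1
      filter_upwards [h1, Lp.coeFn_smul ((lam k : ℝ) : ℂ) (ψ k)] with r h1 h2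
      simp only [φ, if_neg hk]
      have hk' : (lam k : ℂ) ≠ 0 := by exact_mod_cast hk
      rw [div_eq_iff hk', ← inner_conj_symm, ← h1, h2]
      simp [mul_comm]
  have hφξ (k : ℕ) (r : Destination L) : (lam k : ℂ) * φ k r = inner ℂ (h.op (ψ k)) (ξ r) := by
    by_cases hk : lam k = 0
    · simp [hk, hzero k hk]
    · have hk' : (lam k : ℂ) ≠ 0 := by exact_mod_cast hk
      simp only [φ, if_neg hk]
      field_simp
  refine ⟨lam, φ, ⟨fun k => ?_, fun j k => ?_, fun k r' => ?_, fun r r' => ?_⟩⟩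
  · exact (memLp_congr_ae (hφ k)).2 (Lp.memLp (ψ k)).star
  · have h1 := orthonormal_iff_ite.1 hψ j k
    rw [L2.inner_def] at h1
    rw [← h1]
    refine integral_congr_ae ?_
    filter_upwards [hφ j, hφ k] with r h1 h2
    rw [h1, h2, RCLike.inner_apply, Complex.conj_conj, mul_comm]
  · rw [hφξ, h.inner_op_left]
    refine integral_congr_ae ?_
    filter_upwards [hφ k] with r h1
    rw [h1]
  · have h1 := hasSum_inner_mul_inner_of_orthogonal hinner (x := ξ r) (fun V hV => ?_) (ξ r')
    · rw [← h.autocorr_eq] at h1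
      convert h1 using 2 with k
      by_cases hk : lam k = 0
      · simp [hk]
      · have hk' : (lam k : ℂ) ≠ 0 := by exact_mod_cast hk
        rw [← hφξ, ← inner_conj_symm, ← hφξ, map_mul, Complex.conj_ofReal]
        field_simp
    -- If `V` is orthogonal to every `A ψ k`, then `A* V` is orthogonal to every `ψ k`, hence zero,
    -- and `V` is orthogonal to the whole field.
    · rw [← inner_conj_symm, h.inner_eq_zero_of_adjoint_eq_zero hL, map_zero]
      refine hker _ fun k => ?_
      rw [ContinuousLinearMap.adjoint_inner_right, hV]

end IsContinuousField

/-- Equality in Bessel's inequality places `x` in the closed span of the `v k`. -/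
lemma inner_eq_zero_of_hasSum {H : Type*} [NormedAddCommGroup H] [InnerProductSpace ℂ H] {v : ℕ → H}
    {lam : ℕ → ℝ} (hv : ∀ j k, inner ℂ (v j) (v k) = if j = k then (lam k : ℂ) else 0) {x : H}
    (hx : HasSum (fun k => ‖inner ℂ (v k) x‖ ^ 2 / lam k) (‖x‖ ^ 2)) {V : H}
    (hV : ∀ k, inner ℂ (v k) V = 0) : inner ℂ V x = 0 := by
  have hnorm (k : ℕ) : ‖v k‖ ^ 2 = lam k := by
    have h := hv k k
    rw [if_pos rfl, inner_self_eq_norm_sq_to_K] at h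
    exact Complex.ofReal_injective (by simpa using h)
  have hle (s : Finset ℕ) :
      ‖inner ℂ V x‖ ^ 2 ≤ ‖V‖ ^ 2 * (‖x‖ ^ 2 - ∑ k ∈ s, ‖inner ℂ (v k) x‖ ^ 2 / lam k) := by
    -- The orthogonal projection of `x` onto finitely many `v k`; Cauchy–Schwarz is applied to `x -
    -- y`, whose norm tends to zero.
    set y := ∑ k ∈ s, (inner ℂ (v k) x / (lam k : ℂ)) • v k with hy
    have hvy (k : ℕ) (hk : k ∈ s) : inner ℂ (v k) (x - y) = 0 := by
      rw [inner_sub_right, hy, inner_sum]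
      simp only [inner_smul_right, hv]
      simp only [mul_ite, mul_zero, Finset.sum_ite_eq, if_pos hk]
      by_cases h0 : lam k = 0
      · have : v k = 0 := by
          have := hnorm k
          rw [h0] at this
          simpa using this
        simp [this]
      · have : (lam k : ℂ) ≠ 0 := by exact_mod_cast h0
        field_simp
        ring
    have hyy : inner ℂ y (x - y) = 0 := by
      conv_lhs => rw [hy]
      rw [sum_inner]
      refine Finset.sum_eq_zero fun k hk => ?_
      rw [inner_smul_left, hvy k hk, mul_zero]
    have hVy : inner ℂ V x = inner ℂ V (x - y) := by
      rw [inner_sub_right, hy, inner_sum, Finset.sum_eq_zero, sub_zero]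
      intro k _
      rw [inner_smul_right, ← inner_conj_symm V, hV, map_zero, mul_zero]
    have hn : ‖x - y‖ ^ 2 = ‖x‖ ^ 2 - ∑ k ∈ s, ‖inner ℂ (v k) x‖ ^ 2 / lam k := by
      have h1 : inner ℂ (x - y) (x - y) = inner ℂ x (x - y) := by
        conv_lhs => rw [inner_sub_left, hyy, sub_zero]
      have h2 : inner ℂ x y = ((∑ k ∈ s, ‖inner ℂ (v k) x‖ ^ 2 / lam k : ℝ) : ℂ) := by
        rw [hy, inner_sum]
        push_cast
        refine Finset.sum_congr rfl fun k _ => ?_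
        rw [inner_smul_right, ← inner_conj_symm x (v k), div_mul_eq_mul_div, RCLike.mul_conj]
        rfl
      rw [inner_sub_right x, h2, inner_self_eq_norm_sq_to_K, inner_self_eq_norm_sq_to_K] at h1
      exact Complex.ofReal_injective (by simpa using h1)
    rw [hVy, ← hn, ← mul_pow]
    gcongr
    exact norm_inner_le_norm _ _
  have hlim : Tendsto (fun s : Finset ℕ =>
      ‖V‖ ^ 2 * (‖x‖ ^ 2 - ∑ k ∈ s, ‖inner ℂ (v k) x‖ ^ 2 / lam k)) atTop (𝓝 0) := by
    have := (hx.const_sub (‖x‖ ^ 2)).const_mul (‖V‖ ^ 2)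
    simpa using this
  have := ge_of_tendsto' hlim hle
  have h0 : ‖inner ℂ V x‖ ^ 2 = 0 := le_antisymm this (by positivity)
  simpa using h0

namespace IsMercerExpansion

variable {E : Destination L → Ω → ℂ} {ξ : Destination L → Lp ℂ 2 P}
  {lam : ℕ → ℝ} {φ : ℕ → Destination L → ℂ}

/-- The conjugates of the eigenfunctions of a Mercer expansion, as test functions. -/
noncomputable def testFun {R : Destination L → Destination L → ℂ} (hM : IsMercerExpansion R lam φ)
    (k : ℕ) : TestFun L := (hM.memLp k).star.toLp _

lemma testFun_ae_eq {R : Destination L → Destination L → ℂ} (hM : IsMercerExpansion R lam φ)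
    (k : ℕ) : hM.testFun k =ᵐ[volume] fun r => conj (φ k r) :=
  (hM.memLp k).star.coeFn_toLp

lemma orthonormal_testFun {R : Destination L → Destination L → ℂ} (hM : IsMercerExpansion R lam φ) :
    Orthonormal ℂ hM.testFun := by
  refine orthonormal_iff_ite.2 fun j k => ?_
  rw [← hM.orthonormal j k, L2.inner_def]
  refine integral_congr_ae ?_
  filter_upwards [hM.testFun_ae_eq j, hM.testFun_ae_eq k] with r h1 h2
  rw [h1, h2, RCLike.inner_apply, Complex.conj_conj, mul_comm]

lemma hasSum_norm_sq (hM : IsMercerExpansion (autocorr E P) lam φ) (h : IsContinuousField E ξ)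
    (r : Destination L) : HasSum (fun k => lam k * ‖φ k r‖ ^ 2) (‖ξ r‖ ^ 2) := by
  have h1 := hM.expansion r r
  rw [h.autocorr_eq, inner_self_eq_norm_sq_to_K] at h1
  have h2 := Complex.hasSum_re h1
  convert h2 using 1
  · ext k
    rw [mul_assoc, RCLike.mul_conj, Complex.re_ofReal_mul]
    norm_cast
  · norm_cast

variable [IsFiniteMeasure P]

lemma inner_op_testFun (hM : IsMercerExpansion (autocorr E P) lam φ) (h : IsContinuousField E ξ)
    (k : ℕ) (r : Destination L) :
    inner ℂ (h.op (hM.testFun k)) (ξ r) = (lam k : ℂ) * φ k r := by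
  rw [h.inner_op_left, ← hM.eigen]
  refine integral_congr_ae ?_
  filter_upwards [hM.testFun_ae_eq k] with r' h1
  rw [h1, Complex.conj_conj]

lemma adjoint_op_op_testFun (hM : IsMercerExpansion (autocorr E P) lam φ)
    (h : IsContinuousField E ξ) (k : ℕ) :
    h.op.adjoint (h.op (hM.testFun k)) = (lam k : ℂ) • hM.testFun k := by
  refine Lp.ext ?_
  filter_upwards [h.adjoint_op_ae_eq (h.op (hM.testFun k)), hM.testFun_ae_eq k,
    Lp.coeFn_smul (lam k : ℂ) (hM.testFun k)] with r h1 h2 h3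
  rw [h1, h3, Pi.smul_apply, h2, ← inner_conj_symm, hM.inner_op_testFun h, map_mul,
    Complex.conj_ofReal, smul_eq_mul]

lemma inner_op_op (hM : IsMercerExpansion (autocorr E P) lam φ) (h : IsContinuousField E ξ)
    (k : ℕ) (f : TestFun L) :
    inner ℂ (h.op (hM.testFun k)) (h.op f) = (lam k : ℂ) * inner ℂ (hM.testFun k) f := by
  rw [← ContinuousLinearMap.adjoint_inner_left, hM.adjoint_op_op_testFun h, inner_smul_left,
    Complex.conj_ofReal]

lemma inner_op_testFun_op_testFun (hM : IsMercerExpansion (autocorr E P) lam φ)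
    (h : IsContinuousField E ξ) (j k : ℕ) :
    inner ℂ (h.op (hM.testFun j)) (h.op (hM.testFun k)) = if j = k then (lam k : ℂ) else 0 := by
  rw [hM.inner_op_op h, orthonormal_iff_ite.1 hM.orthonormal_testFun]
  split_ifs with hjk
  · rw [hjk, mul_one]
  · rw [mul_zero]

lemma norm_op_testFun_sq (hM : IsMercerExpansion (autocorr E P) lam φ)
    (h : IsContinuousField E ξ) (k : ℕ) : ‖h.op (hM.testFun k)‖ ^ 2 = lam k := by
  have h1 := hM.inner_op_testFun_op_testFun h k k
  rw [if_pos rfl, inner_self_eq_norm_sq_to_K] at h1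
  exact Complex.ofReal_injective (by simpa using h1)

lemma nonneg (hM : IsMercerExpansion (autocorr E P) lam φ) (h : IsContinuousField E ξ) (k : ℕ) :
    0 ≤ lam k := by
  rw [← hM.norm_op_testFun_sq h]
  positivity

/-- The trace bound: the diagonal expansion is integrated over the segment, where the power `‖ξ r‖²`
is bounded. -/
lemma summable (hM : IsMercerExpansion (autocorr E P) lam φ) (h : IsContinuousField E ξ) :
    Summable lam := by
  obtain ⟨C, hC⟩ := h.exists_norm_le
  refine summable_of_sum_le (hM.nonneg h) (c := ∫ _ : Destination L, C ^ 2) fun s => ?_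
  have hone (k : ℕ) : ∫ r, ‖φ k r‖ ^ 2 = 1 := by
    have h1 := hM.orthonormal k k
    rw [if_pos rfl] at h1
    apply Complex.ofReal_injective
    rw [← integral_complex_ofReal, Complex.ofReal_one, ← h1]
    congr with r
    rw [RCLike.mul_conj]
    norm_cast
  have hint (k : ℕ) : Integrable (fun r => lam k * ‖φ k r‖ ^ 2) :=
    ((memLp_two_iff_integrable_sq_norm (hM.memLp k).1).1 (hM.memLp k)).const_mul _
  calc ∑ k ∈ s, lam k = ∫ r, ∑ k ∈ s, lam k * ‖φ k r‖ ^ 2 := by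
        rw [integral_finsetSum _ fun k _ => hint k]
        refine Finset.sum_congr rfl fun k _ => ?_
        rw [integral_const_mul, hone, mul_one]
    _ ≤ ∫ _ : Destination L, C ^ 2 := by
        refine integral_mono (integrable_finsetSum _ fun k _ => hint k) (integrable_const _)
          fun r => ?_
        refine (sum_le_hasSum s (fun k _ => ?_) (hM.hasSum_norm_sq h r)).trans ?_
        · exact mul_nonneg (hM.nonneg h k) (by positivity)
        · exact pow_le_pow_left₀ (norm_nonneg _) (hC r) 2

/-- This replaces completeness of the eigenfunctions. The diagonal of the expansion is equality in
Bessel's inequality for `ξ r`, so `A f` is orthogonal to the whole field and hence to itself. -/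
lemma op_eq_zero (hM : IsMercerExpansion (autocorr E P) lam φ) (h : IsContinuousField E ξ)
    {f : TestFun L} (hf : ∀ k, inner ℂ (hM.testFun k) f = 0) : h.op f = 0 := by
  have hV (k : ℕ) : inner ℂ (h.op (hM.testFun k)) (h.op f) = 0 := by
    rw [hM.inner_op_op h, hf, mul_zero]
  have hξ (r : Destination L) : inner ℂ (h.op f) (ξ r) = 0 := by
    refine inner_eq_zero_of_hasSum (hM.inner_op_testFun_op_testFun h) ?_ hV
    convert hM.hasSum_norm_sq h r using 2 with k
    rw [hM.inner_op_testFun h, norm_mul, mul_pow, Complex.norm_real, Real.norm_eq_abs, sq_abs]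
    by_cases hk : lam k = 0
    · simp [hk]
    · field_simp
  rw [← inner_self_eq_zero (𝕜 := ℂ), h.inner_op]
  simp [hξ]

end IsMercerExpansion

end Mercer

/-! ### The received field and laws on its path space. -/

section Received

open Filter Topology

lemma real_inner_lp_eq_re {α : Type*} [MeasurableSpace α] {μ : Measure α} (f g : Lp ℂ 2 μ) :
    inner ℝ f g = (inner ℂ f g : ℂ).re := by
  rw [L2.inner_def, L2.inner_def]
  have h := integral_re (L2.integrable_inner (𝕜 := ℂ) f g)
  simp only [RCLike.re_to_complex] at h
  rw [← h]
  rfl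

/-- A real functional is the real part of a complex one, `x ↦ l x - i l (i x)`, evaluated on the
standard basis. -/
lemma exists_re_sum_eq {ι : Type*} [Fintype ι] [DecidableEq ι] (l : (ι → ℂ) →L[ℝ] ℝ) :
    ∃ c : ι → ℂ, ∀ x, l x = (∑ i, c i * x i).re := by
  refine ⟨fun i => l (Pi.single i 1) - l (Pi.single i Complex.I) * Complex.I, fun x => ?_⟩
  have hx : x = ∑ i, ((x i).re • (Pi.single i 1 : ι → ℂ) +
      (x i).im • (Pi.single i Complex.I : ι → ℂ)) := by
    conv_lhs => rw [← Finset.univ_sum_single x]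
    refine Finset.sum_congr rfl fun i _ => ?_
    ext j
    by_cases hj : j = i
    · subst hj
      simp [Complex.re_add_im]
    · simp [hj]
  conv_lhs => rw [hx]
  simp only [map_sum, map_add, map_smul, smul_eq_mul, Complex.re_sum]
  refine Finset.sum_congr rfl fun i _ => ?_
  simp [mul_comm]

/-- Finite-dimensional marginals determine the measure. Almost sure linearity rewrites each of their
characteristic functions as that of the single coordinate `∑ c i • f i`. -/
lemma measure_ext_of_integral_cexp_re {F : Type*} [AddCommGroup F] [Module ℂ F]
    {ρ₁ ρ₂ : Measure (F → ℂ)} [IsFiniteMeasure ρ₁] [IsFiniteMeasure ρ₂]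
    (h₁ : ∀ (I : Finset F) (c : I → ℂ), ∀ᵐ b ∂ρ₁, b (∑ i, c i • (i : F)) = ∑ i, c i * b i)
    (h₂ : ∀ (I : Finset F) (c : I → ℂ), ∀ᵐ b ∂ρ₂, b (∑ i, c i • (i : F)) = ∑ i, c i * b i)
    (h : ∀ f, ∫ b, Complex.exp (Complex.I * ((b f).re : ℂ)) ∂ρ₁
        = ∫ b, Complex.exp (Complex.I * ((b f).re : ℂ)) ∂ρ₂) : ρ₁ = ρ₂ := by
  classical
  have hr (I : Finset F) : Measurable (I.restrict (π := fun _ : F => ℂ)) := by fun_prop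
  refine IsProjectiveLimit.unique (P := fun I => ρ₁.map I.restrict) (fun I => rfl) fun I => ?_
  refine Measure.ext_of_charFunDual (funext fun l => ?_)
  obtain ⟨c, hc⟩ := exists_re_sum_eq l
  rw [charFunDual_apply, charFunDual_apply, integral_map (hr I).aemeasurable (by fun_prop),
    integral_map (hr I).aemeasurable (by fun_prop)]
  have key (ρ : Measure (F → ℂ))
      (hρ : ∀ᵐ b ∂ρ, b (∑ i, c i • (i : F)) = ∑ i, c i * b i) :
      ∫ b, Complex.exp (l (I.restrict b) * Complex.I) ∂ρ
        = ∫ b, Complex.exp (Complex.I * ((b (∑ i, c i • (i : F))).re : ℂ)) ∂ρ := by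
    refine integral_congr_ae ?_
    filter_upwards [hρ] with b hb
    rw [hb, hc, mul_comm]
    rfl
  rw [key ρ₁ (h₁ I c), key ρ₂ (h₂ I c), h]

/-- The received field is a function of a source `X` that is independent of the noise, through a
mean-square continuous field with values in a space of circularly symmetric Gaussian functions of
`X`. -/
structure IsFieldChannel {L : ℝ} {Ω α : Type*} [MeasurableSpace Ω] [MeasurableSpace α]
    {P : Measure Ω} (X : Ω → α) (K : Submodule ℂ (Lp ℂ 2 P)) (E : Destination L → Ω → ℂ)
    (ξ : Destination L → Lp ℂ 2 P) (W : TestFun L → Ω → ℂ) (σ2 : ℝ) : Prop where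
  field : IsContinuousField E ξ
  noise : IsWhiteNoise L σ2 W P
  measurable_source : Measurable X
  indep : IndepFun X (fun ω f => W f ω) P
  isClosed : IsClosed (K : Set (Lp ℂ 2 P))
  isGaussianSpace : IsGaussianSpace K
  mem : ∀ r, ξ r ∈ K
  exists_measurable : ∀ z ∈ K, ∃ g : α → ℂ, Measurable g ∧ (fun ω => g (X ω)) =ᵐ[P] z

namespace IsFieldChannel

variable {L : ℝ} {Ω α : Type*} [MeasurableSpace Ω] [MeasurableSpace α] {P : Measure Ω}
  {X : Ω → α} {K : Submodule ℂ (Lp ℂ 2 P)} {E : Destination L → Ω → ℂ}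
  {ξ : Destination L → Lp ℂ 2 P} {W : TestFun L → Ω → ℂ} {σ2 : ℝ} {lam : ℕ → ℝ}
  {φ : ℕ → Destination L → ℂ}

lemma measurable_received (h : IsFieldChannel X K E ξ W σ2) : Measurable (received E W) := by
  refine measurable_pi_iff.2 fun f => Measurable.add ?_ (h.noise.measurable f)
  refine StronglyMeasurable.measurable (StronglyMeasurable.integral_prod_right'
    (f := fun z : Ω × Destination L => f z.2 * E z.2 z.1) ?_)
  refine ((Lp.stronglyMeasurable f).comp_measurable measurable_snd).mul ?_
  exact (h.field.measurable.comp measurable_swap).stronglyMeasurable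

variable [IsProbabilityMeasure P]

lemma op_mem (h : IsFieldChannel X K E ξ W σ2) (f : TestFun L) : h.field.op f ∈ K :=
  randomIntegral_mem _ (Eventually.of_forall h.field.ae_eq) h.isClosed h.mem f

lemma received_ae_eq (h : IsFieldChannel X K E ξ W σ2) (f : TestFun L) :
    (fun ω => received E W ω f) =ᵐ[P] (h.field.op + h.noise.toCLM) f := by
  rw [add_apply]
  filter_upwards [Lp.coeFn_add (h.field.op f) (h.noise.toCLM f),
    randomIntegral_ae_eq h.field.memLp f, h.noise.circularGaussian.toLp_ae_eq f] with ω h1 h2 h3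
  rw [h1, Pi.add_apply, h.noise.toCLM_apply, h3, received]
  exact congrArg (· + W f ω) h2.symm

/-- Paths need not be linear everywhere; this holds almost surely, also for every law dominated by
that of the received field. -/
lemma ae_received_sum (h : IsFieldChannel X K E ξ W σ2) (I : Finset (TestFun L)) (c : I → ℂ) :
    ∀ᵐ b ∂(P.map (received E W)), b (∑ i, c i • (i : TestFun L)) = ∑ i, c i * b i := by
  rw [ae_map_iff h.measurable_received.aemeasurable
    (measurableSet_eq_fun (by fun_prop) (by fun_prop))]
  have h1 : ∀ᵐ ω ∂P, ∀ i : I, received E W ω i = (h.field.op + h.noise.toCLM) i ω :=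
    ae_all_iff.2 fun i => h.received_ae_eq i
  have h2 : ∀ᵐ ω ∂P, ∀ i : I, (c i • (h.field.op + h.noise.toCLM) i : Lp ℂ 2 P) ω
      = c i * (h.field.op + h.noise.toCLM) i ω :=
    ae_all_iff.2 fun i => Lp.coeFn_smul _ _
  filter_upwards [h.received_ae_eq (∑ i, c i • (i : TestFun L)), h1, h2, Lp.coeFn_finsetSum
    Finset.univ fun i : I => c i • (h.field.op + h.noise.toCLM) i] with ω h0 h1 h2 h3
  rw [h0, map_sum]
  simp_rw [map_smul]
  rw [h3, Finset.sum_apply]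
  exact Finset.sum_congr rfl fun i _ => by rw [h2, h1]

end IsFieldChannel

end Received

/-! ### From the complex channel to a real one. -/

section ComplexToReal

open Filter Topology

/-- The unit vectors `ψ k` and `i ψ k` of a complex space, as a sequence. -/
noncomputable def realFamily {F : Type*} [AddCommGroup F] [Module ℂ F] (ψ : ℕ → F) (n : ℕ) : F :=
  (bif (Equiv.boolProdNatEquivNat.symm n).1 then Complex.I else 1)
    • ψ (Equiv.boolProdNatEquivNat.symm n).2

/-- For the real inner product, `A ψ` and `i A ψ` are orthogonal with the same norm. -/
lemma re_inner_realFamily {F H : Type*} [AddCommGroup F] [Module ℂ F] [NormedAddCommGroup H]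
    [InnerProductSpace ℂ H] {ψ : ℕ → F} (A : F →ₗ[ℂ] H) {lam : ℕ → ℝ}
    (h : ∀ j k, inner ℂ (A (ψ j)) (A (ψ k)) = if j = k then (lam k : ℂ) else 0) (m n : ℕ) :
    (inner ℂ (A (realFamily ψ m)) (A (realFamily ψ n)) : ℂ).re
      = if m = n then lam (Equiv.boolProdNatEquivNat.symm m).2 else 0 := by
  simp only [realFamily]
  simp only [← Equiv.boolProdNatEquivNat.symm.injective.eq_iff (a := m) (b := n)]
  obtain ⟨a, j⟩ := Equiv.boolProdNatEquivNat.symm m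
  obtain ⟨b, k⟩ := Equiv.boolProdNatEquivNat.symm n
  simp only [map_smul, inner_smul_left, inner_smul_right, h, Prod.mk.injEq]
  by_cases hjk : j = k
  · subst hjk
    cases a <;> cases b <;> simp
  · simp [hjk]

/-- Each `k` is counted twice, each time with one half of its term. -/
lemma hasSum_realFamily {f : ℕ → ℝ} {s : ℝ}
    (h : HasSum (fun n => f (Equiv.boolProdNatEquivNat.symm n).2 / 2) s) : HasSum f s := by
  have h1 := ((Equiv.prodComm ℕ Bool).trans Equiv.boolProdNatEquivNat).hasSum_iff.2 h
  refine h1.prod_fiberwise fun k => ?_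
  have h2 := hasSum_fintype fun _ : Bool => f k / 2
  rw [Fintype.sum_bool, add_halves] at h2
  simpa using h2

lemma summable_realFamily {f : ℕ → ℝ} (h : Summable f) (hf : ∀ k, 0 ≤ f k) :
    Summable fun n => f (Equiv.boolProdNatEquivNat.symm n).2 := by
  have h1 : Summable fun p : Bool × ℕ => (1 : ℝ) * f p.2 :=
    Summable.mul_of_nonneg (f := fun _ : Bool => (1 : ℝ)) (Summable.of_finite) h
      (fun _ => zero_le_one) hf
  simp only [one_mul] at h1
  exact Equiv.boolProdNatEquivNat.symm.summable_iff.2 h1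

namespace IsFieldChannel

variable {L : ℝ} {Ω α : Type*} [MeasurableSpace Ω] [MeasurableSpace α] {P : Measure Ω}
  [IsProbabilityMeasure P]
  {X : Ω → α} {K : Submodule ℂ (Lp ℂ 2 P)} {E : Destination L → Ω → ℂ}
  {ξ : Destination L → Lp ℂ 2 P} {W : TestFun L → Ω → ℂ} {σ2 : ℝ} {lam : ℕ → ℝ}
  {φ : ℕ → Destination L → ℂ}

/-- The real part of the signal. -/
noncomputable def signal (h : IsFieldChannel X K E ξ W σ2) : TestFun L →L[ℝ] Lp ℝ 2 P :=
  reLp P ∘L h.field.op.restrictScalars ℝ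

/-- The real part of the noise. -/
noncomputable def noiseRe (h : IsFieldChannel X K E ξ W σ2) : TestFun L →L[ℝ] Lp ℝ 2 P :=
  reLp P ∘L h.noise.toCLM.restrictScalars ℝ

lemma exists_isGaussianChannel (h : IsFieldChannel X K E ξ W σ2) (hσ : 0 < σ2)
    (hM : IsMercerExpansion (autocorr E P) lam φ) :
    ∃ a : TestFun L → α → ℝ, IsGaussianChannel X h.signal h.noiseRe a (σ2 / 2).toNNReal
      (fun n => (lam (Equiv.boolProdNatEquivNat.symm n).2 / 2).toNNReal)
      (realFamily hM.testFun) := by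
  choose g hg hgz using fun f => h.exists_measurable _ (h.op_mem f)
  have hlaw {z : Lp ℂ 2 P} {K : Submodule ℂ (Lp ℂ 2 P)} (hK : IsGaussianSpace K) (hz : z ∈ K) :
      ∫ ω, Complex.exp (Complex.I * (reLp P z ω : ℂ)) ∂P
        = Complex.exp (-(‖reLp P z‖ ^ 2 / 2 : ℝ)) := by
    rw [hK z hz, hK.norm_reLp_sq hz]
    congr 3
    ring
  have horth : Orthonormal ℝ (realFamily hM.testFun) := by
    refine orthonormal_iff_ite.2 fun m n => ?_
    have h1 := re_inner_realFamily (LinearMap.id (R := ℂ)) (lam := fun _ => 1)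
      (ψ := hM.testFun) (fun j k => by
        rw [LinearMap.id_apply, LinearMap.id_apply, orthonormal_iff_ite.1 hM.orthonormal_testFun]
        simp) m n
    rw [real_inner_lp_eq_re]
    exact h1
  refine ⟨fun f x => (g f x).re, h.measurable_source, fun f => (hg f).re, fun f => ?_, fun f => ?_,
    fun f => hlaw h.isGaussianSpace (h.op_mem f),
    fun f => hlaw h.noise.circularGaussian.isGaussianSpace (h.noise.circularGaussian.toLp_mem f),
    fun f₁ f₂ => ?_, horth, fun m n => ?_, fun f => ?_⟩
  · filter_upwards [hgz f, reLp_ae_eq (h.field.op f)] with ω h1 h2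
    rw [h1]
    exact h2.symm
  · have h1 : IndepFun X (fun ω => (W f ω).re) P :=
      h.indep.comp measurable_id (ψ := fun b : TestFun L → ℂ => (b f).re) (by fun_prop)
    refine h1.congr (EventuallyEq.refl _ _) ?_
    filter_upwards [h.noise.circularGaussian.toLp_ae_eq f, reLp_ae_eq (h.noise.toCLM f)] with ω h1 h2
    rw [← h1]
    exact h2.symm
  · have h1 := h.noise.circularGaussian.isGaussianSpace.inner_reLp
      (h.noise.circularGaussian.toLp_mem f₁) (h.noise.circularGaussian.toLp_mem f₂)
    rw [h.noise.inner_toLp, Complex.re_ofReal_mul, ← real_inner_lp_eq_re] at h1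
    rw [Real.coe_toNNReal _ (by positivity), div_mul_eq_mul_div]
    exact h1
  · have h1 := h.isGaussianSpace.inner_reLp (h.op_mem (realFamily hM.testFun m))
      (h.op_mem (realFamily hM.testFun n))
    have h2 := re_inner_realFamily (h.field.op : TestFun L →ₗ[ℂ] Lp ℂ 2 P)
      (hM.inner_op_testFun_op_testFun h.field) m n
    simp only [ContinuousLinearMap.coe_coe] at h2
    rw [h2] at h1
    rw [Real.coe_toNNReal _ (div_nonneg (hM.nonneg h.field _) zero_le_two)]
    refine Eq.trans h1 ?_
    split_ifs <;> simp
  -- Real orthogonality to `ψ k` and `i ψ k` is complex orthogonality to `ψ k`, and there the signal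
  -- operator vanishes.
  · refine hasSum_inner_smul_of_orthonormal horth h.signal fun V hV => ?_
    have h0 : h.field.op V = 0 := by
      refine hM.op_eq_zero h.field fun k => Complex.ext ?_ ?_
      · have h1 := hV (Equiv.boolProdNatEquivNat (false, k))
        rw [real_inner_lp_eq_re] at h1
        simpa [realFamily] using h1
      · have h1 := hV (Equiv.boolProdNatEquivNat (true, k))
        rw [real_inner_lp_eq_re] at h1
        simpa [realFamily, inner_smul_left] using h1
    have h1 : h.signal V = 0 := by
      simp only [signal, ContinuousLinearMap.comp_apply, ContinuousLinearMap.coe_restrictScalars']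
      rw [h0, map_zero]
    rw [h1, smul_zero]

theorem mutualInfo_ne_top_and_hasSum (h : IsFieldChannel X K E ξ W σ2) (hσ : 0 < σ2)
    (hM : IsMercerExpansion (autocorr E P) lam φ) :
    mutualInfo X (received E W) P ≠ ∞ ∧
      HasSum (fun k => Real.log (1 + lam k / σ2)) (mutualInfo X (received E W) P).toReal := by
  obtain ⟨a, ha⟩ := h.exists_isGaussianChannel hσ hM
  have hl : Summable fun n => (lam (Equiv.boolProdNatEquivNat.symm n).2 / 2).toNNReal := by
    refine NNReal.summable_coe.1 ?_
    simp_rw [Real.coe_toNNReal _ (div_nonneg (hM.nonneg h.field _) zero_le_two)]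
    exact (summable_realFamily (hM.summable h.field) (hM.nonneg h.field)).div_const 2
  have hv : (σ2 / 2).toNNReal ≠ 0 := (Real.toNNReal_pos.2 (by positivity)).ne'
  -- Real parts suffice as observations: the imaginary part of the output at `f` is read off almost
  -- surely from the real part at `i f`.
  obtain ⟨h1, h2⟩ := ha.klDiv_ne_top_and_hasSum (Y := received E W) (y := fun f b => (b f).re) hv hl
    h.measurable_received (fun f => by fun_prop) (fun f => by
      have e : (h.signal + h.noiseRe) f = reLp P ((h.field.op + h.noise.toCLM) f) := by
        rw [add_apply, add_apply, map_add]
        rfl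
      rw [e]
      filter_upwards [h.received_ae_eq f, reLp_ae_eq ((h.field.op + h.noise.toCLM) f)] with ω h1 h2
      rw [h2, h1]) (fun ρ₁ ρ₂ _ _ h₁ h₂ heq => measure_ext_of_integral_cexp_re
        (fun I c => h₁.ae_le (h.ae_received_sum I c)) (fun I c => h₂.ae_le (h.ae_received_sum I c))
        heq)
  refine ⟨h1, hasSum_realFamily ?_⟩
  rw [mutualInfo]
  convert h2 using 4 with n
  rw [Real.coe_toNNReal _ (div_nonneg (hM.nonneg h.field _) zero_le_two),
    Real.coe_toNNReal _ (by positivity), div_div_div_cancel_right₀ two_ne_zero]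

end IsFieldChannel

end ComplexToReal

/-! ### Mean-square continuous fields: continuous autocorrelation, kernels, and the Green function.
-/

section Fields

open Filter Topology

variable {Ω : Type*} [MeasurableSpace Ω] {P : Measure Ω}

/-- The squared distance of two values is a combination of values of the autocorrelation. -/
lemma IsCircularGaussian.continuous_toLp {T : Type*} [TopologicalSpace T] {X : T → Ω → ℂ}
    (hX : IsCircularGaussian X P) (hc : Continuous (Function.uncurry (autocorr X P))) :
    Continuous hX.toLp := by
  refine continuous_iff_continuousAt.2 fun t => ?_
  rw [ContinuousAt, tendsto_iff_norm_sub_tendsto_zero]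
  have hn (s t : T) : ‖hX.toLp s - hX.toLp t‖ ^ 2
      = (autocorr X P s s - 2 * autocorr X P t s + autocorr X P t t).re := by
    rw [norm_sub_sq (𝕜 := ℂ), ← hX.inner_toLp, ← hX.inner_toLp, ← hX.inner_toLp,
      ← inner_self_eq_norm_sq (𝕜 := ℂ), ← inner_self_eq_norm_sq (𝕜 := ℂ)]
    simp
  have hc' {f g : T → T} (hf : Continuous f) (hg : Continuous g) :
      Continuous fun s => autocorr X P (f s) (g s) := hc.comp (hf.prodMk hg)
  have h1 : Continuous fun s => ‖hX.toLp s - hX.toLp t‖ := by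
    have : (fun s => ‖hX.toLp s - hX.toLp t‖) = fun s =>
        Real.sqrt (autocorr X P s s - 2 * autocorr X P t s + autocorr X P t t).re := by
      ext s
      rw [← hn, Real.sqrt_sq (norm_nonneg _)]
    rw [this]
    refine Real.continuous_sqrt.comp (Complex.continuous_re.comp ?_)
    exact ((hc' continuous_id continuous_id).sub
      (continuous_const.mul (hc' continuous_const continuous_id))).add continuous_const
  simpa using h1.tendsto t

section Kernel

variable {L : ℝ} {T : Type*} [MeasurableSpace T] {w : Measure T} [IsFiniteMeasure w]
  {h : Destination L → T → ℂ} {C : ℝ}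

lemma memLp_kernel (hm : Measurable (Function.uncurry h)) (hC : ∀ r t, ‖h r t‖ ≤ C)
    (r : Destination L) : MemLp (h r) 2 w :=
  MemLp.of_bound hm.of_uncurry_left.aestronglyMeasurable C (Eventually.of_forall (hC r))

/-- Dominated convergence with a constant bound, integrable because `w` is finite. -/
lemma continuous_toLp_kernel (hm : Measurable (Function.uncurry h)) (hC : ∀ r t, ‖h r t‖ ≤ C)
    (hc : ∀ t, Continuous fun r => h r t) :
    Continuous fun r => (memLp_kernel (w := w) hm hC r).toLp := by
  refine continuous_iff_continuousAt.2 fun r => ?_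
  rw [ContinuousAt, tendsto_iff_edist_tendsto_0]
  have hlim : Tendsto (fun s => ∫⁻ t, ‖h s t - h r t‖ₑ ^ 2 ∂w) (𝓝 r) (𝓝 0) := by
    have h0 : ∫⁻ _ : T, 0 ∂w = 0 := by simp
    rw [← h0]
    refine tendsto_lintegral_filter_of_dominated_convergence
      (fun _ => ENNReal.ofReal (C + C) ^ 2) (Eventually.of_forall fun s => ?_)
      (Eventually.of_forall fun s => Eventually.of_forall fun t => ?_) ?_
      (Eventually.of_forall fun t => ?_)
    · exact (hm.of_uncurry_left.sub hm.of_uncurry_left).enorm.pow_const 2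
    · gcongr
      rw [← ofReal_norm]
      exact ENNReal.ofReal_le_ofReal ((norm_sub_le _ _).trans (add_le_add (hC _ _) (hC _ _)))
    · rw [lintegral_const]
      exact ENNReal.mul_ne_top (by simp) (measure_ne_top _ _)
    · have h1 : Tendsto (fun s => h s t - h r t) (𝓝 r) (𝓝 (h r t - h r t)) :=
        ((hc t).tendsto r).sub_const _
      have h2 := (((ENNReal.continuous_pow 2).comp continuous_enorm).tendsto _).comp h1
      simpa [Function.comp_def] using h2
  have h2 := (ENNReal.continuous_rpow_const (y := (1 / 2 : ℝ))).tendsto 0 |>.comp hlim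
  rw [ENNReal.zero_rpow_of_pos (by norm_num)] at h2
  refine h2.congr fun s => ?_
  rw [Lp.edist_toLp_toLp, Function.comp_apply]
  have := eLpNorm_two_sq w (h s - h r)
  simp only [Pi.sub_apply] at this
  rw [← this, ← ENNReal.rpow_natCast, ← ENNReal.rpow_mul]
  norm_num

lemma isContinuousField_kernel [SFinite P] (hm : Measurable (Function.uncurry h))
    (hC : ∀ r t, ‖h r t‖ ≤ C) (hc : ∀ t, Continuous fun r => h r t) {X : T → Ω → ℂ}
    (hXm : Measurable (Function.uncurry X)) (hX : MemLp (Function.uncurry X) 2 (w.prod P)) :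
    IsContinuousField (fun r ω => ∫ t, h r t * X t ω ∂w)
      fun r => randomIntegral hX (memLp_kernel hm hC r).toLp where
  measurable := by
    refine StronglyMeasurable.measurable (StronglyMeasurable.integral_prod_right'
      (f := fun z : (Destination L × Ω) × T => h z.1.1 z.2 * X z.2 z.1.2) ?_)
    refine Measurable.stronglyMeasurable ?_
    exact (hm.comp (measurable_fst.fst.prodMk measurable_snd)).mul
      (hXm.comp (measurable_snd.prodMk measurable_fst.snd))
  ae_eq r := by
    refine (randomIntegral_ae_eq hX _).trans (Eventually.of_forall fun ω => ?_)
    refine integral_congr_ae ?_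
    filter_upwards [(memLp_kernel (w := w) hm hC r).coeFn_toLp] with t ht
    rw [ht]
  continuous := (randomIntegral hX).continuous.comp (continuous_toLp_kernel hm hC hc)

end Kernel

section Green

variable {Z₀ wl d : ℝ}

lemma continuous_green (hw : 0 < wl) (hd : 0 < d) : Continuous (green Z₀ wl d) := by
  have hρ (x : ℝ) : Real.sqrt (x ^ 2 + d ^ 2) ≠ 0 := (Real.sqrt_pos.2 (by positivity)).ne'
  have hκ : 2 * Real.pi / wl ≠ 0 := by positivity
  have hρ' (x : ℝ) : (Real.sqrt (x ^ 2 + d ^ 2) : ℂ) ≠ 0 := by exact_mod_cast hρ x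
  have hw' : (wl : ℂ) ≠ 0 := by exact_mod_cast hw.ne'
  unfold green
  dsimp only
  refine Continuous.mul (Continuous.div (by fun_prop) (by fun_prop) fun x => ?_) ?_
  · exact mul_ne_zero (mul_ne_zero two_ne_zero hw') (hρ' x)
  · refine (Continuous.add ?_ (Continuous.mul ?_ ?_)).sub ?_
    · exact Complex.continuous_ofReal.comp (Continuous.div (by fun_prop) (by fun_prop)
        fun x => pow_ne_zero 2 (hρ x))
    · refine Continuous.div (by fun_prop) (by fun_prop) fun x => ?_
      exact_mod_cast mul_ne_zero hκ (hρ x)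
    · exact Complex.continuous_ofReal.comp (Continuous.div (by fun_prop) (by fun_prop)
        fun x => pow_ne_zero 2 (hρ x))
    · refine Complex.continuous_ofReal.comp (Continuous.mul (Continuous.div (by fun_prop)
        (by fun_prop) fun x => ?_) (Continuous.div (by fun_prop) (by fun_prop)
        fun x => pow_ne_zero 2 (hρ x)))
      exact mul_ne_zero (pow_ne_zero 2 hκ) (pow_ne_zero 2 (hρ x))

/-- Decay of order `1 / ρ²`: the slowest term is the prefactor `1 / ρ` times `1 / (κ ρ)`, and `|d² -
2 x²| ≤ 2 ρ²`. -/
lemma exists_norm_green_mul_le (hw : 0 < wl) (hd : 0 < d) :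
    ∃ C, 0 ≤ C ∧ ∀ x, ‖green Z₀ wl d x‖ * (x ^ 2 + d ^ 2) ≤ C := by
  set κ := 2 * Real.pi / wl with hκdef
  have hκ : 0 < κ := by positivity
  refine ⟨|Z₀| / (2 * wl) * (d + 2 / κ + 2 / (κ ^ 2 * d)), by positivity, fun x => ?_⟩
  set ρ := Real.sqrt (x ^ 2 + d ^ 2) with hρdef
  have hρ2 : ρ ^ 2 = x ^ 2 + d ^ 2 := Real.sq_sqrt (by positivity)
  have hρ : 0 < ρ := Real.sqrt_pos.2 (by positivity)
  have hdρ : d ≤ ρ := Real.le_sqrt_of_sq_le (by nlinarith [sq_nonneg x])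
  have hq : |(d ^ 2 - 2 * x ^ 2) / ρ ^ 2| ≤ 2 := by
    rw [abs_div, abs_of_pos (pow_pos hρ 2), div_le_iff₀ (pow_pos hρ 2), hρ2, abs_le]
    constructor <;> nlinarith [sq_nonneg x, sq_nonneg d]
  have h1 : ‖(-Complex.I * Z₀ * Complex.exp (Complex.I * κ * ρ)) / (2 * wl * ρ)‖
      = |Z₀| / (2 * wl * ρ) := by
    have : Complex.I * κ * ρ = ((κ * ρ : ℝ) : ℂ) * Complex.I := by
      push_cast
      ring
    rw [this, norm_div, norm_mul, norm_mul, Complex.norm_exp_ofReal_mul_I]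
    simp [abs_of_pos hw, abs_of_pos hρ]
  have h2 : ‖((d ^ 2 / ρ ^ 2 : ℝ) : ℂ)
      + Complex.I / (κ * ρ : ℝ) * ((d ^ 2 - 2 * x ^ 2) / ρ ^ 2 : ℝ)
      - (1 / (κ ^ 2 * ρ ^ 2) * ((d ^ 2 - 2 * x ^ 2) / ρ ^ 2) : ℝ)‖
      ≤ d ^ 2 / ρ ^ 2 + 1 / (κ * ρ) * 2 + 1 / (κ ^ 2 * ρ ^ 2) * 2 := by
    refine (norm_sub_le _ _).trans (add_le_add ((norm_add_le _ _).trans (add_le_add ?_ ?_)) ?_)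
    · rw [Complex.norm_real, Real.norm_eq_abs, abs_of_nonneg (by positivity)]
    · rw [norm_mul, norm_div, Complex.norm_I, Complex.norm_real, Complex.norm_real,
        Real.norm_eq_abs, Real.norm_eq_abs, abs_of_pos (mul_pos hκ hρ)]
      gcongr
    · rw [Complex.norm_real, Real.norm_eq_abs, abs_mul, abs_of_pos (by positivity)]
      gcongr
  have h3 : ‖green Z₀ wl d x‖ ≤ |Z₀| / (2 * wl * ρ)
      * (d ^ 2 / ρ ^ 2 + 1 / (κ * ρ) * 2 + 1 / (κ ^ 2 * ρ ^ 2) * 2) := by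
    unfold green
    dsimp only
    rw [norm_mul, ← hκdef, ← hρdef, h1]
    gcongr
  rw [← hρ2]
  calc ‖green Z₀ wl d x‖ * ρ ^ 2 ≤ |Z₀| / (2 * wl * ρ)
      * (d ^ 2 / ρ ^ 2 + 1 / (κ * ρ) * 2 + 1 / (κ ^ 2 * ρ ^ 2) * 2) * ρ ^ 2 := by gcongr
    _ = |Z₀| / (2 * wl) * (d * (d / ρ) + 2 / κ + 2 / (κ ^ 2 * ρ)) := by
      field_simp
    _ ≤ |Z₀| / (2 * wl) * (d + 2 / κ + 2 / (κ ^ 2 * d)) := by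
      have : d * (d / ρ) ≤ d := mul_le_of_le_one_right hd.le ((div_le_one hρ).2 hdρ)
      gcongr

/-- The decay compensates the factor `1 + s²` uniformly over the bounded destination, so the kernel
is bounded with respect to the finite measure `ds / (1 + s²)`. -/
lemma exists_norm_green_sub_mul_le (L : ℝ) (hw : 0 < wl) (hd : 0 < d) :
    ∃ C, ∀ (r : Destination L) (s : ℝ), ‖green Z₀ wl d (r - s) * ((1 + s ^ 2 : ℝ) : ℂ)‖ ≤ C := by
  obtain ⟨C, hC0, hC⟩ := exists_norm_green_mul_le (Z₀ := Z₀) hw hd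
  refine ⟨C * (2 + (1 + 2 * L ^ 2) / d ^ 2), fun r s => ?_⟩
  have h1 : 1 + s ^ 2 ≤ ((r - s) ^ 2 + d ^ 2) * (2 + (1 + 2 * L ^ 2) / d ^ 2) := by
    have hr : (r : ℝ) ^ 2 ≤ L ^ 2 := pow_le_pow_left₀ r.2.1 r.2.2 2
    have h2 : 1 + 2 * L ^ 2 ≤ ((r - s) ^ 2 + d ^ 2) * ((1 + 2 * L ^ 2) / d ^ 2) := by
      rw [← mul_div_assoc, le_div_iff₀ (by positivity)]
      nlinarith [mul_nonneg (sq_nonneg ((r : ℝ) - s)) (by positivity : 0 ≤ 1 + 2 * L ^ 2)]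
    -- The square accounts for `s² ≤ 2 (r - s)² + 2 r²`.
    nlinarith [sq_nonneg (s - 2 * (r : ℝ)), sq_nonneg d]
  rw [norm_mul, Complex.norm_real, Real.norm_eq_abs, abs_of_pos (by positivity)]
  calc _ ≤ ‖green Z₀ wl d (r - s)‖ * (((r - s) ^ 2 + d ^ 2) * (2 + (1 + 2 * L ^ 2) / d ^ 2)) := by
        gcongr
    _ ≤ _ := by
        rw [← mul_assoc]
        gcongr
        exact hC _

end Green

section Source

variable {S : Set ℝ}

/-- The measure `ds / (1 + s ^ 2)` on a part of the line. -/
noncomputable def cauchyWeight (S : Set ℝ) : Measure S :=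
  (volume : Measure S).withDensity fun s => ((1 + (s : ℝ) ^ 2)⁻¹.toNNReal : ℝ≥0∞)

lemma isFiniteMeasure_cauchyWeight (hS : MeasurableSet S) : IsFiniteMeasure (cauchyWeight S) := by
  refine isFiniteMeasure_withDensity ?_
  have h1 : ∫⁻ s : S, ((1 + (s : ℝ) ^ 2)⁻¹.toNNReal : ℝ≥0∞)
      = ∫⁻ s in S, ENNReal.ofReal (1 + s ^ 2)⁻¹ :=
    lintegral_subtype_comap hS fun s : ℝ => ENNReal.ofReal (1 + s ^ 2)⁻¹
  rw [h1]
  exact ((setLIntegral_le_lintegral _ _).trans_lt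
    (integrable_inv_one_add_sq.lintegral_lt_top)).ne

lemma memLp_cauchyWeight [SFinite P] {J : S → Ω → ℂ} (hm : Measurable (Function.uncurry J))
    (hJ : ∫⁻ s : S, (∫⁻ ω, ‖J s ω‖ₑ ^ 2 ∂P) * ENNReal.ofReal (1 + (s : ℝ) ^ 2)⁻¹ ≠ ∞) :
    MemLp (Function.uncurry J) 2 ((cauchyWeight S).prod P) := by
  refine ⟨hm.aestronglyMeasurable,
    (ENNReal.pow_lt_top_iff.1 (?_ : _ ^ 2 < ∞)).resolve_right two_ne_zero⟩
  have hm2 : Measurable fun z : S × Ω => ‖Function.uncurry J z‖ₑ ^ 2 := hm.enorm.pow_const 2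
  rw [eLpNorm_two_sq, lintegral_prod _ hm2.aemeasurable, cauchyWeight,
    lintegral_withDensity_eq_lintegral_mul _ (by fun_prop) hm2.lintegral_prod_right']
  refine lt_of_le_of_lt (le_of_eq (lintegral_congr fun s => ?_)) hJ.lt_top
  rw [Pi.mul_apply, mul_comm]
  rfl

/-- The weight of the measure is moved into the kernel, which puts the field in the setting of a
bounded kernel on a finite measure space. -/
lemma inducedField_eq {Ω : Type*} (L Z₀ wl d : ℝ) (J : S → Ω → ℂ) :
    inducedField L Z₀ wl d J = fun (r : Destination L) ω => ∫ s : S,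
      green Z₀ wl d ((r : ℝ) - s) * ((1 + (s : ℝ) ^ 2 : ℝ) : ℂ) * J s ω ∂(cauchyWeight S) := by
  ext r ω
  rw [cauchyWeight, integral_withDensity_eq_integral_smul (by fun_prop), inducedField]
  congr with s
  have h1 : (0 : ℝ) < 1 + (s : ℝ) ^ 2 := by positivity
  have h2 : ((1 + (s : ℝ) ^ 2 : ℝ) : ℂ) ≠ 0 := by exact_mod_cast h1.ne'
  rw [NNReal.smul_def, Real.coe_toNNReal _ (by positivity), Complex.real_smul]
  push_cast at h2 ⊢
  field_simp

end Source

end Fields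

end EMCapacity

/-- Mutual information over a finite-length destination with white Gaussian noise, from the Mercer
eigenvalues of the received field. The first part is about an arbitrary Gaussian field `E` with
continuous autocorrelation; the second one about the field induced by a Gaussian current density on
a source `S` in a parallel line (for instance `S = [0, L]`, or `S = ℝ` with a stationary `J`; the
power condition holds for every finite-power `J` on a bounded `S`, and for every stationary one). -/
theorem mainTheorem3 {Ω : Type*} [MeasurableSpace Ω] (P : Measure Ω) [IsProbabilityMeasure P]
    (L n₀ : ℝ) (hL : 0 < L) (hn₀ : 0 < n₀)
    (W : EMCapacity.TestFun L → Ω → ℂ) (hW : EMCapacity.IsWhiteNoise L (n₀ / 2) W P) :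
    (∀ E : EMCapacity.Destination L → Ω → ℂ,
      Measurable (Function.uncurry E) →
      EMCapacity.IsCircularGaussian E P →
      Continuous (Function.uncurry (EMCapacity.autocorr E P)) →
      IndepFun (fun ω r => E r ω) (fun ω f => W f ω) P →
      (∃ lam φ, EMCapacity.IsMercerExpansion (EMCapacity.autocorr E P) lam φ) ∧
      ∀ lam φ, EMCapacity.IsMercerExpansion (EMCapacity.autocorr E P) lam φ →
        EMCapacity.mutualInfo (fun ω r => E r ω) (EMCapacity.received E W) P ≠ ∞ ∧
        HasSum (fun k => Real.log (1 + lam k / (n₀ / 2)))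
          (EMCapacity.mutualInfo (fun ω r => E r ω) (EMCapacity.received E W) P).toReal) ∧
    (∀ (Z₀ wl d : ℝ) (S : Set ℝ) (J : S → Ω → ℂ) (E : EMCapacity.Destination L → Ω → ℂ),
      0 < wl → 0 < d → MeasurableSet S →
      Measurable (Function.uncurry J) →
      EMCapacity.IsCircularGaussian J P →
      ∫⁻ s : S, (∫⁻ ω, ‖J s ω‖ₑ ^ 2 ∂P) * ENNReal.ofReal (1 + (s : ℝ) ^ 2)⁻¹ ≠ ∞ →
      IndepFun (fun ω s => J s ω) (fun ω f => W f ω) P →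
      E = EMCapacity.inducedField L Z₀ wl d J →
      (∃ lam φ, EMCapacity.IsMercerExpansion (EMCapacity.autocorr E P) lam φ) ∧
      ∀ lam φ, EMCapacity.IsMercerExpansion (EMCapacity.autocorr E P) lam φ →
        EMCapacity.mutualInfo (fun ω s => J s ω) (EMCapacity.received E W) P ≠ ∞ ∧
        HasSum (fun k => Real.log (1 + lam k / (n₀ / 2)))
          (EMCapacity.mutualInfo (fun ω s => J s ω) (EMCapacity.received E W) P).toReal) := by
  refine ⟨fun E hE hG hc hind => ?_, fun Z₀ wl d S J E hwl hd hS hJm hG hJ hind hEq => ?_⟩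
  · have h : EMCapacity.IsFieldChannel (fun ω r => E r ω) hG.gaussianSpace E hG.toLp W (n₀ / 2) :=
      { field := ⟨hE, hG.toLp_ae_eq, hG.continuous_toLp hc⟩
        noise := hW
        measurable_source := measurable_pi_iff.2 fun r => hE.of_uncurry_left
        indep := hind
        isClosed := hG.isClosed_gaussianSpace
        isGaussianSpace := hG.isGaussianSpace
        mem := hG.toLp_mem
        exists_measurable := fun z hz => hG.exists_measurable_comp
          (measurable_pi_iff.2 fun r => hE.of_uncurry_left) hz }
    exact ⟨h.field.exists_isMercerExpansion hL,
      fun lam φ hM => h.mutualInfo_ne_top_and_hasSum (by positivity) hM⟩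
  · have hfin := EMCapacity.isFiniteMeasure_cauchyWeight hS
    obtain ⟨C, hC⟩ := EMCapacity.exists_norm_green_sub_mul_le (Z₀ := Z₀) L hwl hd
    have hg := EMCapacity.continuous_green (Z₀ := Z₀) hwl hd
    have hX := EMCapacity.memLp_cauchyWeight hJm hJ
    rw [EMCapacity.inducedField_eq] at hEq
    have hfield := EMCapacity.isContinuousField_kernel (L := L)
      (h := fun r (s : S) => EMCapacity.green Z₀ wl d ((r : ℝ) - s) * ((1 + (s : ℝ) ^ 2 : ℝ) : ℂ))
      (by fun_prop) (fun r s => hC r s) (fun s => by fun_prop) hJm hX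
    rw [← hEq] at hfield
    have h : EMCapacity.IsFieldChannel (fun ω s => J s ω) hG.gaussianSpace E _ W (n₀ / 2) :=
      { field := hfield
        noise := hW
        measurable_source := measurable_pi_iff.2 fun s => hJm.of_uncurry_left
        indep := hind
        isClosed := hG.isClosed_gaussianSpace
        isGaussianSpace := hG.isGaussianSpace
        -- The induced field lies in the closed span of the current, so it is Gaussian and a
        -- function of the source `J`.
        mem := fun r => EMCapacity.randomIntegral_mem hX (Filter.Eventually.of_forall hG.toLp_ae_eq)
          hG.isClosed_gaussianSpace hG.toLp_mem _
        exists_measurable := fun z hz => hG.exists_measurable_comp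
          (measurable_pi_iff.2 fun s => hJm.of_uncurry_left) hz }
    exact ⟨h.field.exists_isMercerExpansion hL,
      fun lam φ hM => h.mutualInfo_ne_top_and_hasSum (by positivity) hM⟩
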